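/- **Theorem (Bott connection on half-forms).** Let $\mathcal G\rightrightarrows M$ be a Lie groupoid with source $\mathsf s$, target $\mathsf t$, multiplication $\mathsf m:\mathcal G_2\to\mathcal G$ (where $\mathcal G_2$ is the manifold of composable pairs) and inversion $\mathrm{inv}$. Write $T^{\mathsf t}_{\mathbb C}\mathcal G$ and $T^{\mathsf s}_{\mathbb C}\mathcal G$ for the complexified kernels of $T\mathsf t$ and $T\mathsf s$. Let $\mathcal P\subset T_{\mathbb C}\mathcal G$ be a polarization of $\mathcal G$, i.e. a smooth complex distribution (subbundle) that is involutive, multiplicative ($T\mathsf m\big((\mathcal P\times\mathcal P)\cap T_{\mathbb C}\mathcal G_2\big)_{(\gamma,\eta)}=\mathcal P_{\gamma\eta}$ for all composable $(\gamma,\eta)$) and Hermitian ($T\,\mathrm{inv}(\mathcal P)=\overline{\mathcal P}$). Assume that $T^{\mathsf t}_{\mathbb C}\mathcal G\cap\mathcal P$ has constant rank, so that the complex line bundle $$\Omega_{\mathcal P}:=\Lambda^{\max}\Big(T^{\mathsf t}_{\mathbb C}\mathcal G/(T^{\mathsf t}_{\mathbb C}\mathcal G\cap\mathcal P)\ \oplus\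 T^{\mathsf s}_{\mathbb C}\mathcal G/(T^{\mathsf s}_{\mathbb C}\mathcal G\cap\mathcal P)\Big)^*$$ is defined. For a distribution $\mathcal F\subset T_{\mathbb C}\mathcal G$ let $\mathcal F^\perp\subset T^*_{\mathbb C}\mathcal G$ be its annihilator. A $\mathcal P$-connection on a complex vector bundle is a partial connection $\nabla_X s$ defined for $X\in\mathcal P$; it is flat if $\nabla_X\nabla_Y-\nabla_Y\nabla_X=\nabla_{[X,Y]}$ for all local sections $X,Y$ of $\mathcal P$. The Bott connection is the $\mathcal P$-connection on $\mathcal P^\perp$ given by $\nabla_X\xi=\mathcal L_X\xi$, that is, $(\nabla_X\xi)(Y)=X(\xi(Y))-\xi([X,Y])$. Then: 1. $\mathcal P+T^{\mathsf t}_{\mathbb C}\mathcal G$ and $\mathcal P+T^{\mathsf s}_{\mathbb C}\mathcal G$ are involutive distributions. 2. The Bott connection is a flat $\mathcal P$-connection on $\mathcal P^\perp$. It preserves $(\mathcal P+T^{\mathsf t}_{\mathbb C}\mathcal G)^\perp$ and $(\mathcal P+T^{\mathsf s}_{\mathbb C}\mathcal G)^\perp$. Through restriction of covectors, $\mathcal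 P^\perp\to\mathcal P^\perp/(\mathcal P+T^{\mathsf t}_{\mathbb C}\mathcal G)^\perp\cong\big(T^{\mathsf t}_{\mathbb C}\mathcal G/(T^{\mathsf t}_{\mathbb C}\mathcal G\cap\mathcal P)\big)^*$, it induces a unique $\mathcal P$-connection on $\big(T^{\mathsf t}_{\mathbb C}\mathcal G/(T^{\mathsf t}_{\mathbb C}\mathcal G\cap\mathcal P)\big)^*$, and this connection is flat; the same holds with $\mathsf s$ in place of $\mathsf t$. 3. There is a unique $\mathcal P$-connection on $\Omega_{\mathcal P}$ such that, for all local sections $\beta_1,\dots,\beta_n$ of the dual of the direct sum above ($n$ its rank), $\nabla_X(\beta_1\wedge\dots\wedge\beta_n)=\sum_i\beta_1\wedge\dots\wedge\nabla_X\beta_i\wedge\dots\wedge\beta_n$, where $\nabla\beta_i$ is taken with respect to the direct sum of the two connections of part 2. It is flat. 4. For every square root of $\Omega_{\mathcal P}$, i.e. every smooth complex line bundle $\Omega^{1/2}_{\mathcal P}$ with a smooth isomorphism $\Omega^{1/2}_{\mathcal P}\otimes\Omega^{1/2}_{\mathcal P}\cong\Omega_{\mathcal P}$, there is a unique $\mathcal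 P$-connection on $\Omega^{1/2}_{\mathcal P}$ with $\nabla_X(a\otimes b)=\nabla_Xa\otimes b+a\otimes\nabla_Xb$ for all local sections $a,b$, the left-hand side being the connection on $\Omega_{\mathcal P}$. It is flat. -/

import Mathlib

universe uL

open scoped Manifold ContDiff TensorProduct Topology

noncomputable section

namespace HalfForms

/-! ### Complexification of a real vector space -/

section Complexification

variable {V : Type*} [AddCommGroup V] [Module ℝ V]

/-- The real part `ℂ ⊗ V → V`. -/
def rePart : ℂ ⊗[ℝ] V →ₗ[ℝ] V :=
  (TensorProduct.lid ℝ V).toLinearMap ∘ₗ LinearMap.rTensor V Complex.reLm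

/-- The imaginary part `ℂ ⊗ V → V`. -/
def imPart : ℂ ⊗[ℝ] V →ₗ[ℝ] V :=
  (TensorProduct.lid ℝ V).toLinearMap ∘ₗ LinearMap.rTensor V Complex.imLm

/-- Complex conjugation of `ℂ ⊗ V`. -/
def conjC : ℂ ⊗[ℝ] V →ₗ[ℝ] ℂ ⊗[ℝ] V :=
  LinearMap.rTensor V Complex.conjAe.toLinearMap

end Complexification

/-! ### Complex vector fields and complex distributions on a manifold -/

section Fields

variable (E : Type*) [NormedAddCommGroup E] [NormedSpace ℝ E]
  {G : Type*} [TopologicalSpace G] [ChartedSpace E G]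

/-- The fibre at `γ` of the complexified tangent bundle. -/
abbrev CTangent (γ : G) : Type _ := ℂ ⊗[ℝ] TangentSpace 𝓘(ℝ, E) γ

/-- `f` is a smooth complex-valued function on the set `U`. -/
def SmoothFun (f : G → ℂ) (U : Set G) : Prop :=
  ContMDiffOn 𝓘(ℝ, E) 𝓘(ℝ, ℂ) ∞ f U

variable {E} [IsManifold 𝓘(ℝ, E) ∞ G]

/-- `X` is a smooth complex vector field on the set `U`
(its values outside `U` are irrelevant). -/
def SmoothField (X : ∀ γ : G, CTangent E γ) (U : Set G) : Prop :=
  ContMDiffOn 𝓘(ℝ, E) (𝓘(ℝ, E).prod 𝓘(ℝ, E)) ∞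
      (fun γ => (⟨γ, rePart (X γ)⟩ : TangentBundle 𝓘(ℝ, E) G)) U ∧
    ContMDiffOn 𝓘(ℝ, E) (𝓘(ℝ, E).prod 𝓘(ℝ, E)) ∞
      (fun γ => (⟨γ, imPart (X γ)⟩ : TangentBundle 𝓘(ℝ, E) G)) U

/-- The Lie bracket of complex vector fields: the `ℂ`-bilinear extension of the real one. -/
def cBracket (X Y : ∀ γ : G, CTangent E γ) (γ : G) : CTangent E γ :=
  (1 : ℂ) ⊗ₜ[ℝ]
      (VectorField.mlieBracket 𝓘(ℝ, E) (fun x => rePart (X x)) (fun x => rePart (Y x)) γ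
        - VectorField.mlieBracket 𝓘(ℝ, E) (fun x => imPart (X x)) (fun x => imPart (Y x)) γ)
    + Complex.I ⊗ₜ[ℝ]
      (VectorField.mlieBracket 𝓘(ℝ, E) (fun x => rePart (X x)) (fun x => imPart (Y x)) γ
        + VectorField.mlieBracket 𝓘(ℝ, E) (fun x => imPart (X x)) (fun x => rePart (Y x)) γ)

/-- The derivative of a complex-valued function along complex tangent vectors at `γ`. -/
def cDeriv (f : G → ℂ) (γ : G) : CTangent E γ →ₗ[ℂ] ℂ :=
  LinearMap.liftBaseChange ℂ
    (ContinuousLinearMap.toLinearMap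
      (show TangentSpace 𝓘(ℝ, E) γ →L[ℝ] ℂ from mfderiv 𝓘(ℝ, E) 𝓘(ℝ, ℂ) f γ))

/-- A smooth complex distribution: a family of subspaces of the complexified tangent spaces that
is locally spanned by a smooth frame, i.e. a smooth subbundle of the complexified tangent bundle. -/
def IsDistribution (P : ∀ γ : G, Submodule ℂ (CTangent E γ)) : Prop :=
  ∀ γ₀ : G, ∃ U : Set G, IsOpen U ∧ γ₀ ∈ U ∧
    ∃ (r : ℕ) (e : Fin r → ∀ γ : G, CTangent E γ),
      (∀ i, SmoothField (e i) U) ∧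
      ∀ γ ∈ U, LinearIndependent ℂ (fun i => e i γ) ∧
        Submodule.span ℂ (Set.range fun i => e i γ) = P γ

/-- An involutive distribution: a smooth subbundle whose local sections are closed under
brackets. -/
structure IsInvolutive (P : ∀ γ : G, Submodule ℂ (CTangent E γ)) : Prop where
  isDistribution : IsDistribution P
  bracket_mem : ∀ (U : Set G), IsOpen U → ∀ X Y : ∀ γ : G, CTangent E γ,
    SmoothField X U → SmoothField Y U → (∀ γ ∈ U, X γ ∈ P γ) → (∀ γ ∈ U, Y γ ∈ P γ) →
      ∀ γ ∈ U, cBracket X Y γ ∈ P γ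

/-- `X`, a section of the distribution `P`, is smooth on `U`. -/
def SmoothIn (P : ∀ γ : G, Submodule ℂ (CTangent E γ)) (X : ∀ γ : G, P γ) (U : Set G) : Prop :=
  SmoothField (fun γ => (X γ : CTangent E γ)) U

/-- The complexified derivative of a map between manifolds. -/
def cMap {F : Type*} [NormedAddCommGroup F] [NormedSpace ℝ F]
    {M : Type*} [TopologicalSpace M] [ChartedSpace F M] (f : G → M) (γ : G) :
    CTangent E γ →ₗ[ℂ] CTangent F (f γ) :=
  LinearMap.baseChange ℂ
    ((mfderiv 𝓘(ℝ, E) 𝓘(ℝ, F) f γ :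
      TangentSpace 𝓘(ℝ, E) γ →L[ℝ] TangentSpace 𝓘(ℝ, F) (f γ)) :
      TangentSpace 𝓘(ℝ, E) γ →ₗ[ℝ] TangentSpace 𝓘(ℝ, F) (f γ))

end Fields

/-! ### Partial connections -/

section Connections

variable {E : Type*} [NormedAddCommGroup E] [NormedSpace ℝ E]
  {G : Type*} [TopologicalSpace G] [ChartedSpace E G] [IsManifold 𝓘(ℝ, E) ∞ G]

/-- `D` is a `P`-connection on the complex vector bundle with fibres `V γ`, whose smooth local
sections are given by `Sm` (`Sm s U`: the section `s` is smooth on the open set `U`).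
The value `D s γ v` is the covariant derivative of `s` at `γ` along `v ∈ P γ`; only its values on
sections that are smooth near `γ` are meaningful. -/
structure IsPConnection (P : ∀ γ : G, Submodule ℂ (CTangent E γ))
    {V : G → Type*} [∀ γ, AddCommGroup (V γ)] [∀ γ, Module ℂ (V γ)]
    (Sm : (∀ γ, V γ) → Set G → Prop)
    (D : (∀ γ, V γ) → ∀ γ, P γ →ₗ[ℂ] V γ) : Prop where
  add : ∀ U : Set G, IsOpen U → ∀ s s' : ∀ γ, V γ, Sm s U → Sm s' U →
    ∀ γ ∈ U, D (fun x => s x + s' x) γ = D s γ + D s' γ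
  leibniz : ∀ U : Set G, IsOpen U → ∀ (f : G → ℂ) (s : ∀ γ, V γ), SmoothFun E f U → Sm s U →
    ∀ γ ∈ U, ∀ v : P γ,
      D (fun x => f x • s x) γ v = f γ • D s γ v + cDeriv f γ (v : CTangent E γ) • s γ
  smooth : ∀ U : Set G, IsOpen U → ∀ (X : ∀ γ, P γ) (s : ∀ γ, V γ), SmoothIn P X U → Sm s U →
    Sm (fun γ => D s γ (X γ)) U

/-- Vanishing curvature: `∇_X ∇_Y s - ∇_Y ∇_X s = ∇_[X,Y] s`. -/
def IsFlat (P : ∀ γ : G, Submodule ℂ (CTangent E γ))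
    {V : G → Type*} [∀ γ, AddCommGroup (V γ)] [∀ γ, Module ℂ (V γ)]
    (Sm : (∀ γ, V γ) → Set G → Prop)
    (D : (∀ γ, V γ) → ∀ γ, P γ →ₗ[ℂ] V γ) : Prop :=
  ∀ U : Set G, IsOpen U → ∀ X Y Z : ∀ γ, P γ, SmoothIn P X U → SmoothIn P Y U →
    (∀ γ ∈ U, (Z γ : CTangent E γ) = cBracket (fun x => (X x : CTangent E x))
      (fun x => (Y x : CTangent E x)) γ) →
    ∀ s : ∀ γ, V γ, Sm s U → ∀ γ ∈ U,
      D (fun x => D s x (Y x)) γ (X γ) - D (fun x => D s x (X x)) γ (Y γ) = D s γ (Z γ)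

/-- `D` is a flat `P`-connection with the property `C`, and on smooth sections it is the only
`P`-connection with this property. -/
structure IsTheFlatConnection (P : ∀ γ : G, Submodule ℂ (CTangent E γ))
    {V : G → Type*} [∀ γ, AddCommGroup (V γ)] [∀ γ, Module ℂ (V γ)]
    (Sm : (∀ γ, V γ) → Set G → Prop)
    (C : ((∀ γ, V γ) → ∀ γ, P γ →ₗ[ℂ] V γ) → Prop)
    (D : (∀ γ, V γ) → ∀ γ, P γ →ₗ[ℂ] V γ) : Prop where
  isPConnection : IsPConnection P Sm D
  isFlat : IsFlat P Sm D
  property : C D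
  unique : ∀ D' : (∀ γ, V γ) → ∀ γ, P γ →ₗ[ℂ] V γ, IsPConnection P Sm D' → C D' →
    ∀ U : Set G, IsOpen U → ∀ s : ∀ γ, V γ, Sm s U → ∀ γ ∈ U, D' s γ = D s γ

end Connections

/-! ### The Bott connection and the bundles it acts on -/

section Bott

variable {E : Type*} [NormedAddCommGroup E] [NormedSpace ℝ E]
  {G : Type*} [TopologicalSpace G] [ChartedSpace E G] [IsManifold 𝓘(ℝ, E) ∞ G]

/-- The fibre of the conormal bundle of `P`: complex covectors that annihilate `P γ`. -/
abbrev Conormal (P : ∀ γ : G, Submodule ℂ (CTangent E γ)) (γ : G) :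
    Submodule ℂ (Module.Dual ℂ (CTangent E γ)) :=
  (P γ).dualAnnihilator

/-- Smooth sections of the conormal bundle over the open set `U`: complex `1`-forms whose values on
smooth local vector fields are smooth. -/
def SmoothConormal (P : ∀ γ : G, Submodule ℂ (CTangent E γ)) (ξ : ∀ γ : G, Conormal P γ)
    (U : Set G) : Prop :=
  ∀ V ⊆ U, IsOpen V → ∀ Y : ∀ γ : G, CTangent E γ, SmoothField Y V →
    SmoothFun E (fun γ => (ξ γ : Module.Dual ℂ (CTangent E γ)) (Y γ)) V

/-- `D` is given by the Lie derivative: `(∇_X ξ)(Y) = (L_X ξ)(Y) = X(ξ(Y)) - ξ([X, Y])` for every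
local vector field `Y`. -/
def IsBott (P : ∀ γ : G, Submodule ℂ (CTangent E γ))
    (D : (∀ γ : G, Conormal P γ) → ∀ γ : G, P γ →ₗ[ℂ] Conormal P γ) : Prop :=
  ∀ U : Set G, IsOpen U → ∀ (X : ∀ γ, P γ) (ξ : ∀ γ : G, Conormal P γ)
    (Y : ∀ γ : G, CTangent E γ), SmoothIn P X U → SmoothConormal P ξ U → SmoothField Y U →
    ∀ γ ∈ U, (D ξ γ (X γ) : Module.Dual ℂ (CTangent E γ)) (Y γ) =
      cDeriv (fun x => (ξ x : Module.Dual ℂ (CTangent E x)) (Y x)) γ (X γ : CTangent E γ)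
        - (ξ γ : Module.Dual ℂ (CTangent E γ))
            (cBracket (fun x => (X x : CTangent E x)) Y γ)

/-- The `P`-connection `D` on the conormal bundle of `P` maps sections of the annihilator of the
larger distribution `Q` to sections of the annihilator of `Q`. -/
def PreservesAnnihilator (P Q : ∀ γ : G, Submodule ℂ (CTangent E γ))
    (D : (∀ γ : G, Conormal P γ) → ∀ γ : G, P γ →ₗ[ℂ] Conormal P γ) : Prop :=
  ∀ U : Set G, IsOpen U → ∀ ξ : ∀ γ : G, Conormal P γ, SmoothConormal P ξ U →
    (∀ γ ∈ U, (ξ γ : Module.Dual ℂ (CTangent E γ)) ∈ (Q γ).dualAnnihilator) →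
    ∀ γ ∈ U, ∀ v : P γ,
      (D ξ γ v : Module.Dual ℂ (CTangent E γ)) ∈ (Q γ).dualAnnihilator

/-- The fibre of `T / (T ∩ P)`. -/
abbrev RelQuot (T P : ∀ γ : G, Submodule ℂ (CTangent E γ)) (γ : G) : Type _ :=
  T γ ⧸ (P γ).submoduleOf (T γ)

/-- The class in `T / (T ∩ P)` of an element of `T`. -/
abbrev relMk (T P : ∀ γ : G, Submodule ℂ (CTangent E γ)) (γ : G) (v : T γ) : RelQuot T P γ :=
  Submodule.Quotient.mk v

/-- Smooth sections of `(T / (T ∩ P))^*` over the open set `U`. -/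
def SmoothRelDual (T P : ∀ γ : G, Submodule ℂ (CTangent E γ))
    (α : ∀ γ : G, Module.Dual ℂ (RelQuot T P γ)) (U : Set G) : Prop :=
  ∀ V ⊆ U, IsOpen V → ∀ Y : ∀ γ : G, T γ, SmoothIn T Y V →
    SmoothFun E (fun γ => α γ (relMk T P γ (Y γ))) V

/-- The surjection `P^⊥ → P^⊥ / (P + T)^⊥ ≅ (T / (T ∩ P))^*`, restriction of covectors to `T`. -/
def conormalRestrict (T P : ∀ γ : G, Submodule ℂ (CTangent E γ)) (γ : G) (ξ : Conormal P γ) :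
    Module.Dual ℂ (RelQuot T P γ) :=
  ((P γ).submoduleOf (T γ)).liftQ
    ((ξ : Module.Dual ℂ (CTangent E γ)).comp (T γ).subtype) (by
      intro v hv
      exact (Submodule.mem_dualAnnihilator _).1 ξ.2 _ hv)

/-- The connection `D` on `(T / (T ∩ P))^*` is induced by the connection `DB` on `P^⊥` through
the quotient map `P^⊥ → (T / (T ∩ P))^*`. -/
def IsInduced (T P : ∀ γ : G, Submodule ℂ (CTangent E γ))
    (DB : (∀ γ : G, Conormal P γ) → ∀ γ : G, P γ →ₗ[ℂ] Conormal P γ)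
    (D : (∀ γ : G, Module.Dual ℂ (RelQuot T P γ)) →
      ∀ γ : G, P γ →ₗ[ℂ] Module.Dual ℂ (RelQuot T P γ)) : Prop :=
  ∀ U : Set G, IsOpen U → ∀ ξ : ∀ γ : G, Conormal P γ, SmoothConormal P ξ U →
    ∀ γ ∈ U, ∀ v : P γ,
      D (fun x => conormalRestrict T P x (ξ x)) γ v = conormalRestrict T P γ (DB ξ γ v)

/-- The fibre of `T / (T ∩ P) ⊕ S / (S ∩ P)`. -/
abbrev SumQuot (T S P : ∀ γ : G, Submodule ℂ (CTangent E γ)) (γ : G) : Type _ :=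
  RelQuot T P γ × RelQuot S P γ

/-- Smooth sections of the dual of `T / (T ∩ P) ⊕ S / (S ∩ P)` over the open set `U`. -/
def SmoothSumDual (T S P : ∀ γ : G, Submodule ℂ (CTangent E γ))
    (β : ∀ γ : G, Module.Dual ℂ (SumQuot T S P γ)) (U : Set G) : Prop :=
  SmoothRelDual T P (fun γ => (β γ).comp (LinearMap.inl ℂ _ _)) U ∧
    SmoothRelDual S P (fun γ => (β γ).comp (LinearMap.inr ℂ _ _)) U

/-- The direct sum of the connections `DT` and `DS`. -/
def sumConnection (T S P : ∀ γ : G, Submodule ℂ (CTangent E γ))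
    (DT : (∀ γ : G, Module.Dual ℂ (RelQuot T P γ)) →
      ∀ γ : G, P γ →ₗ[ℂ] Module.Dual ℂ (RelQuot T P γ))
    (DS : (∀ γ : G, Module.Dual ℂ (RelQuot S P γ)) →
      ∀ γ : G, P γ →ₗ[ℂ] Module.Dual ℂ (RelQuot S P γ))
    (β : ∀ γ : G, Module.Dual ℂ (SumQuot T S P γ)) (γ : G) (v : P γ) :
    Module.Dual ℂ (SumQuot T S P γ) :=
  LinearMap.coprod (DT (fun x => (β x).comp (LinearMap.inl ℂ _ _)) γ v)
    (DS (fun x => (β x).comp (LinearMap.inr ℂ _ _)) γ v)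

/-- The fibre of `Λ^n (T / (T ∩ P) ⊕ S / (S ∩ P))^*`, as alternating `n`-linear forms.
This is the top exterior power when `n` is the rank of `T / (T ∩ P) ⊕ S / (S ∩ P)`. -/
abbrev FormBundle (n : ℕ) (T S P : ∀ γ : G, Submodule ℂ (CTangent E γ)) (γ : G) : Type _ :=
  SumQuot T S P γ [⋀^Fin n]→ₗ[ℂ] ℂ

/-- Smooth sections of `Λ^n (T / (T ∩ P) ⊕ S / (S ∩ P))^*` over the open set `U`. -/
def SmoothForm (n : ℕ) (T S P : ∀ γ : G, Submodule ℂ (CTangent E γ))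
    (σ : ∀ γ : G, FormBundle n T S P γ) (U : Set G) : Prop :=
  ∀ V ⊆ U, IsOpen V → ∀ (A : Fin n → ∀ γ : G, T γ) (B : Fin n → ∀ γ : G, S γ),
    (∀ i, SmoothIn T (A i) V) → (∀ i, SmoothIn S (B i) V) →
    SmoothFun E (fun γ => σ γ (fun i => (relMk T P γ (A i γ), relMk S P γ (B i γ)))) V

/-- The exterior product `β₁ ∧ ⋯ ∧ βₙ` of covectors: `(w₁, …, wₙ) ↦ det (βᵢ(wⱼ))`. -/
def wedge {W : Type*} [AddCommGroup W] [Module ℂ W] {n : ℕ} (β : Fin n → Module.Dual ℂ W) :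
    W [⋀^Fin n]→ₗ[ℂ] ℂ :=
  (Matrix.detRowAlternating (R := ℂ) (n := Fin n)).compLinearMap (LinearMap.pi β)

/-- The connection `D` on `Λ^n (T / (T ∩ P) ⊕ S / (S ∩ P))^*` is induced by `DT` and `DS`:
`∇(β₁ ∧ ⋯ ∧ βₙ) = ∑ᵢ β₁ ∧ ⋯ ∧ ∇βᵢ ∧ ⋯ ∧ βₙ`. -/
def IsWedgeInduced (n : ℕ) (T S P : ∀ γ : G, Submodule ℂ (CTangent E γ))
    (DT : (∀ γ : G, Module.Dual ℂ (RelQuot T P γ)) →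
      ∀ γ : G, P γ →ₗ[ℂ] Module.Dual ℂ (RelQuot T P γ))
    (DS : (∀ γ : G, Module.Dual ℂ (RelQuot S P γ)) →
      ∀ γ : G, P γ →ₗ[ℂ] Module.Dual ℂ (RelQuot S P γ))
    (D : (∀ γ : G, FormBundle n T S P γ) → ∀ γ : G, P γ →ₗ[ℂ] FormBundle n T S P γ) : Prop :=
  ∀ U : Set G, IsOpen U → ∀ β : Fin n → ∀ γ : G, Module.Dual ℂ (SumQuot T S P γ),
    (∀ i, SmoothSumDual T S P (β i) U) → ∀ γ ∈ U, ∀ v : P γ,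
      D (fun x => wedge (fun i => β i x)) γ v =
        ∑ i : Fin n, wedge (Function.update (fun j => β j γ) i
          (sumConnection T S P DT DS (β i) γ v))

end Bott

/-! ### Square roots of line bundles -/

section SquareRoot

variable {E : Type*} [NormedAddCommGroup E] [NormedSpace ℝ E]
  {G : Type*} [TopologicalSpace G] [ChartedSpace E G]

/-- Smooth sections of a (Mathlib) complex line bundle over the set `U`. -/
def SmoothLine (E : Type*) [NormedAddCommGroup E] [NormedSpace ℝ E]
    {G : Type*} [TopologicalSpace G] [ChartedSpace E G]
    (L : G → Type*) [TopologicalSpace (Bundle.TotalSpace ℂ L)]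
    [∀ γ, TopologicalSpace (L γ)] [FiberBundle ℂ L]
    (s : ∀ γ, L γ) (U : Set G) : Prop :=
  ContMDiffOn 𝓘(ℝ, E) (𝓘(ℝ, E).prod 𝓘(ℝ, ℂ)) ∞
    (fun γ => (⟨γ, s γ⟩ : Bundle.TotalSpace ℂ L)) U

/-- The fibrewise isomorphisms `φ : L ⊗ L ≅ Λ` form a smooth isomorphism of line bundles: they map
products of smooth local sections of `L` to smooth local sections of `Λ`. -/
def IsSmoothSquare (E : Type*) [NormedAddCommGroup E] [NormedSpace ℝ E]
    {G : Type*} [TopologicalSpace G] [ChartedSpace E G]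
    (L : G → Type*) [TopologicalSpace (Bundle.TotalSpace ℂ L)]
    [∀ γ, TopologicalSpace (L γ)] [FiberBundle ℂ L]
    [∀ γ, AddCommGroup (L γ)] [∀ γ, Module ℂ (L γ)]
    {Λ : G → Type*} [∀ γ, AddCommGroup (Λ γ)] [∀ γ, Module ℂ (Λ γ)]
    (SmΛ : (∀ γ, Λ γ) → Set G → Prop)
    (φ : ∀ γ, (L γ ⊗[ℂ] L γ) ≃ₗ[ℂ] Λ γ) : Prop :=
  ∀ U : Set G, IsOpen U → ∀ s s' : ∀ γ, L γ, SmoothLine E L s U → SmoothLine E L s' U →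
    SmΛ (fun γ => φ γ (s γ ⊗ₜ[ℂ] s' γ)) U

/-- The Leibniz rule `∇^Λ(s ⊗ s') = ∇s ⊗ s' + s ⊗ ∇s'` that relates a connection `D` on the square
root `L` to the connection `DΛ` on `Λ ≅ L ⊗ L`. -/
def IsSquareRootConnection (P : ∀ γ : G, Submodule ℂ (CTangent E γ))
    (L : G → Type*) [TopologicalSpace (Bundle.TotalSpace ℂ L)]
    [∀ γ, TopologicalSpace (L γ)] [FiberBundle ℂ L]
    [∀ γ, AddCommGroup (L γ)] [∀ γ, Module ℂ (L γ)]
    {Λ : G → Type*} [∀ γ, AddCommGroup (Λ γ)] [∀ γ, Module ℂ (Λ γ)]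
    (φ : ∀ γ, (L γ ⊗[ℂ] L γ) ≃ₗ[ℂ] Λ γ)
    (DΛ : (∀ γ, Λ γ) → ∀ γ, P γ →ₗ[ℂ] Λ γ)
    (D : (∀ γ, L γ) → ∀ γ, P γ →ₗ[ℂ] L γ) : Prop :=
  ∀ U : Set G, IsOpen U → ∀ s s' : ∀ γ, L γ, SmoothLine E L s U → SmoothLine E L s' U →
    ∀ γ ∈ U, ∀ v : P γ,
      DΛ (fun x => φ x (s x ⊗ₜ[ℂ] s' x)) γ v =
        φ γ (D s γ v ⊗ₜ[ℂ] s' γ + s γ ⊗ₜ[ℂ] D s' γ v)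

end SquareRoot

/-! ### Lie groupoids and their polarizations -/

section Groupoid

/-- A Lie groupoid `G ⇉ M`. An arrow `γ` goes from `src γ` to `tgt γ`, and `mul γ η` is the product
of a composable pair, i.e. `src γ = tgt η`; the values of `mul` on other pairs are irrelevant.
The composable pairs form an embedded submanifold of `G × G` because `src` and `tgt` are submersions,
and smoothness of the multiplication on it is smoothness within this subset. -/
structure LieGroupoid (E F G M : Type*)
    [NormedAddCommGroup E] [NormedSpace ℝ E] [NormedAddCommGroup F] [NormedSpace ℝ F]
    [TopologicalSpace G] [ChartedSpace E G] [TopologicalSpace M] [ChartedSpace F M] where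
  src : G → M
  tgt : G → M
  one : M → G
  inv : G → G
  mul : G → G → G
  src_one : ∀ x, src (one x) = x
  tgt_one : ∀ x, tgt (one x) = x
  src_inv : ∀ γ, src (inv γ) = tgt γ
  tgt_inv : ∀ γ, tgt (inv γ) = src γ
  src_mul : ∀ γ η, src γ = tgt η → src (mul γ η) = src η
  tgt_mul : ∀ γ η, src γ = tgt η → tgt (mul γ η) = tgt γ
  mul_assoc : ∀ γ η ζ, src γ = tgt η → src η = tgt ζ → mul (mul γ η) ζ = mul γ (mul η ζ)
  one_mul : ∀ γ, mul (one (tgt γ)) γ = γ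
  mul_one : ∀ γ, mul γ (one (src γ)) = γ
  mul_inv : ∀ γ, mul γ (inv γ) = one (tgt γ)
  inv_mul : ∀ γ, mul (inv γ) γ = one (src γ)
  submersion_src : Manifold.IsSubmersion 𝓘(ℝ, E) 𝓘(ℝ, F) ∞ src
  submersion_tgt : Manifold.IsSubmersion 𝓘(ℝ, E) 𝓘(ℝ, F) ∞ tgt
  smooth_one : ContMDiff 𝓘(ℝ, F) 𝓘(ℝ, E) ∞ one
  smooth_inv : ContMDiff 𝓘(ℝ, E) 𝓘(ℝ, E) ∞ inv
  smooth_mul : ContMDiffOn (𝓘(ℝ, E).prod 𝓘(ℝ, E)) 𝓘(ℝ, E) ∞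
    (fun p : G × G => mul p.1 p.2) {p : G × G | src p.1 = tgt p.2}

namespace LieGroupoid

variable {E F G M : Type*}
  [NormedAddCommGroup E] [NormedSpace ℝ E] [NormedAddCommGroup F] [NormedSpace ℝ F]
  [TopologicalSpace G] [ChartedSpace E G] [TopologicalSpace M] [ChartedSpace F M]
  (𝒢 : LieGroupoid E F G M)

/-- The complexified kernel of the derivative of the target map. -/
def tgtTangent (γ : G) : Submodule ℂ (CTangent E γ) := LinearMap.ker (cMap (F := F) 𝒢.tgt γ)

/-- The complexified kernel of the derivative of the source map. -/
def srcTangent (γ : G) : Submodule ℂ (CTangent E γ) := LinearMap.ker (cMap (F := F) 𝒢.src γ)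

/-- The derivative of the multiplication at a composable pair. It is determined on the tangent space
of the manifold of composable pairs, that is, on pairs `(v, w)` with `T src v = T tgt w`, and it
is only used there. -/
def mulDeriv (γ η : G) :
    (TangentSpace 𝓘(ℝ, E) γ × TangentSpace 𝓘(ℝ, E) η) →L[ℝ] TangentSpace 𝓘(ℝ, E) (𝒢.mul γ η) :=
  mfderivWithin (𝓘(ℝ, E).prod 𝓘(ℝ, E)) 𝓘(ℝ, E)
    (fun p : G × G => 𝒢.mul p.1 p.2) {p : G × G | 𝒢.src p.1 = 𝒢.tgt p.2} (γ, η)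

/-- The multiplication of the complexified tangent groupoid over the pair `(γ, η)`. -/
def cMul (γ η : G) (v : CTangent E γ) (w : CTangent E η) : CTangent E (𝒢.mul γ η) :=
  LinearMap.baseChange ℂ
      ((𝒢.mulDeriv γ η).toLinearMap ∘ₗ
        LinearMap.inl ℝ (TangentSpace 𝓘(ℝ, E) γ) (TangentSpace 𝓘(ℝ, E) η)) v
    + LinearMap.baseChange ℂ
      ((𝒢.mulDeriv γ η).toLinearMap ∘ₗ
        LinearMap.inr ℝ (TangentSpace 𝓘(ℝ, E) γ) (TangentSpace 𝓘(ℝ, E) η)) w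

/-- The equation `T src v = T tgt w` in the complexified tangent bundle of the base. -/
def TangentComposable (γ η : G) (v : CTangent E γ) (w : CTangent E η) : Prop :=
  (⟨𝒢.src γ, cMap (F := F) 𝒢.src γ v⟩ : Σ x : M, CTangent F x) =
    ⟨𝒢.tgt η, cMap (F := F) 𝒢.tgt η w⟩

/-- `P` is multiplicative: `Tm ((P × P) ∩ T G₂) = P` over every composable pair. -/
def IsMultiplicative (P : ∀ γ : G, Submodule ℂ (CTangent E γ)) : Prop :=
  ∀ γ η : G, 𝒢.src γ = 𝒢.tgt η →
    {u : CTangent E (𝒢.mul γ η) | ∃ v ∈ P γ, ∃ w ∈ P η,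
      𝒢.TangentComposable γ η v w ∧ 𝒢.cMul γ η v w = u} = (P (𝒢.mul γ η) : Set _)

/-- `P` is Hermitian: the derivative of the inversion maps `P` to its complex conjugate. -/
def IsHermitian (P : ∀ γ : G, Submodule ℂ (CTangent E γ)) : Prop :=
  ∀ γ : G, cMap (F := E) 𝒢.inv γ '' (P γ : Set (CTangent E γ)) =
    {w : CTangent E (𝒢.inv γ) | conjC w ∈ P (𝒢.inv γ)}

/-- A polarization of a Lie groupoid: an involutive, multiplicative, Hermitian distribution. -/
structure IsPolarization [IsManifold 𝓘(ℝ, E) ∞ G] (P : ∀ γ : G, Submodule ℂ (CTangent E γ)) : Prop where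
  involutive : IsInvolutive P
  multiplicative : 𝒢.IsMultiplicative P
  hermitian : 𝒢.IsHermitian P

end LieGroupoid

end Groupoid

end HalfForms

end

/-! Part 1 is the only place where the groupoid multiplication is used. If `γ` and `γ'` have the
same target, then `γ' = γ (γ⁻¹ γ')`; since `t(γη) = t(γ)`, multiplicativity gives `Tt(P γ') ⊆ Tt(P
γ)`. So the image of `P` under `Tt` depends only on the target point (`IsMultiplicative.tgt_image`),
and likewise for the source. For an involutive `P` with this property along a submersion `f`,
`isInvolutive_sup_ker` tests brackets on functions `g = gM ∘ f` for which `d gM` kills `Tf(P)` at `f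
γ₀`. Such a `dg` kills `ker Tf` everywhere and kills `P` along the whole fibre through `γ₀`. With `X
= p + v` and `Y = p' + v'` one gets `[X,Y]g = [p,p']g + v(p'g) - v'(pg)` at `γ₀`. The last two terms
vanish because `pg` and `p'g` vanish on the fibre, the first because `P` is involutive. That `T^s ∩
P` has the same constant rank as `T^t ∩ P` follows from the antilinear map `conj ∘ T inv`
(`IsHermitian.finrank_srcTangent`).

For part 2, if `ξ` annihilates `P` and `X` lies in `P`, Cartan's formula gives `L_X ξ = dξ(X, ·)`,
which is tensorial in `X`. Hence the Bott connection is read off pointwise from an exterior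
derivative (`exists_extDeriv`, `isBott_bottConnection`). Flatness is the Jacobi identity
(`IsBott.isFlat`), and preservation of `(P + T)^⊥` is involutivity of `P + T`
(`IsBott.preservesAnnihilator`). The restriction map `P^⊥ → (T/(T ∩ P))^*` is locally split with
kernel `(P + T)^⊥`, so the connection descends (`isTheFlatConnection_pushforward`).

Parts 3 and 4 construct connections on line bundles from their values on local frames; these glue
once they satisfy the transition rule (`lineConnection_apply`). For the top exterior power the rule
is Jacobi's formula for the derivative of a determinant (`IsSumFrame.wedgeDerivation_eq`). For a
square root one takes half of the connection form of `a ⊗ a`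
(`exists_isTheFlatConnection_squareRoot`). In both cases the cross terms in the second derivatives
are symmetric in the two directions, so flatness is inherited.

Two tools are used throughout: the formula `[X,Y]f = X(Yf) - Y(Xf)` for complex fields
(`cDeriv_cBracket`), and local frames adapted to `P` and `T` at once (`exists_adaptedFrame`), which
exist because `T ∩ P` has constant rank. -/

set_option linter.unusedSectionVars false

noncomputable section

namespace HalfForms

/-! ### Linear algebra of the complexification. -/

section Complexification

variable {V W : Type*} [AddCommGroup V] [Module ℝ V] [AddCommGroup W] [Module ℝ W]

@[simp] lemma rePart_tmul (z : ℂ) (v : V) : rePart (z ⊗ₜ[ℝ] v) = z.re • v := by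
  simp [rePart]

@[simp] lemma imPart_tmul (z : ℂ) (v : V) : imPart (z ⊗ₜ[ℝ] v) = z.im • v := by
  simp [imPart]

lemma tmul_eq_one_add_I (z : ℂ) (v : V) :
    z ⊗ₜ[ℝ] v = (1 : ℂ) ⊗ₜ[ℝ] (z.re • v) + Complex.I ⊗ₜ[ℝ] (z.im • v) := by
  rw [← TensorProduct.smul_tmul, ← TensorProduct.smul_tmul, ← TensorProduct.add_tmul]
  congr 1
  apply Complex.ext <;> simp

/-- Through this decomposition an identity between complex vectors becomes a pair of real
identities, which is how most later statements about `ℂ ⊗ V` are reduced. -/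
lemma eq_rePart_add_imPart (u : ℂ ⊗[ℝ] V) :
    u = (1 : ℂ) ⊗ₜ[ℝ] rePart u + Complex.I ⊗ₜ[ℝ] imPart u := by
  induction u with
  | zero => simp
  | tmul z v => rw [rePart_tmul, imPart_tmul]; exact tmul_eq_one_add_I z v
  | add x y hx hy =>
    rw [map_add, map_add, TensorProduct.tmul_add, TensorProduct.tmul_add]
    nth_rewrite 1 [hx, hy]
    abel

lemma complexified_ext {u u' : ℂ ⊗[ℝ] V} (hr : rePart u = rePart u') (hi : imPart u = imPart u') :
    u = u' := by
  rw [eq_rePart_add_imPart u, eq_rePart_add_imPart u', hr, hi]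

lemma rePart_smul (z : ℂ) (u : ℂ ⊗[ℝ] V) :
    rePart (z • u) = z.re • rePart u - z.im • imPart u := by
  rw [eq_rePart_add_imPart u]
  simp only [smul_add, TensorProduct.smul_tmul', map_add, rePart_tmul, imPart_tmul]
  simp [sub_eq_add_neg]

lemma imPart_smul (z : ℂ) (u : ℂ ⊗[ℝ] V) :
    imPart (z • u) = z.re • imPart u + z.im • rePart u := by
  rw [eq_rePart_add_imPart u]
  simp only [smul_add, TensorProduct.smul_tmul', map_add, rePart_tmul, imPart_tmul]
  simp [add_comm]

lemma rePart_baseChange (f : V →ₗ[ℝ] W) (u : ℂ ⊗[ℝ] V) :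
    rePart (f.baseChange ℂ u) = f (rePart u) := by
  rw [eq_rePart_add_imPart u]; simp

lemma imPart_baseChange (f : V →ₗ[ℝ] W) (u : ℂ ⊗[ℝ] V) :
    imPart (f.baseChange ℂ u) = f (imPart u) := by
  rw [eq_rePart_add_imPart u]; simp

lemma rePart_conjC (u : ℂ ⊗[ℝ] V) : rePart (conjC u) = rePart u := by
  rw [eq_rePart_add_imPart u]; simp [conjC]

lemma imPart_conjC (u : ℂ ⊗[ℝ] V) : imPart (conjC u) = - imPart u := by
  rw [eq_rePart_add_imPart u]; simp [conjC]

end Complexification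

/-! ### Calculus of complex-valued functions. -/

section Calculus

variable {E : Type*} [NormedAddCommGroup E] [NormedSpace ℝ E]
  {G : Type*} [TopologicalSpace G] [ChartedSpace E G]

/-! ### Smooth complex functions -/

section Functions

lemma SmoothFun.mono {f : G → ℂ} {U V : Set G} (hf : SmoothFun E f U) (h : V ⊆ U) :
    SmoothFun E f V := ContMDiffOn.mono hf h

lemma SmoothFun.congr {f g : G → ℂ} {U : Set G} (hf : SmoothFun E f U) (h : ∀ γ ∈ U, g γ = f γ) :
    SmoothFun E g U := ContMDiffOn.congr hf h

lemma SmoothFun.of_local {f : G → ℂ} {U : Set G}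
    (h : ∀ γ ∈ U, ∃ V, IsOpen V ∧ γ ∈ V ∧ SmoothFun E f (U ∩ V)) : SmoothFun E f U :=
  contMDiffOn_of_locally_contMDiffOn h

lemma smoothFun_const (c : ℂ) (U : Set G) : SmoothFun E (fun _ => c) U := contMDiffOn_const

lemma SmoothFun.add {f g : G → ℂ} {U : Set G} (hf : SmoothFun E f U) (hg : SmoothFun E g U) :
    SmoothFun E (fun x => f x + g x) U := ContMDiffOn.add hf hg

lemma SmoothFun.mul {f g : G → ℂ} {U : Set G} (hf : SmoothFun E f U) (hg : SmoothFun E g U) :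
    SmoothFun E (fun x => f x * g x) U :=
  (contDiff_mul (𝕜 := ℝ) (𝔸 := ℂ)).contMDiff.comp_contMDiffOn (hf.prodMk_space hg)

lemma SmoothFun.sub {f g : G → ℂ} {U : Set G} (hf : SmoothFun E f U) (hg : SmoothFun E g U) :
    SmoothFun E (fun x => f x - g x) U := ContMDiffOn.sub hf hg

lemma SmoothFun.sum {ι : Type*} {s : Finset ι} {f : ι → G → ℂ} {U : Set G}
    (hf : ∀ i ∈ s, SmoothFun E (f i) U) : SmoothFun E (fun x => ∑ i ∈ s, f i x) U := by
  classical
  induction s using Finset.induction_on with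
  | empty => simpa using smoothFun_const 0 U
  | insert a s ha ih =>
    simp only [Finset.sum_insert ha]
    exact (hf a (by simp)).add (ih fun i hi => hf i (by simp [hi]))

lemma SmoothFun.prod {ι : Type*} {s : Finset ι} {f : ι → G → ℂ} {U : Set G}
    (hf : ∀ i ∈ s, SmoothFun E (f i) U) : SmoothFun E (fun x => ∏ i ∈ s, f i x) U := by
  classical
  induction s using Finset.induction_on with
  | empty => simpa using smoothFun_const 1 U
  | insert a s ha ih =>
    simp only [Finset.prod_insert ha]
    exact (hf a (by simp)).mul (ih fun i hi => hf i (by simp [hi]))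

lemma SmoothFun.inv {f : G → ℂ} {U : Set G} (hf : SmoothFun E f U) (h : ∀ γ ∈ U, f γ ≠ 0) :
    SmoothFun E (fun x => (f x)⁻¹) U := fun γ hγ =>
  ((contDiffAt_inv ℝ (h γ hγ)).contMDiffAt).comp_contMDiffWithinAt γ (hf γ hγ)

lemma SmoothFun.det {n : Type*} [Fintype n] [DecidableEq n] {A : G → Matrix n n ℂ} {U : Set G}
    (hA : ∀ i j, SmoothFun E (fun x => A x i j) U) : SmoothFun E (fun x => (A x).det) U := by
  simp only [Matrix.det_apply']
  exact SmoothFun.sum fun σ _ => (smoothFun_const _ U).mul (SmoothFun.prod fun i _ => hA _ _)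

lemma SmoothFun.continuousOn {f : G → ℂ} {U : Set G} (hf : SmoothFun E f U) : ContinuousOn f U :=
  ContMDiffOn.continuousOn hf

lemma SmoothFun.mdifferentiableAt {f : G → ℂ} {U : Set G} (hf : SmoothFun E f U) (hU : IsOpen U)
    {γ : G} (hγ : γ ∈ U) : MDifferentiableAt 𝓘(ℝ, E) 𝓘(ℝ, ℂ) f γ :=
  (hf.contMDiffAt (hU.mem_nhds hγ)).mdifferentiableAt (by simp)

end Functions

/-! ### The derivative of a complex function along complex vectors -/

section Deriv

/-- The real derivative of a complex-valued function. -/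
def realDeriv (f : G → ℂ) (γ : G) : TangentSpace 𝓘(ℝ, E) γ →L[ℝ] ℂ :=
  mfderiv 𝓘(ℝ, E) 𝓘(ℝ, ℂ) f γ

lemma cDeriv_eq (f : G → ℂ) (γ : G) (u : CTangent E γ) :
    cDeriv f γ u = realDeriv f γ (rePart u) + Complex.I * realDeriv f γ (imPart u) := by
  nth_rewrite 1 [eq_rePart_add_imPart u]
  simp only [cDeriv, realDeriv, map_add, LinearMap.liftBaseChange_tmul, smul_eq_mul, one_mul]
  rfl

lemma cDeriv_one_tmul (f : G → ℂ) (γ : G) (v : TangentSpace 𝓘(ℝ, E) γ) :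
    cDeriv f γ ((1 : ℂ) ⊗ₜ[ℝ] v) = realDeriv f γ v := by
  rw [cDeriv_eq]; simp

lemma cDeriv_congr {f g : G → ℂ} {γ : G} (h : f =ᶠ[𝓝 γ] g) : cDeriv (E := E) f γ = cDeriv g γ := by
  ext u
  simp only [cDeriv]
  rw [h.mfderiv_eq]

lemma cDeriv_congr_on {f g : G → ℂ} {U : Set G} (hU : IsOpen U) (h : ∀ γ ∈ U, f γ = g γ) {γ : G}
    (hγ : γ ∈ U) : cDeriv (E := E) f γ = cDeriv g γ :=
  cDeriv_congr (Filter.eventuallyEq_of_mem (hU.mem_nhds hγ) h)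

@[simp] lemma cDeriv_const (c : ℂ) (γ : G) : cDeriv (E := E) (fun _ => c) γ = 0 := by
  refine LinearMap.ext fun u => ?_
  have h : realDeriv (E := E) (fun _ => c) γ = 0 := mfderiv_const
  simp [cDeriv_eq, h]

variable {f g : G → ℂ} {γ : G}

lemma realDeriv_add (hf : MDifferentiableAt 𝓘(ℝ, E) 𝓘(ℝ, ℂ) f γ)
    (hg : MDifferentiableAt 𝓘(ℝ, E) 𝓘(ℝ, ℂ) g γ) :
    realDeriv (E := E) (fun x => f x + g x) γ = realDeriv f γ + realDeriv g γ :=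
  mfderiv_add hf hg

lemma realDeriv_mul (hf : MDifferentiableAt 𝓘(ℝ, E) 𝓘(ℝ, ℂ) f γ)
    (hg : MDifferentiableAt 𝓘(ℝ, E) 𝓘(ℝ, ℂ) g γ) (v : TangentSpace 𝓘(ℝ, E) γ) :
    realDeriv (fun x => f x * g x) γ v = f γ * realDeriv g γ v + g γ * realDeriv f γ v := by
  have := (hf.hasMFDerivAt.mul hg.hasMFDerivAt).mfderiv
  exact DFunLike.congr_fun this v

lemma cDeriv_add (hf : MDifferentiableAt 𝓘(ℝ, E) 𝓘(ℝ, ℂ) f γ)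
    (hg : MDifferentiableAt 𝓘(ℝ, E) 𝓘(ℝ, ℂ) g γ) (u : CTangent E γ) :
    cDeriv (fun x => f x + g x) γ u = cDeriv f γ u + cDeriv g γ u := by
  simp only [cDeriv_eq, realDeriv_add hf hg, add_apply]
  ring

lemma cDeriv_mul (hf : MDifferentiableAt 𝓘(ℝ, E) 𝓘(ℝ, ℂ) f γ)
    (hg : MDifferentiableAt 𝓘(ℝ, E) 𝓘(ℝ, ℂ) g γ) (u : CTangent E γ) :
    cDeriv (fun x => f x * g x) γ u = f γ * cDeriv g γ u + g γ * cDeriv f γ u := by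
  simp only [cDeriv_eq, realDeriv_mul hf hg]
  ring

lemma cDeriv_const_mul (c : ℂ) (hg : MDifferentiableAt 𝓘(ℝ, E) 𝓘(ℝ, ℂ) g γ) (u : CTangent E γ) :
    cDeriv (fun x => c * g x) γ u = c * cDeriv g γ u := by
  rw [cDeriv_mul mdifferentiableAt_const hg]; simp

lemma cDeriv_sub (hf : MDifferentiableAt 𝓘(ℝ, E) 𝓘(ℝ, ℂ) f γ)
    (hg : MDifferentiableAt 𝓘(ℝ, E) 𝓘(ℝ, ℂ) g γ) (u : CTangent E γ) :
    cDeriv (fun x => f x - g x) γ u = cDeriv f γ u - cDeriv g γ u := by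
  have h : MDifferentiableAt 𝓘(ℝ, E) 𝓘(ℝ, ℂ) (fun x => (-1) * g x) γ :=
    (mdifferentiableAt_const.mul hg : MDifferentiableAt 𝓘(ℝ, E) 𝓘(ℝ, ℂ) ((fun _ => (-1 : ℂ)) * g) γ)
  have := cDeriv_add hf h u
  rw [cDeriv_const_mul _ hg] at this
  simpa [sub_eq_add_neg] using this

lemma cDeriv_sum {ι : Type*} {s : Finset ι} {f : ι → G → ℂ} {U : Set G} (hU : IsOpen U)
    (hf : ∀ i ∈ s, SmoothFun E (f i) U) (hγ : γ ∈ U) (u : CTangent E γ) :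
    cDeriv (fun x => ∑ i ∈ s, f i x) γ u = ∑ i ∈ s, cDeriv (f i) γ u := by
  classical
  induction s using Finset.induction_on with
  | empty => simp
  | insert a s ha ih =>
    simp only [Finset.sum_insert ha]
    have h2 : ∀ i ∈ s, SmoothFun E (f i) U := fun i hi => hf i (by simp [hi])
    rw [cDeriv_add ((hf a (by simp)).mdifferentiableAt hU hγ)
      ((SmoothFun.sum h2).mdifferentiableAt hU hγ), ih h2]

end Deriv

end Calculus

/-! ### Real vector fields and the bracket as a commutator of derivations. -/

section RealFields

variable {E : Type*} [NormedAddCommGroup E] [NormedSpace ℝ E]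
  {G : Type*} [TopologicalSpace G] [ChartedSpace E G] [IsManifold 𝓘(ℝ, E) ∞ G]

/-- `X` is a smooth real vector field on the set `U`. -/
def RealSmooth (X : ∀ γ : G, TangentSpace 𝓘(ℝ, E) γ) (U : Set G) : Prop :=
  ContMDiffOn 𝓘(ℝ, E) (𝓘(ℝ, E).prod 𝓘(ℝ, E)) ∞
    (fun γ => (⟨γ, X γ⟩ : TangentBundle 𝓘(ℝ, E) G)) U

/-- The tangent map of `f` is smooth; compose it with the section `X` and project the tangent bundle
of the vector space `F` to its fibre. -/
lemma contMDiffOn_mfderiv_apply {F : Type*} [NormedAddCommGroup F] [NormedSpace ℝ F] {f : G → F}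
    {X : ∀ γ : G, TangentSpace 𝓘(ℝ, E) γ} {U : Set G} (hU : IsOpen U)
    (hf : ContMDiffOn 𝓘(ℝ, E) 𝓘(ℝ, F) ∞ f U) (hX : RealSmooth X U) :
    ContMDiffOn 𝓘(ℝ, E) 𝓘(ℝ, F) ∞ (fun γ => (mfderiv 𝓘(ℝ, E) 𝓘(ℝ, F) f γ (X γ) : F)) U := by
  have h1 := hf.contMDiffOn_tangentMapWithin (m := ∞) (by simp) hU.uniqueMDiffOn
  have h2 := h1.comp hX (fun γ hγ => by simpa using hγ)
  have h3 := (contMDiff_snd_tangentBundle_modelSpace F 𝓘(ℝ, F) (n := ∞)).comp_contMDiffOn h2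
  refine h3.congr fun γ hγ => ?_
  change (mfderiv 𝓘(ℝ, E) 𝓘(ℝ, F) f γ (X γ) : F) = mfderivWithin 𝓘(ℝ, E) 𝓘(ℝ, F) f U γ (X γ)
  rw [mfderivWithin_of_isOpen hU hγ]

lemma RealSmooth.mdifferentiableAt {X : ∀ γ : G, TangentSpace 𝓘(ℝ, E) γ} {U : Set G}
    (hX : RealSmooth X U) (hU : IsOpen U) {γ : G} (hγ : γ ∈ U) :
    MDifferentiableAt 𝓘(ℝ, E) (𝓘(ℝ, E).prod 𝓘(ℝ, E))
      (fun γ => (⟨γ, X γ⟩ : TangentBundle 𝓘(ℝ, E) G)) γ :=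
  (ContMDiffOn.contMDiffAt hX (hU.mem_nhds hγ)).mdifferentiableAt (by simp)

lemma RealSmooth.smul {X : ∀ γ : G, TangentSpace 𝓘(ℝ, E) γ} {U : Set G} {f : G → ℝ}
    (hf : ContMDiffOn 𝓘(ℝ, E) 𝓘(ℝ, ℝ) ∞ f U) (hX : RealSmooth X U) : RealSmooth (f • X) U :=
  ContMDiffOn.smul_section hf hX

lemma RealSmooth.add {X Y : ∀ γ : G, TangentSpace 𝓘(ℝ, E) γ} {U : Set G}
    (hX : RealSmooth X U) (hY : RealSmooth Y U) : RealSmooth (X + Y) U :=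
  ContMDiffOn.add_section hX hY

lemma RealSmooth.sub {X Y : ∀ γ : G, TangentSpace 𝓘(ℝ, E) γ} {U : Set G}
    (hX : RealSmooth X U) (hY : RealSmooth Y U) : RealSmooth (X - Y) U :=
  ContMDiffOn.sub_section hX hY

variable [CompleteSpace E]

lemma RealSmooth.bracket {X Y : ∀ γ : G, TangentSpace 𝓘(ℝ, E) γ} {U : Set G} (hU : IsOpen U)
    (hX : RealSmooth X U) (hY : RealSmooth Y U) :
    RealSmooth (VectorField.mlieBracket 𝓘(ℝ, E) X Y) U := by
  intro γ hγ
  have : IsManifold 𝓘(ℝ, E) ((⊤ : ℕ∞) + 1) G := ‹IsManifold 𝓘(ℝ, E) ∞ G›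
  have : IsManifold 𝓘(ℝ, E) (minSmoothness ℝ 2) G := by
    rw [minSmoothness_of_isRCLikeNormedField]; infer_instance
  have : IsManifold 𝓘(ℝ, E) (minSmoothness ℝ 3) G := by
    rw [minSmoothness_of_isRCLikeNormedField]; infer_instance
  exact (ContMDiffAt.mlieBracket_vectorField (m := ⊤) (n := ⊤)
    (ContMDiffOn.contMDiffAt hX (hU.mem_nhds hγ)) (ContMDiffOn.contMDiffAt hY (hU.mem_nhds hγ))
    (by simp)).contMDiffWithinAt

/-- This follows from two algebraic laws of the bracket, without coordinates. Take the Jacobi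
identity for `X, Y, fZ`, expand it by the Leibniz rule, and subtract `f` times the Jacobi identity
for `X, Y, Z`. What remains is `([X,Y]f - X(Yf) + Y(Xf)) Z = 0`, so the coefficient vanishes
wherever `Z` does not. -/
lemma mfderiv_mlieBracket {X Y : ∀ γ : G, TangentSpace 𝓘(ℝ, E) γ} {U : Set G} (hU : IsOpen U)
    (hX : RealSmooth X U) (hY : RealSmooth Y U) {f : G → ℝ}
    (hf : ContMDiffOn 𝓘(ℝ, E) 𝓘(ℝ, ℝ) ∞ f U) {γ : G} (hγ : γ ∈ U) :
    mvfderiv 𝓘(ℝ, E) f γ (VectorField.mlieBracket 𝓘(ℝ, E) X Y γ) =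
      mvfderiv 𝓘(ℝ, E) (fun x => mvfderiv 𝓘(ℝ, E) f x (Y x)) γ (X γ) -
      mvfderiv 𝓘(ℝ, E) (fun x => mvfderiv 𝓘(ℝ, E) f x (X x)) γ (Y γ) := by
  have : IsManifold 𝓘(ℝ, E) (minSmoothness ℝ 3) G := by
    rw [minSmoothness_of_isRCLikeNormedField]; infer_instance
  have sm : ∀ {Z : ∀ γ : G, TangentSpace 𝓘(ℝ, E) γ}, RealSmooth Z U →
      ContMDiffAt 𝓘(ℝ, E) (𝓘(ℝ, E).prod 𝓘(ℝ, E)) (minSmoothness ℝ 2)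
      (fun γ => (⟨γ, Z γ⟩ : TangentBundle 𝓘(ℝ, E) G)) γ := fun hZ =>
    (ContMDiffOn.contMDiffAt hZ (hU.mem_nhds hγ)).of_le (by
      rw [minSmoothness_of_isRCLikeNormedField]; exact ENat.LEInfty.out)
  have dsm : ∀ {Z : ∀ γ : G, TangentSpace 𝓘(ℝ, E) γ}, RealSmooth Z U →
      ContMDiffOn 𝓘(ℝ, E) 𝓘(ℝ, ℝ) ∞ (fun x => mvfderiv 𝓘(ℝ, E) f x (Z x)) U := fun hZ =>
    contMDiffOn_mfderiv_apply hU hf hZ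
  have md : ∀ {g : G → ℝ}, ContMDiffOn 𝓘(ℝ, E) 𝓘(ℝ, ℝ) ∞ g U → ∀ x ∈ U,
      MDifferentiableAt 𝓘(ℝ, E) 𝓘(ℝ, ℝ) g x := fun hg x hx =>
    (hg.contMDiffAt (hU.mem_nhds hx)).mdifferentiableAt (by simp)
  -- The Leibniz rule is applied twice. The two terms with one derivative of `f` are together
  -- symmetric in `A` and `B`, so they cancel in the Jacobi identity.
  have key : ∀ (A B Z : ∀ γ : G, TangentSpace 𝓘(ℝ, E) γ), RealSmooth A U → RealSmooth B U →
      RealSmooth Z U → VectorField.mlieBracket 𝓘(ℝ, E) A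
        (VectorField.mlieBracket 𝓘(ℝ, E) B (f • Z)) γ =
        mvfderiv 𝓘(ℝ, E) (fun x => mvfderiv 𝓘(ℝ, E) f x (B x)) γ (A γ) • Z γ
        + mvfderiv 𝓘(ℝ, E) f γ (B γ) • VectorField.mlieBracket 𝓘(ℝ, E) A Z γ
        + (mvfderiv 𝓘(ℝ, E) f γ (A γ) • VectorField.mlieBracket 𝓘(ℝ, E) B Z γ
        + f γ • VectorField.mlieBracket 𝓘(ℝ, E) A (VectorField.mlieBracket 𝓘(ℝ, E) B Z) γ) := by
    intro A B Z hA hB hZ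
    have e : VectorField.mlieBracket 𝓘(ℝ, E) B (f • Z) =ᶠ[𝓝 γ]
        ((fun x => mvfderiv 𝓘(ℝ, E) f x (B x)) • Z) + f • VectorField.mlieBracket 𝓘(ℝ, E) B Z :=
      Filter.eventuallyEq_of_mem (hU.mem_nhds hγ) fun x hx =>
        VectorField.mlieBracket_smul_right (md hf x hx) (hZ.mdifferentiableAt hU hx)
    rw [Filter.EventuallyEq.mlieBracket_vectorField_eq (Filter.EventuallyEq.refl _ A) e,
      VectorField.mlieBracket_add_right ((RealSmooth.smul (dsm hB) hZ).mdifferentiableAt hU hγ)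
        ((RealSmooth.smul hf (hB.bracket hU hZ)).mdifferentiableAt hU hγ),
      VectorField.mlieBracket_smul_right (md (dsm hB) γ hγ) (hZ.mdifferentiableAt hU hγ),
      VectorField.mlieBracket_smul_right (md hf γ hγ) ((hB.bracket hU hZ).mdifferentiableAt hU hγ)]
  have main : ∀ Z : ∀ γ : G, TangentSpace 𝓘(ℝ, E) γ, RealSmooth Z U → Z γ ≠ 0 →
      mvfderiv 𝓘(ℝ, E) f γ (VectorField.mlieBracket 𝓘(ℝ, E) X Y γ) =
      mvfderiv 𝓘(ℝ, E) (fun x => mvfderiv 𝓘(ℝ, E) f x (Y x)) γ (X γ) -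
      mvfderiv 𝓘(ℝ, E) (fun x => mvfderiv 𝓘(ℝ, E) f x (X x)) γ (Y γ) := by
    intro Z hZ hne
    have h1 := VectorField.leibniz_identity_mlieBracket_apply (sm hX) (sm hY)
      (sm (RealSmooth.smul hf hZ))
    have h2 := VectorField.leibniz_identity_mlieBracket_apply (sm hX) (sm hY) (sm hZ)
    rw [key X Y Z hX hY hZ, key Y X Z hY hX hZ,
      VectorField.mlieBracket_smul_right (md hf γ hγ) (hZ.mdifferentiableAt hU hγ), h2] at h1
    refine smul_left_injective ℝ hne ?_
    simp only [sub_smul]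
    linear_combination (norm := module) -h1
  -- No auxiliary field is needed: `X` or `Y` serves as `Z` if it is nonzero at `γ`, and if both
  -- vanish there, so does their bracket.
  by_cases hx : X γ = 0
  · by_cases hy : Y γ = 0
    · have : VectorField.mlieBracket 𝓘(ℝ, E) X Y γ = 0 := by
        rw [← VectorField.mlieBracketWithin_univ]
        exact VectorField.mlieBracketWithin_eq_zero_of_eq_zero hx hy
      rw [this, hx, hy]; simp
    · exact main Y hY hy
  · exact main X hX hx

end RealFields

/-! ### Complex vector fields and their brackets. -/

section ComplexFields

variable {E : Type*} [NormedAddCommGroup E] [NormedSpace ℝ E]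
  {G : Type*} [TopologicalSpace G] [ChartedSpace E G] [IsManifold 𝓘(ℝ, E) ∞ G]

lemma SmoothField.realSmooth_re {X : ∀ γ : G, CTangent E γ} {U : Set G} (hX : SmoothField X U) :
    RealSmooth (fun γ => rePart (X γ)) U := hX.1

lemma SmoothField.realSmooth_im {X : ∀ γ : G, CTangent E γ} {U : Set G} (hX : SmoothField X U) :
    RealSmooth (fun γ => imPart (X γ)) U := hX.2

lemma SmoothField.mono {X : ∀ γ : G, CTangent E γ} {U V : Set G} (hX : SmoothField X U)
    (h : V ⊆ U) : SmoothField X V := ⟨ContMDiffOn.mono hX.1 h, ContMDiffOn.mono hX.2 h⟩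

lemma SmoothField.congr {X Y : ∀ γ : G, CTangent E γ} {U : Set G} (hX : SmoothField X U)
    (h : ∀ γ ∈ U, Y γ = X γ) : SmoothField Y U :=
  ⟨ContMDiffOn.congr hX.1 fun γ hγ => by rw [h γ hγ],
    ContMDiffOn.congr hX.2 fun γ hγ => by rw [h γ hγ]⟩

lemma RealSmooth.congr {X Y : ∀ γ : G, TangentSpace 𝓘(ℝ, E) γ} {U : Set G} (hX : RealSmooth X U)
    (h : ∀ γ ∈ U, Y γ = X γ) : RealSmooth Y U :=
  ContMDiffOn.congr hX fun γ hγ => by rw [h γ hγ]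

lemma SmoothField.add {X Y : ∀ γ : G, CTangent E γ} {U : Set G} (hX : SmoothField X U)
    (hY : SmoothField Y U) : SmoothField (fun γ => X γ + Y γ) U :=
  ⟨(hX.realSmooth_re.add hY.realSmooth_re).congr fun γ _ => map_add rePart (X γ) (Y γ),
    (hX.realSmooth_im.add hY.realSmooth_im).congr fun γ _ => map_add imPart (X γ) (Y γ)⟩

lemma SmoothFun.contMDiffOn_re {f : G → ℂ} {U : Set G} (hf : SmoothFun E f U) :
    ContMDiffOn 𝓘(ℝ, E) 𝓘(ℝ, ℝ) ∞ (fun x => (f x).re) U :=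
  Complex.reCLM.contMDiff.comp_contMDiffOn hf

lemma SmoothFun.contMDiffOn_im {f : G → ℂ} {U : Set G} (hf : SmoothFun E f U) :
    ContMDiffOn 𝓘(ℝ, E) 𝓘(ℝ, ℝ) ∞ (fun x => (f x).im) U :=
  Complex.imCLM.contMDiff.comp_contMDiffOn hf

lemma SmoothField.smul {f : G → ℂ} {X : ∀ γ : G, CTangent E γ} {U : Set G} (hf : SmoothFun E f U)
    (hX : SmoothField X U) : SmoothField (fun γ => f γ • X γ) U :=
  ⟨((hX.realSmooth_re.smul hf.contMDiffOn_re).sub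
      (hX.realSmooth_im.smul hf.contMDiffOn_im)).congr fun γ _ => rePart_smul (f γ) (X γ),
    ((hX.realSmooth_im.smul hf.contMDiffOn_re).add
      (hX.realSmooth_re.smul hf.contMDiffOn_im)).congr fun γ _ => imPart_smul (f γ) (X γ)⟩

lemma RealSmooth.zero (U : Set G) :
    RealSmooth (fun γ : G => (0 : TangentSpace 𝓘(ℝ, E) γ)) U :=
  (Bundle.contMDiff_zeroSection ℝ (TangentSpace 𝓘(ℝ, E) (M := G))).contMDiffOn

lemma SmoothField.zero (U : Set G) : SmoothField (fun γ : G => (0 : CTangent E γ)) U :=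
  ⟨(RealSmooth.zero U).congr fun _ _ => map_zero rePart,
    (RealSmooth.zero U).congr fun _ _ => map_zero imPart⟩

lemma RealSmooth.smoothField {X : ∀ γ : G, TangentSpace 𝓘(ℝ, E) γ} {U : Set G}
    (hX : RealSmooth X U) : SmoothField (fun γ => (1 : ℂ) ⊗ₜ[ℝ] X γ) U :=
  ⟨hX.congr fun γ _ => by simp, (RealSmooth.zero U).congr fun γ _ => by simp⟩

lemma SmoothField.sum {ι : Type*} {s : Finset ι} {X : ι → ∀ γ : G, CTangent E γ} {U : Set G}
    (h : ∀ i ∈ s, SmoothField (X i) U) : SmoothField (fun γ => ∑ i ∈ s, X i γ) U := by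
  classical
  induction s using Finset.induction_on with
  | empty => simpa using SmoothField.zero U
  | insert a s ha ih =>
    simp only [Finset.sum_insert ha]
    exact (h a (by simp)).add (ih fun i hi => h i (by simp [hi]))

lemma SmoothFun.realDeriv {f : G → ℂ} {X : ∀ γ : G, TangentSpace 𝓘(ℝ, E) γ} {U : Set G}
    (hU : IsOpen U) (hf : SmoothFun E f U) (hX : RealSmooth X U) :
    SmoothFun E (fun γ => HalfForms.realDeriv f γ (X γ)) U :=
  contMDiffOn_mfderiv_apply hU hf hX

lemma SmoothFun.cDeriv {f : G → ℂ} {X : ∀ γ : G, CTangent E γ} {U : Set G} (hU : IsOpen U)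
    (hf : SmoothFun E f U) (hX : SmoothField X U) :
    SmoothFun E (fun γ => HalfForms.cDeriv f γ (X γ)) U :=
  ((hf.realDeriv hU hX.realSmooth_re).add
    ((smoothFun_const Complex.I U).mul (hf.realDeriv hU hX.realSmooth_im))).congr
      fun γ _ => cDeriv_eq f γ (X γ)

lemma rePart_cBracket (X Y : ∀ γ : G, CTangent E γ) (γ : G) :
    rePart (cBracket X Y γ) =
      VectorField.mlieBracket 𝓘(ℝ, E) (fun x => rePart (X x)) (fun x => rePart (Y x)) γ
        - VectorField.mlieBracket 𝓘(ℝ, E) (fun x => imPart (X x)) (fun x => imPart (Y x)) γ := by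
  simp [cBracket]

lemma imPart_cBracket (X Y : ∀ γ : G, CTangent E γ) (γ : G) :
    imPart (cBracket X Y γ) =
      VectorField.mlieBracket 𝓘(ℝ, E) (fun x => rePart (X x)) (fun x => imPart (Y x)) γ
        + VectorField.mlieBracket 𝓘(ℝ, E) (fun x => imPart (X x)) (fun x => rePart (Y x)) γ := by
  simp [cBracket]

lemma cBracket_congr {X X' Y Y' : ∀ γ : G, CTangent E γ} {U : Set G} (hU : IsOpen U)
    (hX : ∀ γ ∈ U, X γ = X' γ) (hY : ∀ γ ∈ U, Y γ = Y' γ) {γ : G} (hγ : γ ∈ U) :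
    cBracket X Y γ = cBracket X' Y' γ := by
  have h : ∀ {Z Z' W W' : ∀ γ : G, TangentSpace 𝓘(ℝ, E) γ}, (∀ x ∈ U, Z x = Z' x) →
      (∀ x ∈ U, W x = W' x) →
      VectorField.mlieBracket 𝓘(ℝ, E) Z W γ = VectorField.mlieBracket 𝓘(ℝ, E) Z' W' γ := fun h h' =>
    Filter.EventuallyEq.mlieBracket_vectorField_eq
      (Filter.eventuallyEq_of_mem (hU.mem_nhds hγ) h) (Filter.eventuallyEq_of_mem (hU.mem_nhds hγ) h')
  have hXr : ∀ x ∈ U, rePart (X x) = rePart (X' x) := fun x hx => by rw [hX x hx]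
  have hXi : ∀ x ∈ U, imPart (X x) = imPart (X' x) := fun x hx => by rw [hX x hx]
  have hYr : ∀ x ∈ U, rePart (Y x) = rePart (Y' x) := fun x hx => by rw [hY x hx]
  have hYi : ∀ x ∈ U, imPart (Y x) = imPart (Y' x) := fun x hx => by rw [hY x hx]
  apply complexified_ext
  · rw [rePart_cBracket, rePart_cBracket, h hXr hYr, h hXi hYi]
  · rw [imPart_cBracket, imPart_cBracket, h hXr hYi, h hXi hYr]

variable [CompleteSpace E]

lemma SmoothField.cBracket {X Y : ∀ γ : G, CTangent E γ} {U : Set G} (hU : IsOpen U)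
    (hX : SmoothField X U) (hY : SmoothField Y U) : SmoothField (HalfForms.cBracket X Y) U :=
  ⟨((hX.realSmooth_re.bracket hU hY.realSmooth_re).sub
      (hX.realSmooth_im.bracket hU hY.realSmooth_im)).congr fun γ _ => rePart_cBracket X Y γ,
    ((hX.realSmooth_re.bracket hU hY.realSmooth_im).add
      (hX.realSmooth_im.bracket hU hY.realSmooth_re)).congr fun γ _ => imPart_cBracket X Y γ⟩

lemma mvfderiv_re {f : G → ℂ} {γ : G} (hf : MDifferentiableAt 𝓘(ℝ, E) 𝓘(ℝ, ℂ) f γ)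
    (v : TangentSpace 𝓘(ℝ, E) γ) :
    mvfderiv 𝓘(ℝ, E) (fun x => (f x).re) γ v = (realDeriv f γ v).re := by
  have h := (Complex.reCLM.hasMFDerivAt (x := f γ)).comp γ hf.hasMFDerivAt
  exact DFunLike.congr_fun h.mfderiv v

lemma mvfderiv_im {f : G → ℂ} {γ : G} (hf : MDifferentiableAt 𝓘(ℝ, E) 𝓘(ℝ, ℂ) f γ)
    (v : TangentSpace 𝓘(ℝ, E) γ) :
    mvfderiv 𝓘(ℝ, E) (fun x => (f x).im) γ v = (realDeriv f γ v).im := by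
  have h := (Complex.imCLM.hasMFDerivAt (x := f γ)).comp γ hf.hasMFDerivAt
  exact DFunLike.congr_fun h.mfderiv v

lemma mvfderiv_congr {f g : G → ℝ} {γ : G} (h : f =ᶠ[𝓝 γ] g) :
    mvfderiv 𝓘(ℝ, E) f γ = mvfderiv 𝓘(ℝ, E) g γ :=
  ContinuousLinearMap.ext fun v => DFunLike.congr_fun h.mfderiv_eq v

lemma realDeriv_mlieBracket {X Y : ∀ γ : G, TangentSpace 𝓘(ℝ, E) γ} {U : Set G} (hU : IsOpen U)
    (hX : RealSmooth X U) (hY : RealSmooth Y U) {f : G → ℂ} (hf : SmoothFun E f U) {γ : G}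
    (hγ : γ ∈ U) :
    realDeriv f γ (VectorField.mlieBracket 𝓘(ℝ, E) X Y γ) =
      realDeriv (fun x => realDeriv f x (Y x)) γ (X γ) -
      realDeriv (fun x => realDeriv f x (X x)) γ (Y γ) := by
  have hfY := (hf.realDeriv hU hY).mdifferentiableAt hU hγ
  have hfX := (hf.realDeriv hU hX).mdifferentiableAt hU hγ
  have hre : ∀ Z : ∀ γ : G, TangentSpace 𝓘(ℝ, E) γ,
      (fun x => mvfderiv 𝓘(ℝ, E) (fun x => (f x).re) x (Z x)) =ᶠ[𝓝 γ]
        fun x => (realDeriv f x (Z x)).re := fun Z =>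
    Filter.eventuallyEq_of_mem (hU.mem_nhds hγ) fun x hx =>
      mvfderiv_re (hf.mdifferentiableAt hU hx) (Z x)
  have him : ∀ Z : ∀ γ : G, TangentSpace 𝓘(ℝ, E) γ,
      (fun x => mvfderiv 𝓘(ℝ, E) (fun x => (f x).im) x (Z x)) =ᶠ[𝓝 γ]
        fun x => (realDeriv f x (Z x)).im := fun Z =>
    Filter.eventuallyEq_of_mem (hU.mem_nhds hγ) fun x hx =>
      mvfderiv_im (hf.mdifferentiableAt hU hx) (Z x)
  apply Complex.ext
  · rw [Complex.sub_re, ← mvfderiv_re (hf.mdifferentiableAt hU hγ), ← mvfderiv_re hfY,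
      ← mvfderiv_re hfX, mfderiv_mlieBracket hU hX hY hf.contMDiffOn_re hγ]
    rw [mvfderiv_congr (hre Y), mvfderiv_congr (hre X)]
  · rw [Complex.sub_im, ← mvfderiv_im (hf.mdifferentiableAt hU hγ), ← mvfderiv_im hfY,
      ← mvfderiv_im hfX, mfderiv_mlieBracket hU hX hY hf.contMDiffOn_im hγ]
    rw [mvfderiv_congr (him Y), mvfderiv_congr (him X)]

/-- Both sides are the complex bilinear extension of the real formula. The minus sign of the
imaginary-imaginary term in `cBracket` is `I² = -1`, and this is the only relation used at the end.
-/
lemma cDeriv_cBracket {X Y : ∀ γ : G, CTangent E γ} {U : Set G} (hU : IsOpen U)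
    (hX : SmoothField X U) (hY : SmoothField Y U) {f : G → ℂ} (hf : SmoothFun E f U) {γ : G}
    (hγ : γ ∈ U) :
    cDeriv f γ (cBracket X Y γ) =
      cDeriv (fun x => cDeriv f x (Y x)) γ (X γ) - cDeriv (fun x => cDeriv f x (X x)) γ (Y γ) := by
  have expand : ∀ {Z : ∀ γ : G, CTangent E γ}, SmoothField Z U → ∀ v : TangentSpace 𝓘(ℝ, E) γ,
      realDeriv (fun x => cDeriv f x (Z x)) γ v =
        realDeriv (fun x => realDeriv f x (rePart (Z x))) γ v +
        Complex.I * realDeriv (fun x => realDeriv f x (imPart (Z x))) γ v := by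
    intro Z hZ v
    have h1 := (hf.realDeriv hU hZ.realSmooth_re).mdifferentiableAt hU hγ
    have h2 := hf.realDeriv hU hZ.realSmooth_im
    have h3 := ((smoothFun_const Complex.I U).mul h2).mdifferentiableAt hU hγ
    simp only [cDeriv_eq]
    rw [realDeriv_add h1 h3, add_apply]
    congr 1
    have := realDeriv_mul (f := fun _ => Complex.I) mdifferentiableAt_const
      (h2.mdifferentiableAt hU hγ) v
    rw [this]
    have h0 : realDeriv (E := E) (fun _ : G => Complex.I) γ = 0 := mfderiv_const
    simp [h0]
  rw [cDeriv_eq, rePart_cBracket, imPart_cBracket, map_sub, map_add,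
    realDeriv_mlieBracket hU hX.realSmooth_re hY.realSmooth_re hf hγ,
    realDeriv_mlieBracket hU hX.realSmooth_im hY.realSmooth_im hf hγ,
    realDeriv_mlieBracket hU hX.realSmooth_re hY.realSmooth_im hf hγ,
    realDeriv_mlieBracket hU hX.realSmooth_im hY.realSmooth_re hf hγ,
    cDeriv_eq (fun x => cDeriv f x (Y x)), cDeriv_eq (fun x => cDeriv f x (X x)),
    expand hX, expand hX, expand hY, expand hY]
  linear_combination (realDeriv (fun x => realDeriv f x (imPart (X x))) γ (imPart (Y γ)) -
    realDeriv (fun x => realDeriv f x (imPart (Y x))) γ (imPart (X γ))) * Complex.I_sq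

end ComplexFields

/-! ### Frames and coframes of the complexified tangent bundle. -/

section Frames

variable {E : Type*} [NormedAddCommGroup E] [NormedSpace ℝ E]
  {G : Type*} [TopologicalSpace G] [ChartedSpace E G] [IsManifold 𝓘(ℝ, E) ∞ G]

/-- A smooth complex `1`-form on `U`. -/
def SmoothOneForm (θ : ∀ γ : G, Module.Dual ℂ (CTangent E γ)) (U : Set G) : Prop :=
  ∀ V ⊆ U, IsOpen V → ∀ Y : ∀ γ : G, CTangent E γ, SmoothField Y V →
    SmoothFun E (fun γ => θ γ (Y γ)) V

/-- A smooth frame `e` of the complexified tangent bundle over `U`, with dual coframe `c`. -/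
structure IsFrame {ι : Type*} [Fintype ι] [DecidableEq ι] (U : Set G)
    (e : ι → ∀ γ : G, CTangent E γ)
    (c : ι → ∀ γ : G, Module.Dual ℂ (CTangent E γ)) : Prop where
  isOpen : IsOpen U
  smooth : ∀ i, SmoothField (e i) U
  smooth_coframe : ∀ i, SmoothOneForm (c i) U
  dual : ∀ γ ∈ U, ∀ i j, c i γ (e j γ) = if i = j then 1 else 0
  expand : ∀ γ ∈ U, ∀ u : CTangent E γ, u = ∑ i, c i γ u • e i γ

instance (γ : G) [FiniteDimensional ℝ E] : FiniteDimensional ℝ (TangentSpace 𝓘(ℝ, E) γ) :=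
  inferInstanceAs (FiniteDimensional ℝ E)

lemma finrank_cTangent [FiniteDimensional ℝ E] (γ : G) :
    Module.finrank ℂ (CTangent E γ) = Module.finrank ℝ E :=
  Module.finrank_baseChange (R := ℂ) (S := ℝ) (M' := E)

lemma linearMap_complexified_ext {V W : Type*} [AddCommGroup V] [Module ℝ V] [AddCommGroup W]
    [Module ℂ W] {f g : ℂ ⊗[ℝ] V →ₗ[ℂ] W} (h : ∀ v : V, f (1 ⊗ₜ v) = g (1 ⊗ₜ v)) : f = g := by
  refine LinearMap.ext fun u => ?_
  induction u with
  | zero => simp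
  | tmul z v =>
    have : z ⊗ₜ[ℝ] v = z • ((1 : ℂ) ⊗ₜ[ℝ] v) := by simp [TensorProduct.smul_tmul']
    rw [this, map_smul, map_smul, h]
  | add x y hx hy => rw [map_add, map_add, hx, hy]

/-- The coframe consists of the differentials of the coordinates, the frame of the pullbacks of the
constant basis fields along the chart. An arbitrary chart of the maximal atlas is allowed because
the charts in the normal form of a submersion are needed later. -/
theorem isFrame_of_chart [FiniteDimensional ℝ E] {ι : Type*} [Fintype ι] [DecidableEq ι]
    {φ : OpenPartialHomeomorph G E} (hφ : φ ∈ IsManifold.maximalAtlas 𝓘(ℝ, E) ∞ G)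
    (b : Module.Basis ι ℝ E) :
    (∀ i, SmoothFun E (fun γ => ((b.coord i (φ γ) : ℝ) : ℂ)) φ.source) ∧
    ∃ d : ι → ∀ γ : G, CTangent E γ, IsFrame φ.source d
      (fun i γ => cDeriv (fun γ => ((b.coord i (φ γ) : ℝ) : ℂ)) γ) := by
  have : CompleteSpace E := FiniteDimensional.complete ℝ E
  have hsm := contMDiffOn_of_mem_maximalAtlas hφ
  have hsm' := contMDiffOn_symm_of_mem_maximalAtlas hφ
  have hmd : φ.MDifferentiable 𝓘(ℝ, E) 𝓘(ℝ, E) :=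
    ⟨hsm.mdifferentiableOn (by simp), hsm'.mdifferentiableOn (by simp)⟩
  let L : ι → E →L[ℝ] ℂ := fun i =>
    Complex.ofRealCLM ∘L LinearMap.toContinuousLinearMap (b.coord i)
  have hL : ∀ i v, L i v = ((b.coord i v : ℝ) : ℂ) := fun i v => rfl
  have hinv : ∀ γ ∈ φ.source, (mfderiv 𝓘(ℝ, E) 𝓘(ℝ, E) φ γ).IsInvertible := fun γ hγ =>
    ⟨hmd.mfderiv hγ, rfl⟩
  have hx : ∀ i, SmoothFun E (fun γ => ((b.coord i (φ γ) : ℝ) : ℂ)) φ.source := fun i =>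
    (L i).contMDiff.comp_contMDiffOn hsm
  refine ⟨hx, ?_⟩
  have hderiv : ∀ i, ∀ γ ∈ φ.source, ∀ v : TangentSpace 𝓘(ℝ, E) γ,
      realDeriv (fun γ => ((b.coord i (φ γ) : ℝ) : ℂ)) γ v =
        ((b.coord i (mfderiv 𝓘(ℝ, E) 𝓘(ℝ, E) φ γ v) : ℝ) : ℂ) := by
    intro i γ hγ v
    have h := ((L i).hasMFDerivAt (x := φ γ)).comp γ (hmd.mdifferentiableAt hγ).hasMFDerivAt
    exact DFunLike.congr_fun h.mfderiv v
  let D : ι → ∀ γ : G, TangentSpace 𝓘(ℝ, E) γ := fun i =>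
    VectorField.mpullback 𝓘(ℝ, E) 𝓘(ℝ, E) φ (fun _ => b i)
  have hD : ∀ i, ∀ γ ∈ φ.source, mfderiv 𝓘(ℝ, E) 𝓘(ℝ, E) φ γ (D i γ) = b i := by
    intro i γ hγ
    rw [show D i γ = (mfderiv 𝓘(ℝ, E) 𝓘(ℝ, E) φ γ).inverse (b i) from rfl]
    obtain ⟨A, hA⟩ := hinv γ hγ
    rw [← hA, ContinuousLinearMap.inverse_equiv]
    exact A.apply_symm_apply _
  have hDs : ∀ i, RealSmooth (D i) φ.source := by
    intro i γ hγ
    refine (ContMDiffAt.mpullback_vectorField_preimage (m := ∞) (n := ∞) ?_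
      (hsm.contMDiffAt (φ.open_source.mem_nhds hγ)) (hinv γ hγ) (by simp)).contMDiffWithinAt
    rw [← contMDiffWithinAt_univ]
    exact contMDiffWithinAt_vectorSpace_iff_contDiffWithinAt.2 contDiffWithinAt_const
  refine ⟨fun i γ => (1 : ℂ) ⊗ₜ[ℝ] D i γ, φ.open_source, fun i => (hDs i).smoothField,
    fun i V hV hVo Y hY => SmoothFun.cDeriv hVo ((hx i).mono hV) hY, ?_, ?_⟩
  · intro γ hγ i j
    rw [cDeriv_one_tmul, hderiv i γ hγ, hD j γ hγ]
    simp only [Module.Basis.coord_apply, Module.Basis.repr_self, Finsupp.single_apply, eq_comm]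
    split_ifs <;> simp
  · intro γ hγ u
    -- Written as an identity of `ℂ`-linear endomorphisms, the expansion need only be checked on
    -- real vectors, where the injectivity of the derivative of the chart decides it.
    have : (LinearMap.id : CTangent E γ →ₗ[ℂ] CTangent E γ) = ∑ i, LinearMap.smulRight
        (cDeriv (fun γ => ((b.coord i (φ γ) : ℝ) : ℂ)) γ) ((1 : ℂ) ⊗ₜ[ℝ] D i γ) := by
      refine linearMap_complexified_ext fun v => ?_
      simp only [LinearMap.id_coe, id_eq, LinearMap.sum_apply, LinearMap.smulRight_apply,
        cDeriv_one_tmul, hderiv _ γ hγ]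
      have hv : v = ∑ i, (b.coord i (mfderiv 𝓘(ℝ, E) 𝓘(ℝ, E) φ γ v)) • D i γ := by
        apply hmd.mfderiv_injective hγ
        rw [map_sum]
        simp only [map_smul, hD _ γ hγ]
        exact (b.sum_repr _).symm
      nth_rewrite 1 [hv]
      rw [TensorProduct.tmul_sum]
      refine Finset.sum_congr rfl fun i _ => ?_
      rw [TensorProduct.tmul_smul, TensorProduct.smul_tmul', TensorProduct.smul_tmul']
      simp
    simpa using DFunLike.congr_fun this u

variable {ι : Type*} [Fintype ι] [DecidableEq ι] {U : Set G} {e : ι → ∀ γ : G, CTangent E γ}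
  {c : ι → ∀ γ : G, Module.Dual ℂ (CTangent E γ)}

lemma IsFrame.linearIndependent (h : IsFrame U e c) {γ : G} (hγ : γ ∈ U) :
    LinearIndependent ℂ (fun i => e i γ) := by
  rw [Fintype.linearIndependent_iff]
  intro g hg i
  have := congrArg (c i γ) hg
  simpa [map_sum, h.dual γ hγ] using this

lemma IsFrame.smooth_field_iff (h : IsFrame U e c) {V : Set G} (hV : V ⊆ U) (hVo : IsOpen V)
    {Y : ∀ γ : G, CTangent E γ} :
    SmoothField Y V ↔ ∀ i, SmoothFun E (fun γ => c i γ (Y γ)) V :=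
  ⟨fun hY i => h.smooth_coframe i V hV hVo Y hY, fun hc =>
    (SmoothField.sum fun i (_ : i ∈ Finset.univ) => ((h.smooth i).mono hV).smul (hc i)).congr
      fun γ hγ => h.expand γ (hV hγ) (Y γ)⟩

lemma exists_coordinates [FiniteDimensional ℝ E] (γ₀ : G)
    (hι : Fintype.card ι = Module.finrank ℝ E) :
    ∃ U : Set G, γ₀ ∈ U ∧ ∃ (x : ι → G → ℂ) (d : ι → ∀ γ : G, CTangent E γ),
      (∀ i, SmoothFun E (x i) U) ∧ IsFrame U d (fun i γ => cDeriv (x i) γ) := by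
  let b := (Module.finBasis ℝ E).reindex (Fintype.equivOfCardEq (by simpa using hι.symm))
  obtain ⟨h1, d, h2⟩ := isFrame_of_chart (E := E) (G := G) (φ := chartAt E γ₀)
    (IsManifold.chart_mem_maximalAtlas γ₀) b
  exact ⟨_, mem_chart_source E γ₀, _, d, h1, h2⟩

/-- Independence is an open condition: the matrix of the fields in a coordinate frame has nonzero
determinant near `γ₀`. By Cramer's rule its inverse is smooth there, and the rows of the inverse
give the dual coframe. -/
theorem exists_isFrame_of_basis [FiniteDimensional ℝ E] {γ₀ : G} (hU : IsOpen U) (hγ₀ : γ₀ ∈ U)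
    (he : ∀ i, SmoothField (e i) U) (hli : LinearIndependent ℂ (fun i => e i γ₀))
    (hι : Fintype.card ι = Module.finrank ℝ E) :
    ∃ (V : Set G) (c : ι → ∀ γ : G, Module.Dual ℂ (CTangent E γ)),
      V ⊆ U ∧ γ₀ ∈ V ∧ IsFrame V e c := by
  obtain ⟨U', hγ', x, d, hx, hd⟩ := exists_coordinates (E := E) γ₀ hι
  let M : G → Matrix ι ι ℂ := fun γ => Matrix.of fun i j => cDeriv (x i) γ (e j γ)
  have hM : ∀ i j, SmoothFun E (fun γ => M γ i j) (U ∩ U') := fun i j =>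
    hd.smooth_coframe i _ Set.inter_subset_right (hU.inter hd.isOpen) _
      ((he j).mono Set.inter_subset_left)
  have hdet : SmoothFun E (fun γ => (M γ).det) (U ∩ U') := SmoothFun.det hM
  have hMe : ∀ γ ∈ U', ∀ v : ι → ℂ,
      ∑ i, ((M γ).mulVec v) i • d i γ = ∑ j, v j • e j γ := by
    intro γ hγ v
    have h2 := hd.expand γ hγ (∑ j, v j • e j γ)
    rw [h2]
    refine Finset.sum_congr rfl fun i _ => ?_
    congr 1
    simp [M, Matrix.mulVec, dotProduct, mul_comm]
  have h0 : (M γ₀).det ≠ 0 := by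
    intro h
    obtain ⟨v, hv, hv0⟩ := Matrix.exists_mulVec_eq_zero_iff.2 h
    have h3 := hMe γ₀ hγ' v
    rw [hv0] at h3
    simp only [Pi.zero_apply, zero_smul, Finset.sum_const_zero] at h3
    exact hv (funext fun i => Fintype.linearIndependent_iff.1 hli v h3.symm i)
  let V := (U ∩ U') ∩ (fun γ => (M γ).det) ⁻¹' {0}ᶜ
  have hVo : IsOpen V :=
    hdet.continuousOn.isOpen_inter_preimage (hU.inter hd.isOpen) isOpen_compl_singleton
  have hu : ∀ γ ∈ V, IsUnit (M γ).det := fun γ hγ => isUnit_iff_ne_zero.2 hγ.2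
  have hMinv : ∀ i j, SmoothFun E (fun γ => (M γ)⁻¹ i j) V := by
    intro i j
    have hadj : SmoothFun E (fun γ => (M γ).adjugate i j) V := by
      simp only [Matrix.adjugate_apply]
      refine SmoothFun.det fun k l => ?_
      by_cases hk : k = j
      · subst hk
        simp only [Matrix.updateRow_self]
        exact smoothFun_const _ _
      · simp only [Matrix.updateRow_ne hk]
        exact (hM k l).mono Set.inter_subset_left
    refine (((hdet.mono Set.inter_subset_left).inv fun γ hγ => hγ.2).mul hadj).congr fun γ hγ => ?_
    simp [Matrix.inv_def, Ring.inverse_eq_inv']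
  refine ⟨V, fun i γ => ∑ j, (M γ)⁻¹ i j • cDeriv (x j) γ,
    fun γ hγ => hγ.1.1, ⟨⟨hγ₀, hγ'⟩, h0⟩, hVo, fun i => (he i).mono fun γ hγ => hγ.1.1, ?_, ?_, ?_⟩
  · intro i W hW hWo Y hY
    simp only [LinearMap.sum_apply, LinearMap.smul_apply, smul_eq_mul]
    exact SmoothFun.sum fun j _ => ((hMinv i j).mono hW).mul
      (hd.smooth_coframe j W (fun γ hγ => (hW hγ).1.2) hWo Y hY)
  · intro γ hγ i j
    have := congrFun (congrFun (Matrix.nonsing_inv_mul (M γ) (hu γ hγ)) i) j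
    simpa [Matrix.mul_apply, M, Matrix.one_apply] using this
  · intro γ hγ u
    have h4 := hMe γ hγ.1.2 (fun i => ∑ j, (M γ)⁻¹ i j * cDeriv (x j) γ u)
    simp only [LinearMap.sum_apply, LinearMap.smul_apply, smul_eq_mul]
    rw [← h4]
    have h5 : (M γ).mulVec (fun i => ∑ j, (M γ)⁻¹ i j * cDeriv (x j) γ u) =
        fun j => cDeriv (x j) γ u := by
      have : (fun i => ∑ j, (M γ)⁻¹ i j * cDeriv (x j) γ u) =
        (M γ)⁻¹.mulVec (fun j => cDeriv (x j) γ u) := rfl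
      rw [this, Matrix.mulVec_mulVec, Matrix.mul_nonsing_inv _ (hu γ hγ), Matrix.one_mulVec]
    rw [h5]
    exact hd.expand γ hγ.1.2 u

end Frames

/-! ### Local sections of distributions and adapted frames. -/

section AdaptedFrames

variable {E : Type*} [NormedAddCommGroup E] [NormedSpace ℝ E]
  {G : Type*} [TopologicalSpace G] [ChartedSpace E G] [IsManifold 𝓘(ℝ, E) ∞ G]

lemma IsDistribution.exists_section {P : ∀ γ : G, Submodule ℂ (CTangent E γ)}
    (hP : IsDistribution P) {γ₀ : G} {v : CTangent E γ₀} (hv : v ∈ P γ₀) :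
    ∃ U : Set G, IsOpen U ∧ γ₀ ∈ U ∧ ∃ X : ∀ γ : G, P γ, SmoothIn P X U ∧
      (X γ₀ : CTangent E γ₀) = v := by
  classical
  obtain ⟨U, hU, hγ, r, e, he, hspan⟩ := hP γ₀
  rw [← (hspan γ₀ hγ).2, Submodule.mem_span_range_iff_exists_fun] at hv
  obtain ⟨a, ha⟩ := hv
  have hmem : ∀ γ ∈ U, ∑ i, a i • e i γ ∈ P γ := fun γ hγ => by
    rw [← (hspan γ hγ).2]
    exact Submodule.sum_mem _ fun i _ => Submodule.smul_mem _ _ (Submodule.subset_span ⟨i, rfl⟩)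
  -- Sections are total families with values in `P`; outside `U` the combination of frame vectors
  -- need not lie in `P`, so zero is used there.
  refine ⟨U, hU, hγ, fun γ => if h : γ ∈ U then ⟨_, hmem γ h⟩ else 0, ?_, by simp [hγ, ha]⟩
  refine (SmoothField.sum fun i (_ : i ∈ Finset.univ) =>
    (he i).smul (smoothFun_const (a i) U)).congr fun γ hγ => ?_
  simp [hγ]

lemma IsDistribution.finrank_eventually_eq {P : ∀ γ : G, Submodule ℂ (CTangent E γ)}
    (hP : IsDistribution P) (γ₀ : G) :
    ∃ U : Set G, IsOpen U ∧ γ₀ ∈ U ∧ ∀ γ ∈ U,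
      Module.finrank ℂ (P γ) = Module.finrank ℂ (P γ₀) := by
  obtain ⟨U, hU, hγ, r, e, he, hspan⟩ := hP γ₀
  have h : ∀ γ ∈ U, Module.finrank ℂ (P γ) = r := fun γ hγ => by
    rw [← (hspan γ hγ).2, finrank_span_eq_card (hspan γ hγ).1, Fintype.card_fin]
  exact ⟨U, hU, hγ, fun γ hγ' => by rw [h γ hγ', h γ₀ hγ]⟩

lemma isDistribution_top [FiniteDimensional ℝ E] :
    IsDistribution (fun γ : G => (⊤ : Submodule ℂ (CTangent E γ))) := by
  intro γ₀
  obtain ⟨U, hγ, x, d, hx, hd⟩ := exists_coordinates (E := E) (ι := Fin (Module.finrank ℝ E)) γ₀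
    (by simp)
  refine ⟨U, hd.isOpen, hγ, _, d, hd.smooth, fun γ hγ => ⟨hd.linearIndependent hγ, ?_⟩⟩
  rw [eq_top_iff]
  intro u _
  rw [hd.expand γ hγ u]
  exact Submodule.sum_mem _ fun i _ => Submodule.smul_mem _ _ (Submodule.subset_span ⟨i, rfl⟩)

lemma IsDistribution.exists_sections {P : ∀ γ : G, Submodule ℂ (CTangent E γ)}
    (hP : IsDistribution P) {γ₀ : G} {ι : Type*} [Finite ι] {v : ι → CTangent E γ₀}
    (hv : ∀ i, v i ∈ P γ₀) :
    ∃ U : Set G, IsOpen U ∧ γ₀ ∈ U ∧ ∃ X : ι → ∀ γ : G, P γ, (∀ i, SmoothIn P (X i) U) ∧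
      ∀ i, (X i γ₀ : CTangent E γ₀) = v i := by
  choose U hU hγ X hX hXv using fun i => hP.exists_section (hv i)
  exact ⟨⋂ i, U i, isOpen_iInter_of_finite hU, Set.mem_iInter.2 hγ, X,
    fun i => (hX i).mono (Set.iInter_subset U i), hXv⟩

variable {ι : Type*} [Fintype ι] [DecidableEq ι] {U : Set G} {e : ι → ∀ γ : G, CTangent E γ}
  {c : ι → ∀ γ : G, Module.Dual ℂ (CTangent E γ)}

/-- The basis of the complexified tangent space at a point given by a frame. -/
def IsFrame.basis (h : IsFrame U e c) {γ : G} (hγ : γ ∈ U) : Module.Basis ι ℂ (CTangent E γ) :=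
  Module.Basis.mk (h.linearIndependent hγ) (by
    intro u _
    rw [h.expand γ hγ u]
    exact Submodule.sum_mem _ fun i _ =>
      Submodule.smul_mem _ _ (Submodule.subset_span ⟨i, rfl⟩))

lemma IsFrame.basis_apply (h : IsFrame U e c) {γ : G} (hγ : γ ∈ U) (i : ι) :
    h.basis hγ i = e i γ := by simp [IsFrame.basis]

lemma IsFrame.basis_repr (h : IsFrame U e c) {γ : G} (hγ : γ ∈ U) (u : CTangent E γ) (i : ι) :
    (h.basis hγ).repr u i = c i γ u := by
  have : (h.basis hγ).coord i = c i γ := (h.basis hγ).ext fun j => by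
    rw [h.basis_apply, h.dual γ hγ, Module.Basis.coord_apply, ← h.basis_apply hγ j,
      Module.Basis.repr_self, Finsupp.single_apply]
    simp [eq_comm]
  rw [← this]; rfl

lemma IsFrame.mem_span_iff (h : IsFrame U e c) {γ : G} (hγ : γ ∈ U) (S : Set ι)
    (u : CTangent E γ) :
    u ∈ Submodule.span ℂ ((fun i => e i γ) '' S) ↔ ∀ i ∉ S, c i γ u = 0 := by
  have h1 : (fun i => e i γ) '' S = h.basis hγ '' S :=
    Set.image_congr fun i _ => (h.basis_apply hγ i).symm
  rw [h1, Module.Basis.mem_span_image]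
  simp only [← h.basis_repr hγ, Set.subset_def, Finset.mem_coe, Finsupp.mem_support_iff]
  exact forall_congr' fun i => not_imp_comm

/-- A frame of the complexified tangent bundle adapted to the distributions `P` and `T`: its first
part is a frame of `P`, and its second part consists of sections of `T` that complete it to a frame
of `P ⊔ T`. -/
structure IsAdaptedFrame (P T : ∀ γ : G, Submodule ℂ (CTangent E γ)) {r m l : ℕ} (U : Set G)
    (e : Fin r ⊕ Fin m ⊕ Fin l → ∀ γ : G, CTangent E γ)
    (c : Fin r ⊕ Fin m ⊕ Fin l → ∀ γ : G, Module.Dual ℂ (CTangent E γ)) : Prop where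
  isFrame : IsFrame U e c
  mem_left : ∀ i γ, e (.inl i) γ ∈ P γ
  mem_right : ∀ i γ, e (.inr (.inl i)) γ ∈ T γ
  mem_left_iff : ∀ γ ∈ U, ∀ u, u ∈ P γ ↔ ∀ i, c (.inr i) γ u = 0
  mem_sup_iff : ∀ γ ∈ U, ∀ u, u ∈ P γ ⊔ T γ ↔ ∀ i, c (.inr (.inr i)) γ u = 0
  finrank_eq : ∀ γ ∈ U, Module.finrank ℂ ↥(T γ ⊓ P γ) + m = Module.finrank ℂ (T γ)

/-- At `γ₀` the tangent space splits as `P ⊕ C₁ ⊕ C₂` with `C₁ ⊆ T` and `P ⊕ C₁ = P + T`. Bases of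
the three pieces extend to local sections of `P`, of `T` and of the full bundle, and these stay
independent nearby. That the first block spans `P` and the first two span `P + T` at nearby points
is a dimension count. Here the constant rank of `T ∩ P` is essential, since it makes the dimension
of `P + T` locally constant. -/
theorem exists_adaptedFrame [FiniteDimensional ℝ E] {P T : ∀ γ : G, Submodule ℂ (CTangent E γ)}
    (hP : IsDistribution P) (hT : IsDistribution T) {k : ℕ}
    (hk : ∀ γ, Module.finrank ℂ ↥(T γ ⊓ P γ) = k) (γ₀ : G) :
    ∃ (r m l : ℕ) (U : Set G) (e : Fin r ⊕ Fin m ⊕ Fin l → ∀ γ : G, CTangent E γ)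
      (c : Fin r ⊕ Fin m ⊕ Fin l → ∀ γ : G, Module.Dual ℂ (CTangent E γ)),
      γ₀ ∈ U ∧ IsAdaptedFrame P T U e c := by
  obtain ⟨C, hC⟩ := exists_isCompl (P γ₀ ⊓ T γ₀)
  obtain ⟨C₂, hC₂⟩ := exists_isCompl (P γ₀ ⊔ T γ₀)
  -- As `C` complements `P ∩ T` in the whole space, the modular law makes `C ⊓ T` a complement of `P
  -- ∩ T` inside `T`.
  set C₁ := C ⊓ T γ₀ with hC₁
  have hdisj : Disjoint (P γ₀) C₁ := by
    rw [disjoint_iff, hC₁, eq_bot_iff, ← hC.inf_eq_bot]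
    exact fun x hx => ⟨⟨hx.1, hx.2.2⟩, hx.2.1⟩
  have hsup : P γ₀ ⊔ C₁ = P γ₀ ⊔ T γ₀ := by
    have h1 : (P γ₀ ⊓ T γ₀) ⊔ C₁ = T γ₀ := by
      rw [hC₁, sup_inf_assoc_of_le C (inf_le_right : P γ₀ ⊓ T γ₀ ≤ T γ₀) |>.symm, hC.sup_eq_top,
        top_inf_eq]
    conv_rhs => rw [← h1]
    rw [← sup_assoc, sup_inf_self]
  let bP := Module.finBasis ℂ (P γ₀)
  let b₁ := Module.finBasis ℂ C₁
  let b₂ := Module.finBasis ℂ C₂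
  obtain ⟨U₀, hU₀, hγ₀, X₀, hX₀, hv₀⟩ := hP.exists_sections (v := fun i => (bP i : CTangent E γ₀))
    fun i => (bP i).2
  obtain ⟨U₁, hU₁, hγ₁, X₁, hX₁, hv₁⟩ := hT.exists_sections (v := fun i => (b₁ i : CTangent E γ₀))
    fun i => (b₁ i).2.2
  obtain ⟨U₂, hU₂, hγ₂, X₂, hX₂, hv₂⟩ := (isDistribution_top (E := E) (G := G)).exists_sections
    (v := fun i => (b₂ i : CTangent E γ₀)) fun i => Submodule.mem_top
  obtain ⟨U₃, hU₃, hγ₃, hr₃⟩ := hP.finrank_eventually_eq γ₀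
  obtain ⟨U₄, hU₄, hγ₄, hr₄⟩ := hT.finrank_eventually_eq γ₀
  have spn : ∀ {C : Submodule ℂ (CTangent E γ₀)} {n : ℕ} (b : Module.Basis (Fin n) ℂ C),
      Submodule.span ℂ (Set.range fun i => (b i : CTangent E γ₀)) = C := by
    intro C n b
    rw [show (Set.range fun i => (b i : CTangent E γ₀)) = C.subtype '' Set.range b by
      rw [← Set.range_comp]; rfl, Submodule.span_image, b.span_eq, Submodule.map_top,
      Submodule.range_subtype]
  have lin : ∀ {C : Submodule ℂ (CTangent E γ₀)} {n : ℕ} (b : Module.Basis (Fin n) ℂ C),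
      LinearIndependent ℂ (fun i => (b i : CTangent E γ₀)) := fun {C n} b =>
    b.linearIndependent.map' C.subtype C.ker_subtype
  let e : Fin (Module.finrank ℂ (P γ₀)) ⊕ Fin (Module.finrank ℂ C₁) ⊕ Fin (Module.finrank ℂ C₂) →
      ∀ γ : G, CTangent E γ :=
    Sum.elim (fun i γ => X₀ i γ) (Sum.elim (fun i γ => X₁ i γ) (fun i γ => X₂ i γ))
  let W := U₀ ∩ U₁ ∩ U₂ ∩ U₃ ∩ U₄
  have hW : IsOpen W := (((hU₀.inter hU₁).inter hU₂).inter hU₃).inter hU₄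
  have heW : ∀ i, SmoothField (e i) W := by
    rintro (i | i | i)
    · exact (hX₀ i).mono fun γ hγ => hγ.1.1.1.1
    · exact (hX₁ i).mono fun γ hγ => hγ.1.1.1.2
    · exact (hX₂ i).mono fun γ hγ => hγ.1.1.2
  have he0 : (fun i => e i γ₀) = Sum.elim (fun i => (bP i : CTangent E γ₀))
      (Sum.elim (fun i => (b₁ i : CTangent E γ₀)) (fun i => (b₂ i : CTangent E γ₀))) := by
    funext i
    rcases i with i | i | i
    · exact hv₀ i
    · exact hv₁ i
    · exact hv₂ i
  have hdisj₂ : Disjoint C₁ C₂ := hC₂.disjoint.mono_left (hsup ▸ le_sup_right)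
  have hdisj₃ : Disjoint (P γ₀) (C₁ ⊔ C₂) := by
    refine Disjoint.disjoint_sup_right_of_disjoint_sup_left hdisj ?_
    rw [hsup]; exact hC₂.disjoint
  have hli : LinearIndependent ℂ (fun i => e i γ₀) := by
    rw [he0]
    refine (lin bP).sum_type ((lin b₁).sum_type (lin b₂) ?_) ?_
    · rw [spn, spn]; exact hdisj₂
    · rw [Set.Sum.elim_range, Submodule.span_union, spn, spn, spn]; exact hdisj₃
  have hspan : Submodule.span ℂ (Set.range fun i => e i γ₀) = ⊤ := by
    rw [he0, Set.Sum.elim_range, Set.Sum.elim_range, Submodule.span_union, Submodule.span_union,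
      spn, spn, spn, ← sup_assoc, hsup, hC₂.sup_eq_top]
  have hcard : Fintype.card (Fin (Module.finrank ℂ (P γ₀)) ⊕ Fin (Module.finrank ℂ C₁) ⊕
      Fin (Module.finrank ℂ C₂)) = Module.finrank ℝ E := by
    rw [← finrank_cTangent (E := E) γ₀, ← finrank_span_eq_card hli, hspan, finrank_top]
  have hsupdim : Module.finrank ℂ (P γ₀) + Module.finrank ℂ C₁ =
      Module.finrank ℂ ↥(P γ₀ ⊔ T γ₀) := by
    rw [← hsup, ← Submodule.finrank_sup_add_finrank_inf_eq, hdisj.eq_bot, finrank_bot, add_zero]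
  have hdim : ∀ γ, Module.finrank ℂ ↥(P γ ⊔ T γ) + k =
      Module.finrank ℂ (P γ) + Module.finrank ℂ (T γ) := fun γ => by
    rw [← Submodule.finrank_sup_add_finrank_inf_eq, inf_comm, hk]
  obtain ⟨V, c, hVW, hγV, hfr⟩ := exists_isFrame_of_basis hW
    ⟨⟨⟨⟨hγ₀, hγ₁⟩, hγ₂⟩, hγ₃⟩, hγ₄⟩ heW hli hcard
  have hmemP : ∀ i γ, e (.inl i) γ ∈ P γ := fun i γ => (X₀ i γ).2
  have hmemT : ∀ i γ, e (.inr (.inl i)) γ ∈ T γ := fun i γ => (X₁ i γ).2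
  refine ⟨_, _, _, V, e, c, hγV, hfr, hmemP, hmemT, ?_, ?_, ?_⟩
  · intro γ hγ u
    have hsub : Submodule.span ℂ (Set.range fun i => e (.inl i) γ) = P γ := by
      refine Submodule.eq_of_le_of_finrank_eq ?_ ?_
      · rw [Submodule.span_le]; rintro _ ⟨i, rfl⟩; exact hmemP i γ
      · rw [finrank_span_eq_card (b := fun i => e (.inl i) γ)
            ((hfr.linearIndependent hγ).comp Sum.inl Sum.inl_injective), Fintype.card_fin, hr₃ γ (hVW hγ).1.2]
    rw [← hsub, show (Set.range fun i => e (.inl i) γ) = (fun i => e i γ) '' Set.range Sum.inl by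
      rw [← Set.range_comp]; rfl, hfr.mem_span_iff hγ]
    constructor
    · exact fun h i => h _ (by simp)
    · rintro h (i | i) hi
      · simp at hi
      · exact h i
  · intro γ hγ u
    -- `f` selects the first two blocks of the frame.
    let f : Fin (Module.finrank ℂ (P γ₀)) ⊕ Fin (Module.finrank ℂ C₁) →
        Fin (Module.finrank ℂ (P γ₀)) ⊕ Fin (Module.finrank ℂ C₁) ⊕ Fin (Module.finrank ℂ C₂) :=
      Sum.map id Sum.inl
    have hf : Function.Injective f := Function.injective_id.sumMap Sum.inl_injective
    have hsub : Submodule.span ℂ (Set.range fun i => e (f i) γ) = P γ ⊔ T γ := by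
      refine Submodule.eq_of_le_of_finrank_eq ?_ ?_
      · rw [Submodule.span_le]
        rintro _ ⟨i | i, rfl⟩
        · exact Submodule.mem_sup_left (hmemP i γ)
        · exact Submodule.mem_sup_right (hmemT i γ)
      · rw [finrank_span_eq_card (b := fun i => e (f i) γ)
            ((hfr.linearIndependent hγ).comp f hf), Fintype.card_sum,
          Fintype.card_fin, Fintype.card_fin, hsupdim]
        have h1 := hdim γ
        have h2 := hdim γ₀
        rw [hr₃ γ (hVW hγ).1.2, hr₄ γ (hVW hγ).2] at h1
        omega
    rw [← hsub, show (Set.range fun i => e (f i) γ) = (fun i => e i γ) '' Set.range f by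
      rw [← Set.range_comp]; rfl, hfr.mem_span_iff hγ]
    constructor
    · exact fun h i => h _ (by simp [f])
    · rintro h (i | i | i) hi
      · exact absurd ⟨.inl i, rfl⟩ hi
      · exact absurd ⟨.inr i, rfl⟩ hi
      · exact h i
  · intro γ hγ
    have h2 := hdim γ₀
    rw [hk, hr₄ γ (hVW hγ).2]
    omega

end AdaptedFrames

/-! ### Submersions and lifting of curves. -/

section Submersions

universe uE

variable {E : Type uE} [NormedAddCommGroup E] [NormedSpace ℝ E]
  {F : Type*} [NormedAddCommGroup F] [NormedSpace ℝ F]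
  {G : Type*} [TopologicalSpace G] [ChartedSpace E G]
  {M : Type*} [TopologicalSpace M] [ChartedSpace F M]

lemma rePart_cMap (f : G → M) (γ : G) (u : CTangent E γ) :
    rePart (cMap (F := F) f γ u) = mfderiv 𝓘(ℝ, E) 𝓘(ℝ, F) f γ (rePart u) :=
  rePart_baseChange _ u

lemma imPart_cMap (f : G → M) (γ : G) (u : CTangent E γ) :
    imPart (cMap (F := F) f γ u) = mfderiv 𝓘(ℝ, E) 𝓘(ℝ, F) f γ (imPart u) :=
  imPart_baseChange _ u

lemma cDeriv_comp {g : M → ℂ} {f : G → M} {γ : G}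
    (hg : MDifferentiableAt 𝓘(ℝ, F) 𝓘(ℝ, ℂ) g (f γ))
    (hf : MDifferentiableAt 𝓘(ℝ, E) 𝓘(ℝ, F) f γ) (u : CTangent E γ) :
    cDeriv (fun x => g (f x)) γ u = cDeriv g (f γ) (cMap (F := F) f γ u) := by
  have h : realDeriv (E := E) (fun x => g (f x)) γ =
      (realDeriv (E := F) g (f γ)).comp (mfderiv 𝓘(ℝ, E) 𝓘(ℝ, F) f γ) :=
    mfderiv_comp γ hg hf
  rw [cDeriv_eq, cDeriv_eq, rePart_cMap, imPart_cMap, h]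
  rfl

/-- The local normal form of a submersion. -/
lemma exists_normalForm {f : G → M} (hf : Manifold.IsSubmersion 𝓘(ℝ, E) 𝓘(ℝ, F) ∞ f) (γ₀ : G) :
    ∃ (K : Type uE) (_ : NormedAddCommGroup K) (_ : NormedSpace ℝ K) (A : E ≃L[ℝ] F × K)
      (φ : OpenPartialHomeomorph G E) (ψ : OpenPartialHomeomorph M F),
      φ ∈ IsManifold.maximalAtlas 𝓘(ℝ, E) ∞ G ∧ ψ ∈ IsManifold.maximalAtlas 𝓘(ℝ, F) ∞ M ∧
      γ₀ ∈ φ.source ∧ (∀ γ ∈ φ.source, f γ ∈ ψ.source) ∧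
      ∀ γ ∈ φ.source, ψ (f γ) = (A (φ γ)).1 := by
  have h := (hf.isSubmersionAt γ₀).isSubmersionAtOfComplement_complement
  refine ⟨(hf.isSubmersionAt γ₀).complement, inferInstance, inferInstance, h.equiv, h.domChart, h.codChart, h.domChart_mem_maximalAtlas,
    h.codChart_mem_maximalAtlas, h.mem_domChart_source, fun γ hγ => h.source_subset_preimage_source hγ,
    fun γ hγ => ?_⟩
  have h2 := h.writtenInCharts (show h.domChart γ ∈ (h.domChart.extend 𝓘(ℝ, E)).target by
    simpa using h.domChart.map_source hγ)
  simpa [h.domChart.left_inv hγ] using h2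

lemma mdifferentiable_of_mem_maximalAtlas {φ : OpenPartialHomeomorph G E}
    (hφ : φ ∈ IsManifold.maximalAtlas 𝓘(ℝ, E) ∞ G) : φ.MDifferentiable 𝓘(ℝ, E) 𝓘(ℝ, E) :=
  ⟨(contMDiffOn_of_mem_maximalAtlas hφ).mdifferentiableOn (by simp),
    (contMDiffOn_symm_of_mem_maximalAtlas hφ).mdifferentiableOn (by simp)⟩

/-- The derivative of a map between manifolds, as a map between the model spaces. -/
def modelDeriv (f : G → M) (γ : G) : E →L[ℝ] F := mfderiv 𝓘(ℝ, E) 𝓘(ℝ, F) f γ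

/-- The curve `η` passes at time `0` through `γ` with velocity `w`. -/
def HasVelocity (η : ℝ → G) (γ : G) (w : E) : Prop :=
  η 0 = γ ∧ ∃ L : ℝ →L[ℝ] E, HasMFDerivAt 𝓘(ℝ, ℝ) 𝓘(ℝ, E) η 0 L ∧ L 1 = w

lemma HasVelocity.comp {η : ℝ → G} {γ : G} {w : E} (h : HasVelocity η γ w) {f : G → M}
    (hf : MDifferentiableAt 𝓘(ℝ, E) 𝓘(ℝ, F) f γ) :
    HasVelocity (fun τ => f (η τ)) (f γ) (modelDeriv (E := E) (F := F) f γ w) := by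
  obtain ⟨rfl, L, h, rfl⟩ := h
  exact ⟨rfl, (modelDeriv (E := E) (F := F) f (η 0)).comp L, hf.hasMFDerivAt.comp 0 h, rfl⟩

/-- Velocities are recorded in the model space, so `γ` and `γ'` may be different terms for the same
point. Identities between groupoid expressions can then be differentiated without transporting
tangent vectors along equalities. -/
lemma HasVelocity.unique {η η' : ℝ → G} {γ γ' : G} {w w' : E} (h : HasVelocity η γ w)
    (h' : HasVelocity η' γ' w') (he : η =ᶠ[𝓝 0] η') : w = w' := by
  obtain ⟨-, L, h, rfl⟩ := h
  obtain ⟨-, L', h', rfl⟩ := h'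
  have h2 : L = L' := hasMFDerivAt_unique h (h'.congr_of_eventuallyEq he)
  rw [h2]

lemma HasVelocity.eventually_mem {η : ℝ → G} {γ : G} {w : E} (h : HasVelocity η γ w) {U : Set G}
    (hU : IsOpen U) (hγ : γ ∈ U) : ∀ᶠ τ in 𝓝 (0 : ℝ), η τ ∈ U :=
  h.2.choose_spec.1.continuousAt.eventually_mem (hU.mem_nhds (by rw [h.1]; exact hγ))

lemma hasVelocity_const (γ : G) : HasVelocity (fun _ => γ) γ (0 : E) :=
  ⟨rfl, 0, hasMFDerivAt_const γ (0 : ℝ), rfl⟩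

lemma hasVelocity_iff_hasDerivAt {e : ℝ → E} {x w : E} :
    HasVelocity e x w ↔ e 0 = x ∧ HasDerivAt e w 0 := by
  refine and_congr_right fun _ => ⟨?_, fun h => ⟨_, h.hasFDerivAt.hasMFDerivAt, by simp⟩⟩
  rintro ⟨L, h, rfl⟩
  have h' : HasFDerivAt e L (0 : ℝ) := hasMFDerivAt_iff_hasFDerivAt.1 h
  exact h'.hasDerivAt

lemma modelDeriv_symm {φ : OpenPartialHomeomorph G E}
    (hφ : φ ∈ IsManifold.maximalAtlas 𝓘(ℝ, E) ∞ G) {γ₀ : G} (hγ₀ : γ₀ ∈ φ.source) (w : E) :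
    modelDeriv (E := E) (F := E) φ.symm (φ γ₀) (modelDeriv (E := E) (F := E) φ γ₀ w) = w :=
  DFunLike.congr_fun ((mdifferentiable_of_mem_maximalAtlas hφ).symm_comp_deriv hγ₀) w

/-- In a chart, curves with given velocity can be described by their coordinate expression. -/
lemma hasVelocity_symm_comp {φ : OpenPartialHomeomorph G E}
    (hφ : φ ∈ IsManifold.maximalAtlas 𝓘(ℝ, E) ∞ G) {γ₀ : G} (hγ₀ : γ₀ ∈ φ.source) (w : E)
    {e : ℝ → E} (he : HasVelocity e (φ γ₀) (modelDeriv (E := E) (F := E) φ γ₀ w)) :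
    HasVelocity (fun τ => φ.symm (e τ)) γ₀ w := by
  have hmd := mdifferentiable_of_mem_maximalAtlas hφ
  have h := he.comp (hmd.mdifferentiableAt_symm (φ.map_source hγ₀))
  rwa [φ.left_inv hγ₀, modelDeriv_symm hφ hγ₀] at h

lemma hasVelocity_line (x w : E) : HasVelocity (fun τ : ℝ => x + τ • w) x w :=
  hasVelocity_iff_hasDerivAt.2
    ⟨by simp, by simpa using ((hasDerivAt_id (0 : ℝ)).smul_const w).const_add x⟩

lemma exists_curve [IsManifold 𝓘(ℝ, E) ∞ G] (γ₀ : G) (w : E) :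
    ∃ η : ℝ → G, HasVelocity η γ₀ w :=
  ⟨_, hasVelocity_symm_comp (IsManifold.chart_mem_maximalAtlas (I := 𝓘(ℝ, E)) (n := ∞) γ₀)
    (mem_chart_source E γ₀) w (hasVelocity_line _ _)⟩

lemma modelDeriv_normalForm {f : G → M} {K : Type*} [NormedAddCommGroup K] [NormedSpace ℝ K]
    {A : E ≃L[ℝ] F × K} {φ : OpenPartialHomeomorph G E} {ψ : OpenPartialHomeomorph M F}
    (hφ : φ ∈ IsManifold.maximalAtlas 𝓘(ℝ, E) ∞ G) (hψ : ψ ∈ IsManifold.maximalAtlas 𝓘(ℝ, F) ∞ M)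
    (hmaps : ∀ γ ∈ φ.source, f γ ∈ ψ.source) (hnf : ∀ γ ∈ φ.source, ψ (f γ) = (A (φ γ)).1)
    {γ : G} (hγ : γ ∈ φ.source) (hf : MDifferentiableAt 𝓘(ℝ, E) 𝓘(ℝ, F) f γ) (w : E) :
    modelDeriv (E := F) (F := F) ψ (f γ) (modelDeriv (E := E) (F := F) f γ w) =
      (A (modelDeriv (E := E) (F := E) φ γ w)).1 := by
  have hφd := mdifferentiable_of_mem_maximalAtlas hφ
  have hψd := mdifferentiable_of_mem_maximalAtlas hψ
  have h1 := (hψd.mdifferentiableAt (hmaps γ hγ)).hasMFDerivAt.comp γ hf.hasMFDerivAt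
  have h2 := (((ContinuousLinearMap.fst ℝ F K).comp (A : E →L[ℝ] F × K)).hasMFDerivAt
    (x := φ γ)).comp γ (hφd.mdifferentiableAt hγ).hasMFDerivAt
  have h3 : (ψ ∘ f) =ᶠ[𝓝 γ] ((ContinuousLinearMap.fst ℝ F K).comp (A : E →L[ℝ] F × K)) ∘ φ :=
    Filter.eventuallyEq_of_mem (φ.open_source.mem_nhds hγ) hnf
  have h4 := hasMFDerivAt_unique (h2.congr_of_eventuallyEq h3) h1
  exact (DFunLike.congr_fun h4 w).symm

lemma submersion_mdifferentiableAt {f : G → M}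
    (hf : Manifold.IsSubmersion 𝓘(ℝ, E) 𝓘(ℝ, F) ∞ f) (γ : G) :
    MDifferentiableAt 𝓘(ℝ, E) 𝓘(ℝ, F) f γ := (hf.contMDiff γ).mdifferentiableAt (by simp)

/-- Curves lift along submersions, with prescribed velocity. -/
lemma exists_lift_curve {f : G → M} (hf : Manifold.IsSubmersion 𝓘(ℝ, E) 𝓘(ℝ, F) ∞ f)
    (γ₀ : G) (w : E) {c : ℝ → M}
    (hc : HasVelocity c (f γ₀) (modelDeriv (E := E) (F := F) f γ₀ w)) :
    ∃ η : ℝ → G, HasVelocity η γ₀ w ∧ ∀ᶠ τ in 𝓝 0, f (η τ) = c τ := by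
  obtain ⟨K, _, _, A, φ, ψ, hφ, hψ, hγ₀, hmaps, hnf⟩ := exists_normalForm hf γ₀
  have hx₀ : f γ₀ ∈ ψ.source := hmaps γ₀ hγ₀
  set w' : E := modelDeriv (E := E) (F := E) φ γ₀ w with hw'
  have hψc := hc.comp ((mdifferentiable_of_mem_maximalAtlas hψ).mdifferentiableAt hx₀)
  rw [modelDeriv_normalForm hφ hψ hmaps hnf hγ₀ (submersion_mdifferentiableAt hf γ₀) w, ← hw',
    hnf γ₀ hγ₀, hasVelocity_iff_hasDerivAt] at hψc
  -- In the normal form `f` is the projection `F × K → F`. The lift follows `c` in the first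
  -- component and runs along a straight line in `K`, whose slope is dictated by `w`.
  let e : ℝ → E := fun τ => A.symm (ψ (c τ), (A (φ γ₀)).2 + τ • (A w').2)
  have he : HasVelocity e (φ γ₀) w' := by
    have h1 := hasVelocity_iff_hasDerivAt.1 (hasVelocity_line (A (φ γ₀)).2 (A w').2)
    have h2 := (A.symm : F × K →L[ℝ] E).hasFDerivAt.comp_hasDerivAt 0 (hψc.2.prodMk h1.2)
    refine hasVelocity_iff_hasDerivAt.2 ⟨?_, ?_⟩
    · simp only [e, hψc.1, h1.1]
      exact A.symm_apply_apply _
    · have h3 : (A.symm : F × K →L[ℝ] E) ((A w').1, (A w').2) = w' := A.symm_apply_apply w'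
      rw [h3] at h2
      exact h2
  refine ⟨fun τ => φ.symm (e τ), hasVelocity_symm_comp hφ hγ₀ w he, ?_⟩
  filter_upwards [he.eventually_mem φ.open_target (φ.map_source hγ₀),
    hc.eventually_mem ψ.open_source hx₀] with τ h1 h2
  refine ψ.injOn (hmaps _ (φ.map_target h1)) h2 ?_
  rw [hnf _ (φ.map_target h1), φ.right_inv h1]
  simp [e]

/-- A function that vanishes on a fibre of a submersion has vanishing derivative along it. -/
lemma cDeriv_eq_zero_of_fibre {f : G → M} (hf : Manifold.IsSubmersion 𝓘(ℝ, E) 𝓘(ℝ, F) ∞ f)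
    {γ₀ : G} {U : Set G} (hU : IsOpen U) (hγ₀ : γ₀ ∈ U) {h : G → ℂ} (hh : SmoothFun E h U)
    (h0 : ∀ γ ∈ U, f γ = f γ₀ → h γ = 0) {u : CTangent E γ₀} (hu : cMap (F := F) f γ₀ u = 0) :
    cDeriv h γ₀ u = 0 := by
  have key : ∀ w : E, modelDeriv (E := E) (F := F) f γ₀ w = 0 →
      modelDeriv (E := E) (F := ℂ) h γ₀ w = 0 := by
    intro w hw
    -- A vertical vector is the velocity of a lift of the constant curve, that is, of a curve inside
    -- the fibre, where `h` vanishes.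
    obtain ⟨η, hη, hev⟩ := exists_lift_curve hf γ₀ w (c := fun _ => f γ₀)
      (hw ▸ hasVelocity_const (f γ₀))
    have h2 := hη.comp (hh.mdifferentiableAt hU hγ₀)
    rw [h0 γ₀ hγ₀ rfl] at h2
    refine h2.unique (hasVelocity_const (0 : ℂ)) ?_
    filter_upwards [hη.eventually_mem hU hγ₀, hev] with τ h4 h5
    exact h0 _ h4 h5
  have hr := congrArg rePart hu
  have hi := congrArg imPart hu
  rw [rePart_cMap, map_zero] at hr
  rw [imPart_cMap, map_zero] at hi
  have hr' : realDeriv h γ₀ (rePart u) = 0 := key _ hr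
  have hi' : realDeriv h γ₀ (imPart u) = 0 := key _ hi
  rw [cDeriv_eq, hr', hi', mul_zero, add_zero]

end Submersions

/-! ### Kernels of submersions and involutivity of the sum. -/

section Kernels

universe uE

variable {E : Type uE} [NormedAddCommGroup E] [NormedSpace ℝ E] [FiniteDimensional ℝ E]
  {F : Type*} [NormedAddCommGroup F] [NormedSpace ℝ F] [FiniteDimensional ℝ F]
  {G : Type*} [TopologicalSpace G] [ChartedSpace E G] [IsManifold 𝓘(ℝ, E) ∞ G]
  {M : Type*} [TopologicalSpace M] [ChartedSpace F M] [IsManifold 𝓘(ℝ, F) ∞ M]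

/-- A frame whose last vectors span the kernel of the derivative of a submersion. -/
lemma exists_frame_submersion {f : G → M} (hf : Manifold.IsSubmersion 𝓘(ℝ, E) 𝓘(ℝ, F) ∞ f)
    (γ₀ : G) :
    ∃ (U : Set G) (d : Fin (Module.finrank ℝ F) ⊕ Fin (Module.finrank ℝ E - Module.finrank ℝ F) →
        ∀ γ : G, CTangent E γ)
      (c : Fin (Module.finrank ℝ F) ⊕ Fin (Module.finrank ℝ E - Module.finrank ℝ F) →
        ∀ γ : G, Module.Dual ℂ (CTangent E γ)),
      γ₀ ∈ U ∧ IsFrame U d c ∧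
        ∀ γ ∈ U, ∀ u, cMap (F := F) f γ u = 0 ↔ ∀ i, c (.inl i) γ u = 0 := by
  obtain ⟨K, _, _, A, φ, ψ, hφ, hψ, hγ₀, hmaps, hnf⟩ := exists_normalForm hf γ₀
  have : FiniteDimensional ℝ (F × K) := A.toLinearEquiv.finiteDimensional
  have : FiniteDimensional ℝ K :=
    Module.Finite.of_surjective (LinearMap.snd ℝ F K) LinearMap.snd_surjective
  have hK : Module.finrank ℝ K = Module.finrank ℝ E - Module.finrank ℝ F := by
    rw [A.toLinearEquiv.finrank_eq, Module.finrank_prod, Nat.add_sub_cancel_left]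
  let bF := Module.finBasis ℝ F
  -- With this basis the first coordinates of `φ` are the coordinates of `ψ ∘ f`, so their
  -- differentials factor through `Tf`.
  let b := (bF.prod (Module.finBasisOfFinrankEq ℝ K hK)).map A.symm.toLinearEquiv
  obtain ⟨h1, d, hd⟩ := isFrame_of_chart (E := E) (G := G) hφ b
  obtain ⟨h2, dM, hdM⟩ := isFrame_of_chart (E := F) (G := M) hψ bF
  refine ⟨φ.source, d, _, hγ₀, hd, fun γ hγ u => ?_⟩
  have key : ∀ i, cDeriv (fun γ => ((b.coord (.inl i) (φ γ) : ℝ) : ℂ)) γ u =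
      cDeriv (fun x => ((bF.coord i (ψ x) : ℝ) : ℂ)) (f γ) (cMap (F := F) f γ u) := by
    intro i
    rw [← cDeriv_comp ((h2 i).mdifferentiableAt ψ.open_source (hmaps γ hγ))
      (submersion_mdifferentiableAt hf γ)]
    refine DFunLike.congr_fun (cDeriv_congr_on φ.open_source (fun x hx => ?_) hγ) u
    rw [hnf x hx]
    simp [b, Module.Basis.prod_repr_inl]
  constructor
  · intro h i
    rw [key, h, map_zero]
  · intro h
    rw [hdM.expand (f γ) (hmaps γ hγ) (cMap (F := F) f γ u)]
    exact Finset.sum_eq_zero fun i _ => by rw [← key, h, zero_smul]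

lemma IsFrame.isDistribution_aux {ι κ : Type*} [Fintype ι] [DecidableEq ι] [Fintype κ]
    {U : Set G} {e : ι → ∀ γ : G, CTangent E γ} {c : ι → ∀ γ : G, Module.Dual ℂ (CTangent E γ)}
    (h : IsFrame U e c) {γ : G} (hγ : γ ∈ U) {Q : Submodule ℂ (CTangent E γ)} {j : κ → ι}
    (hj : Function.Injective j)
    (hQ : ∀ u, u ∈ Q ↔ ∀ i ∉ Set.range j, c i γ u = 0) :
    LinearIndependent ℂ (fun i => e (j i) γ) ∧
      Submodule.span ℂ (Set.range fun i => e (j i) γ) = Q := by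
  refine ⟨(h.linearIndependent hγ).comp j hj, ?_⟩
  ext u
  rw [hQ, ← h.mem_span_iff hγ, ← Set.range_comp]
  rfl

/-- Passes from the dual description, `Q` as the common kernel of part of a coframe, to a spanning
frame: the vectors indexed by the range of `j`. -/
lemma isDistribution_of_frames {Q : ∀ γ : G, Submodule ℂ (CTangent E γ)}
    (h : ∀ γ₀ : G, ∃ (ι κ : Type) (_ : Fintype ι) (_ : DecidableEq ι) (_ : Fintype κ) (j : κ → ι)
      (U : Set G) (e : ι → ∀ γ : G, CTangent E γ) (c : ι → ∀ γ : G, Module.Dual ℂ (CTangent E γ)),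
      γ₀ ∈ U ∧ IsFrame U e c ∧ Function.Injective j ∧
      ∀ γ ∈ U, ∀ u, u ∈ Q γ ↔ ∀ i ∉ Set.range j, c i γ u = 0) : IsDistribution Q := by
  intro γ₀
  obtain ⟨ι, κ, _, _, _, j, U, e, c, hγ₀, he, hj, hQ⟩ := h γ₀
  have σ := (Fintype.equivFin κ).symm
  refine ⟨U, he.isOpen, hγ₀, Fintype.card κ, fun i => e (j (σ i)), fun i => he.smooth _,
    fun γ hγ => ?_⟩
  refine he.isDistribution_aux hγ (hj.comp σ.injective) fun u => ?_
  rw [hQ γ hγ u]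
  simp only [Set.mem_range, σ.surjective.exists]

lemma isDistribution_ker {f : G → M} (hf : Manifold.IsSubmersion 𝓘(ℝ, E) 𝓘(ℝ, F) ∞ f) :
    IsDistribution (fun γ => LinearMap.ker (cMap (E := E) (F := F) f γ)) := by
  refine isDistribution_of_frames fun γ₀ => ?_
  obtain ⟨U, d, c, hγ₀, hd, h⟩ := exists_frame_submersion hf γ₀
  refine ⟨_, _, _, _, inferInstance, Sum.inr, U, d, c, hγ₀, hd, Sum.inr_injective,
    fun γ hγ u => ?_⟩
  rw [LinearMap.mem_ker, h γ hγ]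
  simp

lemma finrank_ker {f : G → M} (hf : Manifold.IsSubmersion 𝓘(ℝ, E) 𝓘(ℝ, F) ∞ f) (γ : G) :
    Module.finrank ℂ (LinearMap.ker (cMap (E := E) (F := F) f γ)) =
      Module.finrank ℝ E - Module.finrank ℝ F := by
  obtain ⟨U, d, c, hγ, hd, h⟩ := exists_frame_submersion hf γ
  have := hd.isDistribution_aux hγ (Q := LinearMap.ker (cMap (E := E) (F := F) f γ))
    Sum.inr_injective fun u => by rw [LinearMap.mem_ker, h γ hγ]; simp
  rw [← this.2, finrank_span_eq_card this.1, Fintype.card_fin]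

variable {P T : ∀ γ : G, Submodule ℂ (CTangent E γ)}

lemma isDistribution_sup (hP : IsDistribution P) (hT : IsDistribution T) {k : ℕ}
    (hk : ∀ γ, Module.finrank ℂ ↥(T γ ⊓ P γ) = k) : IsDistribution (fun γ => P γ ⊔ T γ) := by
  refine isDistribution_of_frames fun γ₀ => ?_
  obtain ⟨r, m, l, U, e, c, hγ₀, he⟩ := exists_adaptedFrame hP hT hk γ₀
  refine ⟨_, Fin r ⊕ Fin m, inferInstance, inferInstance, inferInstance, Sum.map id Sum.inl, U, e,
    c, hγ₀, he.isFrame, Function.injective_id.sumMap Sum.inl_injective, fun γ hγ u => ?_⟩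
  rw [he.mem_sup_iff γ hγ]
  simp

/-- The two summands are the components of `X` along the first two blocks of the frame; the third
block does not contribute. -/
lemma IsAdaptedFrame.exists_decomposition {r m l : ℕ} {U : Set G}
    {e : Fin r ⊕ Fin m ⊕ Fin l → ∀ γ : G, CTangent E γ}
    {c : Fin r ⊕ Fin m ⊕ Fin l → ∀ γ : G, Module.Dual ℂ (CTangent E γ)}
    (h : IsAdaptedFrame P T U e c) {V : Set G} (hV : V ⊆ U) (hVo : IsOpen V)
    {X : ∀ γ : G, CTangent E γ} (hX : SmoothField X V) (hXm : ∀ γ ∈ V, X γ ∈ P γ ⊔ T γ) :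
    ∃ p v : ∀ γ : G, CTangent E γ, SmoothField p V ∧ SmoothField v V ∧ (∀ γ, p γ ∈ P γ) ∧
      (∀ γ, v γ ∈ T γ) ∧ ∀ γ ∈ V, X γ = p γ + v γ := by
  have hs := fun i => (h.isFrame.smooth_field_iff hV hVo).1 hX i
  refine ⟨fun γ => ∑ i, c (.inl i) γ (X γ) • e (.inl i) γ,
    fun γ => ∑ i, c (.inr (.inl i)) γ (X γ) • e (.inr (.inl i)) γ,
    SmoothField.sum fun i _ => ((h.isFrame.smooth _).mono hV).smul (hs _),
    SmoothField.sum fun i _ => ((h.isFrame.smooth _).mono hV).smul (hs _),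
    fun γ => Submodule.sum_mem _ fun i _ => Submodule.smul_mem _ _ (h.mem_left _ _),
    fun γ => Submodule.sum_mem _ fun i _ => Submodule.smul_mem _ _ (h.mem_right _ _),
    fun γ hγ => ?_⟩
  have h0 := (h.mem_sup_iff γ (hV hγ) _).1 (hXm γ hγ)
  conv_lhs => rw [h.isFrame.expand γ (hV hγ) (X γ)]
  simp [Fintype.sum_sum_type, h0]

/-- If an involutive distribution `P` has constant image along the fibres of a submersion, then its
sum with the tangent distribution of the fibres is involutive. -/
theorem isInvolutive_sup_ker {f : G → M} (hf : Manifold.IsSubmersion 𝓘(ℝ, E) 𝓘(ℝ, F) ∞ f)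
    (hP : IsInvolutive P) {k : ℕ}
    (hk : ∀ γ, Module.finrank ℂ ↥(LinearMap.ker (cMap (E := E) (F := F) f γ) ⊓ P γ) = k)
    (hfib : ∀ γ γ' : G, f γ = f γ' → ∀ u ∈ P γ', ∃ v ∈ P γ,
      (⟨f γ', cMap (F := F) f γ' u⟩ : Σ x : M, CTangent F x) = ⟨f γ, cMap (F := F) f γ v⟩) :
    IsInvolutive (fun γ => P γ ⊔ LinearMap.ker (cMap (E := E) (F := F) f γ)) := by
  have : CompleteSpace E := FiniteDimensional.complete ℝ E
  refine ⟨isDistribution_sup hP.isDistribution (isDistribution_ker hf) hk, ?_⟩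
  intro U hU X Y hX hY hXm hYm γ₀ hγ₀
  obtain ⟨r, m, l, W, e, c, hγW, he⟩ :=
    exists_adaptedFrame hP.isDistribution (isDistribution_ker hf) hk γ₀
  obtain ⟨N, hN, y, d, hy, hd⟩ :=
    exists_coordinates (E := F) (ι := Fin (Module.finrank ℝ F)) (f γ₀) (by simp)
  have hNo := hd.isOpen
  let V := U ∩ W ∩ f ⁻¹' N
  have hVo : IsOpen V := (hU.inter he.isFrame.isOpen).inter (hNo.preimage hf.contMDiff.continuous)
  have hγV : γ₀ ∈ V := ⟨⟨hγ₀, hγW⟩, hN⟩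
  obtain ⟨p, v, hp, hv, hpm, hvm, hpv⟩ := he.exists_decomposition (V := V) (fun γ h => h.1.2) hVo
    (hX.mono fun γ h => h.1.1) (fun γ h => hXm γ h.1.1)
  obtain ⟨p', v', hp', hv', hpm', hvm', hpv'⟩ := he.exists_decomposition (V := V)
    (fun γ h => h.1.2) hVo (hY.mono fun γ h => h.1.1) (fun γ h => hYm γ h.1.1)
  -- Membership in `P + ker Tf` means that the image under `Tf` lies in `Tf(P)`. If this fails for
  -- the bracket, some functional `c₀` on the tangent space of the base kills `Tf(P γ₀)` but not the
  -- image of the bracket.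
  rw [← Submodule.comap_map_eq, Submodule.mem_comap]
  by_contra hcon
  obtain ⟨c₀, hc₀, hc₀P⟩ := Submodule.exists_le_ker_of_notMem hcon
  -- A function near `f γ₀` whose differential at this point is `c₀`.
  let gM : M → ℂ := fun x => ∑ i, c₀ (d i (f γ₀)) * y i x
  have hgM : SmoothFun F gM N := SmoothFun.sum fun i _ => (smoothFun_const _ N).mul (hy i)
  have hgM0 : ∀ w, cDeriv gM (f γ₀) w = c₀ w := by
    intro w
    rw [cDeriv_sum hNo (fun i _ => (smoothFun_const _ N).mul (hy i)) hN]
    conv_rhs => rw [hd.expand _ hN w, map_sum]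
    refine Finset.sum_congr rfl fun i _ => ?_
    rw [cDeriv_const_mul _ ((hy i).mdifferentiableAt hNo hN), map_smul, smul_eq_mul, mul_comm]
  let g : G → ℂ := fun γ => gM (f γ)
  have hg : SmoothFun E g V := 
    ContMDiffOn.comp (g := gM) (t := N) hgM hf.contMDiff.contMDiffOn fun γ h => h.2
  have hgd : ∀ γ ∈ V, ∀ u, cDeriv g γ u = cDeriv gM (f γ) (cMap (F := F) f γ u) := fun γ h u =>
    cDeriv_comp (hgM.mdifferentiableAt hNo h.2) (submersion_mdifferentiableAt hf γ) u
  have hker : ∀ γ ∈ V, ∀ u ∈ LinearMap.ker (cMap (E := E) (F := F) f γ), cDeriv g γ u = 0 :=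
    fun γ h u hu => by rw [hgd γ h, LinearMap.mem_ker.1 hu, map_zero]
  -- On the fibre through `γ₀` the image `Tf(P γ)` is contained in `Tf(P γ₀)`, which `c₀` kills. Off
  -- this fibre nothing is claimed, and nothing is needed.
  have hfibre : ∀ γ ∈ V, f γ = f γ₀ → ∀ u ∈ P γ, cDeriv g γ u = 0 := by
    intro γ h hγ u hu
    obtain ⟨w, hw, hwe⟩ := hfib γ₀ γ hγ.symm u hu
    have h2 := congrArg (fun s : Σ x : M, CTangent F x => cDeriv gM s.1 s.2) hwe
    rw [hgd γ h]
    refine h2.trans ?_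
    rw [hgM0]
    exact LinearMap.mem_ker.1 (hc₀P (Submodule.mem_map_of_mem hw))
  have hXg : ∀ γ ∈ V, cDeriv g γ (X γ) = cDeriv g γ (p γ) := fun γ h => by
    rw [hpv γ h, map_add, hker γ h _ (hvm γ), add_zero]
  have hYg : ∀ γ ∈ V, cDeriv g γ (Y γ) = cDeriv g γ (p' γ) := fun γ h => by
    rw [hpv' γ h, map_add, hker γ h _ (hvm' γ), add_zero]
  -- The vertical parts drop out of the inner derivatives, so `[X,Y]g = X(p'g) - Y(pg)`. They drop
  -- out of the outer ones too, because `pg` and `p'g` vanish on the fibre. What is left is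
  -- `[p,p']g`, which is zero by involutivity of `P`; this contradicts the choice of `c₀`.
  have h1 := cDeriv_cBracket hVo (hX.mono fun γ h => h.1.1) (hY.mono fun γ h => h.1.1) hg hγV
  have h2 := cDeriv_cBracket hVo hp hp' hg hγV
  rw [cDeriv_congr_on hVo hXg hγV, cDeriv_congr_on hVo hYg hγV, hpv γ₀ hγV, hpv' γ₀ hγV,
    map_add, map_add,
    cDeriv_eq_zero_of_fibre hf hVo hγV (hg.cDeriv hVo hp') (fun γ h hγ => hfibre γ h hγ _ (hpm' γ))
      (LinearMap.mem_ker.1 (hvm γ₀)),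
    cDeriv_eq_zero_of_fibre hf hVo hγV (hg.cDeriv hVo hp) (fun γ h hγ => hfibre γ h hγ _ (hpm γ))
      (LinearMap.mem_ker.1 (hvm' γ₀)), add_zero, add_zero, ← h2,
    hfibre γ₀ hγV rfl _ (hP.bracket_mem V hVo p p' hp hp' (fun γ _ => hpm γ) (fun γ _ => hpm' γ)
      γ₀ hγV), hgd γ₀ hγV, hgM0] at h1
  exact hc₀ h1

end Kernels

/-! ### Tangent groupoid, multiplicative and Hermitian distributions. -/

section Groupoids

lemma conjC_smul {V : Type*} [AddCommGroup V] [Module ℝ V] (z : ℂ) (u : ℂ ⊗[ℝ] V) :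
    conjC (z • u) = (starRingEnd ℂ) z • conjC u := by
  apply complexified_ext
  · simp only [rePart_conjC, rePart_smul, imPart_conjC]; simp
  · simp only [imPart_conjC, imPart_smul, rePart_conjC]; simp [add_comm]

lemma conjC_conjC {V : Type*} [AddCommGroup V] [Module ℝ V] (u : ℂ ⊗[ℝ] V) :
    conjC (conjC u) = u := by
  apply complexified_ext <;> simp [rePart_conjC, imPart_conjC]

variable {E : Type*} [NormedAddCommGroup E] [NormedSpace ℝ E]
  {F : Type*} [NormedAddCommGroup F] [NormedSpace ℝ F]
  {G : Type*} [TopologicalSpace G] [ChartedSpace E G]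
  {M : Type*} [TopologicalSpace M] [ChartedSpace F M]

lemma cMap_conjC (f : G → M) (γ : G) (u : CTangent E γ) :
    cMap (F := F) f γ (conjC u) = conjC (cMap (F := F) f γ u) := by
  apply complexified_ext
  · rw [rePart_conjC, rePart_cMap, rePart_cMap, rePart_conjC]
  · rw [imPart_conjC, imPart_cMap, imPart_cMap, imPart_conjC, map_neg]

/-- The real part of a complex tangent vector, in the model space. -/
def modelRe {γ : G} (u : CTangent E γ) : E := rePart u

/-- The imaginary part of a complex tangent vector, in the model space. -/
def modelIm {γ : G} (u : CTangent E γ) : E := imPart u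

/-- Composability compares vectors in fibres over two terms for one base point. As every tangent
space is the model space, this amounts to equality of base points and of real and imaginary parts
there. -/
lemma sigma_cTangent_iff {x y : M} {a : CTangent F x} {b : CTangent F y} :
    (⟨x, a⟩ : Σ x : M, CTangent F x) = ⟨y, b⟩ ↔
      x = y ∧ modelRe a = modelRe b ∧ modelIm a = modelIm b := by
  constructor
  · intro h
    exact ⟨congrArg Sigma.fst h, congrArg (fun s : Σ x : M, CTangent F x => modelRe s.2) h,
      congrArg (fun s : Σ x : M, CTangent F x => modelIm s.2) h⟩
  · rintro ⟨rfl, hr, hi⟩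
    rw [complexified_ext (u := a) (u' := b) hr hi]

lemma cTangent_eq_zero_iff {x : M} {a : CTangent F x} :
    a = 0 ↔ modelRe a = 0 ∧ modelIm a = 0 := by
  constructor
  · rintro rfl
    exact ⟨map_zero (rePart (V := TangentSpace 𝓘(ℝ, F) x)),
      map_zero (imPart (V := TangentSpace 𝓘(ℝ, F) x))⟩
  · rintro ⟨hr, hi⟩
    exact complexified_ext (hr.trans (map_zero (rePart (V := TangentSpace 𝓘(ℝ, F) x))).symm)
      (hi.trans (map_zero (imPart (V := TangentSpace 𝓘(ℝ, F) x))).symm)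

lemma modelRe_cMap (f : G → M) (γ : G) (u : CTangent E γ) :
    modelRe (cMap (F := F) f γ u) = modelDeriv (E := E) (F := F) f γ (modelRe u) :=
  rePart_cMap f γ u

lemma modelIm_cMap (f : G → M) (γ : G) (u : CTangent E γ) :
    modelIm (cMap (F := F) f γ u) = modelDeriv (E := E) (F := F) f γ (modelIm u) :=
  imPart_cMap f γ u

namespace LieGroupoid

variable [IsManifold 𝓘(ℝ, E) ∞ G] (𝒢 : LieGroupoid E F G M)

/-- The derivative of the multiplication as a map between model spaces. -/
def modelMul (γ η : G) (v w : E) : E := 𝒢.mulDeriv γ η (v, w)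

lemma modelRe_cMul (γ η : G) (v : CTangent E γ) (w : CTangent E η) :
    modelRe (𝒢.cMul γ η v w) = 𝒢.modelMul γ η (modelRe v) (modelRe w) := by
  have h : rePart (𝒢.cMul γ η v w) = 𝒢.mulDeriv γ η (rePart v, rePart w) := by
    rw [cMul, map_add, rePart_baseChange, rePart_baseChange]
    simp only [LinearMap.comp_apply, LinearMap.inl_apply, LinearMap.inr_apply]
    rw [← map_add]
    simp
  exact h

lemma modelIm_cMul (γ η : G) (v : CTangent E γ) (w : CTangent E η) :
    modelIm (𝒢.cMul γ η v w) = 𝒢.modelMul γ η (modelIm v) (modelIm w) := by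
  have h : imPart (𝒢.cMul γ η v w) = 𝒢.mulDeriv γ η (imPart v, imPart w) := by
    rw [cMul, map_add, imPart_baseChange, imPart_baseChange]
    simp only [LinearMap.comp_apply, LinearMap.inl_apply, LinearMap.inr_apply]
    rw [← map_add]
    simp
  exact h

/-- Composable tangent vectors are velocities of composable curves. -/
lemma exists_composable_curves {γ η : G} (h : 𝒢.src γ = 𝒢.tgt η) {v w : E}
    (hvw : modelDeriv (E := E) (F := F) 𝒢.src γ v = modelDeriv (E := E) (F := F) 𝒢.tgt η w) :
    ∃ c₁ c₂ : ℝ → G, HasVelocity c₁ γ v ∧ HasVelocity c₂ η w ∧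
      (∀ᶠ τ in 𝓝 0, 𝒢.src (c₁ τ) = 𝒢.tgt (c₂ τ)) ∧
      HasVelocity (fun τ => 𝒢.mul (c₁ τ) (c₂ τ)) (𝒢.mul γ η) (𝒢.modelMul γ η v w) := by
  obtain ⟨c₁, hc₁⟩ := exists_curve γ v
  have h1 := hc₁.comp (submersion_mdifferentiableAt 𝒢.submersion_src γ)
  rw [h, hvw] at h1
  -- `c₁` is any curve with velocity `v`, and `c₂` lifts its source curve along the target map, with
  -- the prescribed velocity `w`.
  obtain ⟨c₂, hc₂, hev⟩ := exists_lift_curve 𝒢.submersion_tgt η w h1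
  refine ⟨c₁, c₂, hc₁, hc₂, hev.mono fun τ hτ => hτ.symm, by simp only [hc₁.1, hc₂.1], ?_⟩
  obtain ⟨h01, L₁, hL₁, rfl⟩ := hc₁
  obtain ⟨h02, L₂, hL₂, rfl⟩ := hc₂
  subst h01 h02
  have hm := ((𝒢.smooth_mul (c₁ 0, c₂ 0) h).mdifferentiableWithinAt (by simp)).hasMFDerivWithinAt
  -- The multiplication is differentiable only within the composable pairs, so the chain rule holds
  -- within the set of times at which the curves are composable. This set is a neighbourhood of `0`,
  -- hence the derivative is an unrestricted one.
  have hcomp := HasMFDerivWithinAt.comp (s := {τ | 𝒢.src (c₁ τ) = 𝒢.tgt (c₂ τ)})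
    (u := {p : G × G | 𝒢.src p.1 = 𝒢.tgt p.2}) (0 : ℝ) hm
    (hL₁.prodMk hL₂).hasMFDerivWithinAt
    (Set.Subset.refl {τ | 𝒢.src (c₁ τ) = 𝒢.tgt (c₂ τ)})
  exact ⟨_, hcomp.hasMFDerivAt (hev.mono fun τ hτ => hτ.symm), rfl⟩

/-- Differentiate `t(γη) = t(γ)` along composable curves. -/
lemma tgt_modelMul {γ η : G} (h : 𝒢.src γ = 𝒢.tgt η) {v w : E}
    (hvw : modelDeriv (E := E) (F := F) 𝒢.src γ v = modelDeriv (E := E) (F := F) 𝒢.tgt η w) :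
    modelDeriv (E := E) (F := F) 𝒢.tgt (𝒢.mul γ η) (𝒢.modelMul γ η v w) =
      modelDeriv (E := E) (F := F) 𝒢.tgt γ v := by
  obtain ⟨c₁, c₂, hc₁, hc₂, hev, hm⟩ := 𝒢.exists_composable_curves h hvw
  have h1 := hm.comp (submersion_mdifferentiableAt 𝒢.submersion_tgt _)
  have h2 := hc₁.comp (submersion_mdifferentiableAt 𝒢.submersion_tgt _)
  exact h1.unique h2 (hev.mono fun τ hτ => 𝒢.tgt_mul _ _ hτ)

lemma src_modelMul {γ η : G} (h : 𝒢.src γ = 𝒢.tgt η) {v w : E}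
    (hvw : modelDeriv (E := E) (F := F) 𝒢.src γ v = modelDeriv (E := E) (F := F) 𝒢.tgt η w) :
    modelDeriv (E := E) (F := F) 𝒢.src (𝒢.mul γ η) (𝒢.modelMul γ η v w) =
      modelDeriv (E := E) (F := F) 𝒢.src η w := by
  obtain ⟨c₁, c₂, hc₁, hc₂, hev, hm⟩ := 𝒢.exists_composable_curves h hvw
  have h1 := hm.comp (submersion_mdifferentiableAt 𝒢.submersion_src _)
  have h2 := hc₂.comp (submersion_mdifferentiableAt 𝒢.submersion_src _)
  exact h1.unique h2 (hev.mono fun τ hτ => 𝒢.src_mul _ _ hτ)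

variable {𝒢} {P : ∀ γ : G, Submodule ℂ (CTangent E γ)}

/-- Write `γ' = γ (γ⁻¹ γ')`. By multiplicativity `u` is the product of some `v` in `P γ` with a
second vector, and `Tt` of a product is `Tt` of its first factor. -/
lemma IsMultiplicative.tgt_image (hP : 𝒢.IsMultiplicative P) (γ γ' : G)
    (h : 𝒢.tgt γ = 𝒢.tgt γ') : ∀ u ∈ P γ', ∃ v ∈ P γ,
      (⟨𝒢.tgt γ', cMap (F := F) 𝒢.tgt γ' u⟩ : Σ x : M, CTangent F x) =
        ⟨𝒢.tgt γ, cMap (F := F) 𝒢.tgt γ v⟩ := by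
  have h1 : 𝒢.src (𝒢.inv γ) = 𝒢.tgt γ' := by rw [𝒢.src_inv, h]
  have h2 : 𝒢.src γ = 𝒢.tgt (𝒢.mul (𝒢.inv γ) γ') := by rw [𝒢.tgt_mul _ _ h1, 𝒢.tgt_inv]
  have h3 : 𝒢.mul γ (𝒢.mul (𝒢.inv γ) γ') = γ' := by
    rw [← 𝒢.mul_assoc _ _ _ (𝒢.tgt_inv γ).symm h1, 𝒢.mul_inv, h, 𝒢.one_mul]
  rw [← h3]
  intro u hu
  have hu' : u ∈ (P (𝒢.mul γ (𝒢.mul (𝒢.inv γ) γ')) : Set _) := hu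
  rw [← hP _ _ h2] at hu'
  obtain ⟨v, hv, w, hw, hvw, rfl⟩ := hu'
  obtain ⟨-, hr, hi⟩ := sigma_cTangent_iff.1 hvw
  rw [modelRe_cMap, modelRe_cMap] at hr
  rw [modelIm_cMap, modelIm_cMap] at hi
  refine ⟨v, hv, sigma_cTangent_iff.2 ⟨𝒢.tgt_mul _ _ h2, ?_, ?_⟩⟩
  · rw [modelRe_cMap, modelRe_cMap, modelRe_cMul, 𝒢.tgt_modelMul h2 hr]
  · rw [modelIm_cMap, modelIm_cMap, modelIm_cMul, 𝒢.tgt_modelMul h2 hi]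

/-- The mirror image of the argument for targets, with `γ' = (γ' γ⁻¹) γ`. -/
lemma IsMultiplicative.src_image (hP : 𝒢.IsMultiplicative P) (γ γ' : G)
    (h : 𝒢.src γ = 𝒢.src γ') : ∀ u ∈ P γ', ∃ v ∈ P γ,
      (⟨𝒢.src γ', cMap (F := F) 𝒢.src γ' u⟩ : Σ x : M, CTangent F x) =
        ⟨𝒢.src γ, cMap (F := F) 𝒢.src γ v⟩ := by
  have h1 : 𝒢.src γ' = 𝒢.tgt (𝒢.inv γ) := by rw [𝒢.tgt_inv, h]
  have h2 : 𝒢.src (𝒢.mul γ' (𝒢.inv γ)) = 𝒢.tgt γ := by rw [𝒢.src_mul _ _ h1, 𝒢.src_inv]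
  have h3 : 𝒢.mul (𝒢.mul γ' (𝒢.inv γ)) γ = γ' := by
    rw [𝒢.mul_assoc _ _ _ h1 (𝒢.src_inv γ), 𝒢.inv_mul, h, 𝒢.mul_one]
  rw [← h3]
  intro u hu
  have hu' : u ∈ (P (𝒢.mul (𝒢.mul γ' (𝒢.inv γ)) γ) : Set _) := hu
  rw [← hP _ _ h2] at hu'
  obtain ⟨v, hv, w, hw, hvw, rfl⟩ := hu'
  obtain ⟨-, hr, hi⟩ := sigma_cTangent_iff.1 hvw
  rw [modelRe_cMap, modelRe_cMap] at hr
  rw [modelIm_cMap, modelIm_cMap] at hi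
  refine ⟨w, hw, sigma_cTangent_iff.2 ⟨𝒢.src_mul _ _ h2, ?_, ?_⟩⟩
  · rw [modelRe_cMap, modelRe_cMap, modelRe_cMul, 𝒢.src_modelMul h2 hr]
  · rw [modelIm_cMap, modelIm_cMap, modelIm_cMul, 𝒢.src_modelMul h2 hi]

variable (𝒢)

lemma inv_inv (γ : G) : 𝒢.inv (𝒢.inv γ) = γ := by
  have h := 𝒢.mul_one (𝒢.inv (𝒢.inv γ))
  rw [𝒢.src_inv, 𝒢.tgt_inv, ← 𝒢.inv_mul, ← 𝒢.mul_assoc _ _ _ (𝒢.src_inv _) (𝒢.src_inv γ),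
    𝒢.inv_mul, 𝒢.src_inv, 𝒢.one_mul] at h
  exact h.symm

lemma mdifferentiableAt_inv (γ : G) : MDifferentiableAt 𝓘(ℝ, E) 𝓘(ℝ, E) 𝒢.inv γ :=
  (𝒢.smooth_inv γ).mdifferentiableAt (by simp)

/-- Inversion is an involution, so applying it twice to a curve recovers the velocity from its
image. -/
lemma cMap_inv_injective (γ : G) :
    Function.Injective (cMap (E := E) (F := E) 𝒢.inv γ) := by
  have hreal : ∀ v w : E, modelDeriv (E := E) (F := E) 𝒢.inv γ v =
      modelDeriv (E := E) (F := E) 𝒢.inv γ w → v = w := by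
    intro v w h
    obtain ⟨c, hc⟩ := exists_curve γ v
    obtain ⟨c', hc'⟩ := exists_curve γ w
    have h1 := (hc.comp (𝒢.mdifferentiableAt_inv γ)).comp (𝒢.mdifferentiableAt_inv _)
    have h2 := (hc'.comp (𝒢.mdifferentiableAt_inv γ)).comp (𝒢.mdifferentiableAt_inv _)
    simp only [inv_inv] at h1 h2
    rw [h1.unique hc (Filter.Eventually.of_forall fun _ => rfl) |>.symm,
      h2.unique hc' (Filter.Eventually.of_forall fun _ => rfl) |>.symm, h]
  intro u u' h
  have hr := congrArg modelRe h
  have hi := congrArg modelIm h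
  rw [modelRe_cMap, modelRe_cMap] at hr
  rw [modelIm_cMap, modelIm_cMap] at hi
  exact complexified_ext (hreal _ _ hr) (hreal _ _ hi)

lemma cMap_tgt_inv (γ : G) (u : CTangent E γ) (hu : cMap (F := F) 𝒢.src γ u = 0) :
    cMap (F := F) 𝒢.tgt (𝒢.inv γ) (cMap (F := E) 𝒢.inv γ u) = 0 := by
  have hreal : ∀ v : E, modelDeriv (E := E) (F := F) 𝒢.tgt (𝒢.inv γ)
      (modelDeriv (E := E) (F := E) 𝒢.inv γ v) = modelDeriv (E := E) (F := F) 𝒢.src γ v := by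
    intro v
    obtain ⟨c, hc⟩ := exists_curve γ v
    exact ((hc.comp (𝒢.mdifferentiableAt_inv γ)).comp
      (submersion_mdifferentiableAt 𝒢.submersion_tgt _)).unique
      (hc.comp (submersion_mdifferentiableAt 𝒢.submersion_src γ))
      (Filter.Eventually.of_forall fun τ => 𝒢.tgt_inv _)
  rw [cTangent_eq_zero_iff, modelRe_cMap, modelIm_cMap] at hu ⊢
  rwa [modelRe_cMap, modelIm_cMap, hreal, hreal]

lemma cMap_src_inv (γ : G) (u : CTangent E γ) (hu : cMap (F := F) 𝒢.tgt γ u = 0) :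
    cMap (F := F) 𝒢.src (𝒢.inv γ) (cMap (F := E) 𝒢.inv γ u) = 0 := by
  have hreal : ∀ v : E, modelDeriv (E := E) (F := F) 𝒢.src (𝒢.inv γ)
      (modelDeriv (E := E) (F := E) 𝒢.inv γ v) = modelDeriv (E := E) (F := F) 𝒢.tgt γ v := by
    intro v
    obtain ⟨c, hc⟩ := exists_curve γ v
    exact ((hc.comp (𝒢.mdifferentiableAt_inv γ)).comp
      (submersion_mdifferentiableAt 𝒢.submersion_src _)).unique
      (hc.comp (submersion_mdifferentiableAt 𝒢.submersion_tgt γ))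
      (Filter.Eventually.of_forall fun τ => 𝒢.src_inv _)
  rw [cTangent_eq_zero_iff, modelRe_cMap, modelIm_cMap] at hu ⊢
  rwa [modelRe_cMap, modelIm_cMap, hreal, hreal]

variable {𝒢}

/-- The map `u ↦ conj(T inv u)` is injective and sends `P` to `P` by the Hermitian condition. It is
only semilinear over complex conjugation, but that is enough to compare ranks. -/
lemma IsHermitian.finrank_le [FiniteDimensional ℝ E] (hP : 𝒢.IsHermitian P) {γ : G}
    {A : Submodule ℂ (CTangent E γ)} {B : Submodule ℂ (CTangent E (𝒢.inv γ))}
    (hAB : ∀ u ∈ A, conjC (cMap (F := E) 𝒢.inv γ u) ∈ B) :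
    Module.finrank ℂ ↥(A ⊓ P γ) ≤ Module.finrank ℂ ↥(B ⊓ P (𝒢.inv γ)) := by
  have hmem : ∀ u ∈ A ⊓ P γ, conjC (cMap (F := E) 𝒢.inv γ u) ∈ B ⊓ P (𝒢.inv γ) := by
    intro u hu
    refine ⟨hAB u hu.1, ?_⟩
    have : cMap (F := E) 𝒢.inv γ u ∈ {w : CTangent E (𝒢.inv γ) | conjC w ∈ P (𝒢.inv γ)} := by
      rw [← hP γ]
      exact ⟨u, hu.2, rfl⟩
    exact this
  let j : ↥(A ⊓ P γ) →+ ↥(B ⊓ P (𝒢.inv γ)) :=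
    { toFun := fun u => ⟨conjC (cMap (F := E) 𝒢.inv γ (u : CTangent E γ)), hmem u u.2⟩
      map_zero' := by ext; simp
      map_add' := fun u u' => by ext; simp }
  refine Module.finrank_le_finrank_of_rank_le_rank ?_ (Module.rank_lt_aleph0 ℂ _)
  refine lift_rank_le_of_injective_injective (starRingEnd ℂ) j (by simp) ?_ ?_
  · intro u u' h
    have h1 := congrArg
      (fun w : ↥(B ⊓ P (𝒢.inv γ)) => conjC (w : CTangent E (𝒢.inv γ))) h
    simp only [j, AddMonoidHom.coe_mk, ZeroHom.coe_mk, conjC_conjC] at h1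
    exact Subtype.ext (𝒢.cMap_inv_injective γ h1)
  · intro z u
    ext
    simp [j, conjC_smul]

/-- Inversion exchanges source and target fibres; the rank inequality at `γ` and the one at `γ⁻¹`
give the two bounds. -/
lemma IsHermitian.finrank_srcTangent [FiniteDimensional ℝ E] (hP : 𝒢.IsHermitian P) {k : ℕ}
    (hk : ∀ γ : G, Module.finrank ℂ ↥(𝒢.tgtTangent γ ⊓ P γ) = k) (γ : G) :
    Module.finrank ℂ ↥(𝒢.srcTangent γ ⊓ P γ) = k := by
  apply le_antisymm
  · rw [← hk (𝒢.inv γ)]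
    refine hP.finrank_le fun u hu => ?_
    rw [tgtTangent, LinearMap.mem_ker, cMap_conjC, 𝒢.cMap_tgt_inv γ u (LinearMap.mem_ker.1 hu),
      map_zero]
  · have h : Module.finrank ℂ ↥(𝒢.tgtTangent (𝒢.inv γ) ⊓ P (𝒢.inv γ)) ≤
        Module.finrank ℂ ↥(𝒢.srcTangent (𝒢.inv (𝒢.inv γ)) ⊓ P (𝒢.inv (𝒢.inv γ))) := by
      refine hP.finrank_le fun u hu => ?_
      rw [srcTangent, LinearMap.mem_ker, cMap_conjC, 𝒢.cMap_src_inv _ u (LinearMap.mem_ker.1 hu),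
        map_zero]
    rwa [hk, 𝒢.inv_inv] at h

end LieGroupoid

end Groupoids

/-! ### Rank of the relative quotient. -/

section Ranks

variable {E : Type*} [NormedAddCommGroup E] [NormedSpace ℝ E] [FiniteDimensional ℝ E]
  {G : Type*} [TopologicalSpace G] [ChartedSpace E G] [IsManifold 𝓘(ℝ, E) ∞ G]

lemma finrank_relQuot (T P : ∀ γ : G, Submodule ℂ (CTangent E γ)) (γ : G) :
    Module.finrank ℂ (RelQuot T P γ) =
      Module.finrank ℂ (T γ) - Module.finrank ℂ ↥(T γ ⊓ P γ) := by
  rw [Submodule.finrank_quotient]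
  congr 1
  rw [← Submodule.map_comap_subtype, Submodule.finrank_map_subtype_eq]
  rfl

end Ranks

/-! ### Sheaf properties of smooth sections. -/

section Sheaves

variable {E : Type*} [NormedAddCommGroup E] [NormedSpace ℝ E]
  {G : Type*} [TopologicalSpace G] [ChartedSpace E G]

/-- The formal properties of the predicate "`s` is a smooth section over `U`". -/
structure IsSectionSheaf (E : Type*) [NormedAddCommGroup E] [NormedSpace ℝ E]
    {G : Type*} [TopologicalSpace G] [ChartedSpace E G]
    {V : G → Type*} [∀ γ, AddCommGroup (V γ)] [∀ γ, Module ℂ (V γ)]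
    (Sm : (∀ γ, V γ) → Set G → Prop) : Prop where
  mono : ∀ {s U W}, Sm s U → W ⊆ U → Sm s W
  congr : ∀ {s s' U}, Sm s U → (∀ γ ∈ U, s' γ = s γ) → Sm s' U
  of_local : ∀ {s U}, IsOpen U →
    (∀ γ ∈ U, ∃ W, IsOpen W ∧ γ ∈ W ∧ Sm s (U ∩ W)) → Sm s U
  add : ∀ {s s' U}, Sm s U → Sm s' U → Sm (fun γ => s γ + s' γ) U
  smul : ∀ {f : G → ℂ} {s U}, SmoothFun E f U → Sm s U → Sm (fun γ => f γ • s γ) U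
  zero : ∀ U, Sm (fun _ => 0) U

lemma IsSectionSheaf.sum {V : G → Type*} [∀ γ, AddCommGroup (V γ)] [∀ γ, Module ℂ (V γ)]
    {Sm : (∀ γ, V γ) → Set G → Prop} (h : IsSectionSheaf E Sm) {ι : Type*} {t : Finset ι}
    {s : ι → ∀ γ, V γ} {U : Set G} (hs : ∀ i ∈ t, Sm (s i) U) :
    Sm (fun γ => ∑ i ∈ t, s i γ) U := by
  classical
  induction t using Finset.induction_on with
  | empty => simpa using h.zero U
  | insert a t ha ih =>
    simp only [Finset.sum_insert ha]
    exact h.add (hs a (Finset.mem_insert_self a t))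
      (ih fun i hi => hs i (Finset.mem_insert_of_mem hi))

/-- Sections whose smoothness is tested by evaluation on a class of local objects. -/
lemma isSectionSheaf_of_eval {V : G → Type*} [∀ γ, AddCommGroup (V γ)] [∀ γ, Module ℂ (V γ)]
    {A : Type*} (SmA : A → Set G → Prop) (hA : ∀ a U W, SmA a U → W ⊆ U → SmA a W)
    (ev : A → ∀ γ, V γ →ₗ[ℂ] ℂ) :
    IsSectionSheaf E (fun (s : ∀ γ, V γ) U => ∀ W ⊆ U, IsOpen W → ∀ a, SmA a W →
      SmoothFun E (fun γ => ev a γ (s γ)) W) where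
  mono h hWU W' hW' hWo a ha := h W' (hW'.trans hWU) hWo a ha
  congr h hs W hW hWo a ha := (h W hW hWo a ha).congr fun γ hγ => by rw [hs γ (hW hγ)]
  of_local hU h W hW hWo a ha := SmoothFun.of_local fun γ hγ => by
    obtain ⟨W', hW'o, hγW', hs⟩ := h γ (hW hγ)
    exact ⟨W', hW'o, hγW', hs _ (Set.inter_subset_inter_left W' hW) (hWo.inter hW'o) a
      (hA _ _ _ ha Set.inter_subset_left)⟩
  add h h' W hW hWo a ha := by
    simpa only [map_add] using (h W hW hWo a ha).add (h' W hW hWo a ha)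
  smul hf h W hW hWo a ha := by
    simpa only [map_smul, smul_eq_mul] using (hf.mono hW).mul (h W hW hWo a ha)
  zero U W hW hWo a ha := by simpa only [map_zero] using smoothFun_const 0 W

variable [IsManifold 𝓘(ℝ, E) ∞ G] (T S P : ∀ γ : G, Submodule ℂ (CTangent E γ))

lemma isSectionSheaf_conormal : IsSectionSheaf E (SmoothConormal P) :=
  isSectionSheaf_of_eval (V := fun γ => Conormal P γ) (A := ∀ γ : G, CTangent E γ)
    (fun Y W => SmoothField Y W) (fun _ _ _ h hW => h.mono hW)
    (fun Y γ => (LinearMap.applyₗ (Y γ)).comp (Conormal P γ).subtype)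

lemma isSectionSheaf_relDual : IsSectionSheaf E (SmoothRelDual T P) :=
  isSectionSheaf_of_eval (V := fun γ => Module.Dual ℂ (RelQuot T P γ)) (A := ∀ γ : G, T γ)
    (fun Y W => SmoothIn T Y W) (fun _ _ _ h hW => SmoothField.mono h hW)
    (fun Y γ => LinearMap.applyₗ (relMk T P γ (Y γ)))

/-- Evaluation of alternating forms. -/
def altEval {W : Type*} [AddCommGroup W] [Module ℂ W] {n : ℕ} (w : Fin n → W) :
    (W [⋀^Fin n]→ₗ[ℂ] ℂ) →ₗ[ℂ] ℂ where
  toFun σ := σ w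
  map_add' _ _ := rfl
  map_smul' _ _ := rfl

lemma isSectionSheaf_form (n : ℕ) : IsSectionSheaf E (SmoothForm n T S P) := by
  have h := isSectionSheaf_of_eval (E := E) (V := fun γ => FormBundle n T S P γ)
    (A := (Fin n → ∀ γ : G, T γ) × (Fin n → ∀ γ : G, S γ))
    (fun Y W => (∀ i, SmoothIn T (Y.1 i) W) ∧ ∀ i, SmoothIn S (Y.2 i) W)
    (fun Y U W h hW => ⟨fun i => (h.1 i).mono hW, fun i => (h.2 i).mono hW⟩)
    (fun Y γ => altEval (fun i => (relMk T P γ (Y.1 i γ), relMk S P γ (Y.2 i γ))))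
  have he : SmoothForm n T S P = _ := funext fun σ => funext fun U => propext
    ⟨fun h W hW hWo (Y : (Fin n → ∀ γ : G, T γ) × (Fin n → ∀ γ : G, S γ))
      (hY : (∀ i, SmoothIn T (Y.1 i) W) ∧ ∀ i, SmoothIn S (Y.2 i) W) =>
      h W hW hWo Y.1 Y.2 hY.1 hY.2, fun h W hW hWo A B hA hB => h W hW hWo (A, B) ⟨hA, hB⟩⟩
  rw [he]
  exact h

lemma isSectionSheaf_sumDual : IsSectionSheaf E (SmoothSumDual T S P) where
  mono h hW := ⟨(isSectionSheaf_relDual T P).mono h.1 hW, (isSectionSheaf_relDual S P).mono h.2 hW⟩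
  congr h hs := ⟨(isSectionSheaf_relDual T P).congr h.1 fun γ hγ => by rw [hs γ hγ],
    (isSectionSheaf_relDual S P).congr h.2 fun γ hγ => by rw [hs γ hγ]⟩
  of_local hU h := ⟨(isSectionSheaf_relDual T P).of_local hU fun γ hγ =>
      let ⟨W, hW, hγW, hs⟩ := h γ hγ; ⟨W, hW, hγW, hs.1⟩,
    (isSectionSheaf_relDual S P).of_local hU fun γ hγ =>
      let ⟨W, hW, hγW, hs⟩ := h γ hγ; ⟨W, hW, hγW, hs.2⟩⟩
  add h h' := ⟨(isSectionSheaf_relDual T P).add h.1 h'.1, (isSectionSheaf_relDual S P).add h.2 h'.2⟩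
  smul hf h := ⟨(isSectionSheaf_relDual T P).smul hf h.1, (isSectionSheaf_relDual S P).smul hf h.2⟩
  zero U := ⟨(isSectionSheaf_relDual T P).congr ((isSectionSheaf_relDual T P).zero U)
      fun γ hγ => LinearMap.zero_comp _,
    (isSectionSheaf_relDual S P).congr ((isSectionSheaf_relDual S P).zero U)
      fun γ hγ => LinearMap.zero_comp _⟩

end Sheaves

/-! ### Locality of partial connections. -/

section Locality

variable {E : Type*} [NormedAddCommGroup E] [NormedSpace ℝ E]
  {G : Type*} [TopologicalSpace G] [ChartedSpace E G] [IsManifold 𝓘(ℝ, E) ∞ G]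
  {P : ∀ γ : G, Submodule ℂ (CTangent E γ)}
  {V : G → Type*} [∀ γ, AddCommGroup (V γ)] [∀ γ, Module ℂ (V γ)]
  {Sm : (∀ γ, V γ) → Set G → Prop} {D : (∀ γ, V γ) → ∀ γ, P γ →ₗ[ℂ] V γ}

/-- Partial connections are local operators. -/
lemma IsPConnection.congr (h : IsPConnection P Sm D) {U : Set G} (hU : IsOpen U) {s s' : ∀ γ, V γ}
    (hs : Sm s U) (hs' : Sm s' U) (he : ∀ γ ∈ U, s γ = s' γ) {γ : G} (hγ : γ ∈ U) :
    D s γ = D s' γ := by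
  classical
  -- The indicator of `U` is smooth on `U`, with zero derivative there, and multiplying by it makes
  -- the two sections equal everywhere. The Leibniz rule on `U` then gives locality without bump
  -- functions.
  let f : G → ℂ := fun x => if x ∈ U then 1 else 0
  have hf1 : ∀ x ∈ U, f x = 1 := fun x hx => if_pos hx
  have hf : SmoothFun E f U := (smoothFun_const 1 U).congr hf1
  have hfd : cDeriv (E := E) f γ = 0 := by
    rw [cDeriv_congr_on hU hf1 hγ, cDeriv_const]
  have hfs : (fun x => f x • s x) = fun x => f x • s' x := by
    funext x
    by_cases hx : x ∈ U
    · rw [he x hx]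
    · simp [f, hx]
  ext v
  have h1 := h.leibniz U hU f s hf hs γ hγ v
  have h2 := h.leibniz U hU f s' hf hs' γ hγ v
  rw [hf1 γ hγ, hfd, one_smul, LinearMap.zero_apply, zero_smul, add_zero] at h1 h2
  rw [← h1, ← h2, hfs]

lemma IsPConnection.map_sum (h : IsPConnection P Sm D) (hSm : IsSectionSheaf E Sm) {U : Set G}
    (hU : IsOpen U) {ι : Type*} {t : Finset ι} {s : ι → ∀ γ, V γ} (hs : ∀ i ∈ t, Sm (s i) U)
    {γ : G} (hγ : γ ∈ U) : D (fun x => ∑ i ∈ t, s i x) γ = ∑ i ∈ t, D (s i) γ := by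
  classical
  induction t using Finset.induction_on with
  | empty =>
    ext v
    have h1 := h.leibniz U hU (fun _ => 0) (fun _ => 0) (smoothFun_const 0 U) (hSm.zero U) γ hγ v
    simpa using h1
  | insert a t ha ih =>
    simp only [Finset.sum_insert ha]
    rw [h.add U hU _ _ (hs a (Finset.mem_insert_self a t))
      (hSm.sum fun i hi => hs i (Finset.mem_insert_of_mem hi)) γ hγ,
      ih fun i hi => hs i (Finset.mem_insert_of_mem hi)]

end Locality

/-! ### Jacobi identity and exterior derivative of complex one-forms. -/

section Cartan

variable {E : Type*} [NormedAddCommGroup E] [NormedSpace ℝ E] [FiniteDimensional ℝ E]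
  {G : Type*} [TopologicalSpace G] [ChartedSpace E G] [IsManifold 𝓘(ℝ, E) ∞ G]

lemma cTangent_ext {γ : G} {u u' : CTangent E γ}
    (h : ∀ (U : Set G) (f : G → ℂ), IsOpen U → γ ∈ U → SmoothFun E f U →
      cDeriv f γ u = cDeriv f γ u') : u = u' := by
  obtain ⟨U, hγ, x, d, hx, hd⟩ := exists_coordinates (E := E) (ι := Fin (Module.finrank ℝ E)) γ
    (by simp)
  rw [hd.expand γ hγ u, hd.expand γ hγ u']
  exact Finset.sum_congr rfl fun i _ => by rw [h U (x i) hd.isOpen hγ (hx i)]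

/-- Tangent vectors are separated by functions, and on functions every bracket is a commutator of
derivations, for which the identity is formal. -/
lemma cBracket_jacobi {X Y Z : ∀ γ : G, CTangent E γ} {U : Set G} (hU : IsOpen U)
    (hX : SmoothField X U) (hY : SmoothField Y U) (hZ : SmoothField Z U) {γ : G} (hγ : γ ∈ U) :
    cBracket (cBracket X Y) Z γ = cBracket X (cBracket Y Z) γ - cBracket Y (cBracket X Z) γ := by
  have : CompleteSpace E := FiniteDimensional.complete ℝ E
  refine cTangent_ext fun W f hW hγW hf => ?_
  have hV : IsOpen (U ∩ W) := hU.inter hW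
  have hγV : γ ∈ U ∩ W := ⟨hγ, hγW⟩
  replace hX := hX.mono (Set.inter_subset_left (t := W))
  replace hY := hY.mono (Set.inter_subset_left (t := W))
  replace hZ := hZ.mono (Set.inter_subset_left (t := W))
  replace hf := hf.mono (Set.inter_subset_right (s := U))
  have br : ∀ {A B C : ∀ γ : G, CTangent E γ}, SmoothField A (U ∩ W) → SmoothField B (U ∩ W) →
      SmoothField C (U ∩ W) → cDeriv f γ (cBracket A (cBracket B C) γ) =
        cDeriv (fun x => cDeriv (fun x => cDeriv f x (C x)) x (B x)) γ (A γ)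
        - cDeriv (fun x => cDeriv (fun x => cDeriv f x (B x)) x (C x)) γ (A γ)
        - (cDeriv (fun x => cDeriv (fun x => cDeriv f x (A x)) x (C x)) γ (B γ)
        - cDeriv (fun x => cDeriv (fun x => cDeriv f x (A x)) x (B x)) γ (C γ)) := by
    intro A B C hA hB hC
    rw [cDeriv_cBracket hV hA (hB.cBracket hV hC) hf hγV,
      cDeriv_cBracket hV hB hC (hf.cDeriv hV hA) hγV,
      cDeriv_congr_on hV (fun x hx => cDeriv_cBracket hV hB hC hf hx) hγV,
      cDeriv_sub (((hf.cDeriv hV hC).cDeriv hV hB).mdifferentiableAt hV hγV)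
        (((hf.cDeriv hV hB).cDeriv hV hC).mdifferentiableAt hV hγV)]
  rw [map_sub, br hX hY hZ, br hY hX hZ, cDeriv_cBracket hV (hX.cBracket hV hY) hZ hf hγV,
    cDeriv_cBracket hV hX hY (hf.cDeriv hV hZ) hγV,
    cDeriv_congr_on hV (fun x hx => cDeriv_cBracket hV hX hY hf hx) hγV,
    cDeriv_sub (((hf.cDeriv hV hY).cDeriv hV hX).mdifferentiableAt hV hγV)
      (((hf.cDeriv hV hX).cDeriv hV hY).mdifferentiableAt hV hγV)]
  ring

/-- In coordinates `dξ = ∑ d(ξ(∂ⱼ)) ∧ dxⱼ`, an expression that makes sense for any family `ξ`. On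
smooth forms the invariant formula follows from the product rule and from `cDeriv_cBracket` for the
coordinates. Since `δ` is chosen before `ξ` and before the domain, it gives a single operator at
`γ`. -/
lemma exists_extDeriv (γ : G) :
    ∃ δ : (∀ γ : G, Module.Dual ℂ (CTangent E γ)) → CTangent E γ →ₗ[ℂ] Module.Dual ℂ (CTangent E γ),
      ∀ (ξ : ∀ γ : G, Module.Dual ℂ (CTangent E γ)) (U : Set G), IsOpen U → SmoothOneForm ξ U →
      ∀ X Y : ∀ γ : G, CTangent E γ, SmoothField X U → SmoothField Y U → γ ∈ U →
        δ ξ (X γ) (Y γ) = cDeriv (fun x => ξ x (Y x)) γ (X γ)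
          - cDeriv (fun x => ξ x (X x)) γ (Y γ) - ξ γ (cBracket X Y γ) := by
  have : CompleteSpace E := FiniteDimensional.complete ℝ E
  obtain ⟨N, hγN, x, d, hx, hd⟩ :=
    exists_coordinates (E := E) (ι := Fin (Module.finrank ℝ E)) γ (by simp)
  refine ⟨fun ξ => ∑ j, ((cDeriv (fun x => ξ x (d j x)) γ).smulRight (cDeriv (x j) γ)
    - (cDeriv (x j) γ).smulRight (cDeriv (fun x => ξ x (d j x)) γ)), ?_⟩
  intro ξ U hU hξ X Y hX hY hγ
  have hV : IsOpen (U ∩ N) := hU.inter hd.isOpen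
  have hγV : γ ∈ U ∩ N := ⟨hγ, hγN⟩
  replace hX := hX.mono (Set.inter_subset_left (t := N))
  replace hY := hY.mono (Set.inter_subset_left (t := N))
  replace hx := fun i => (hx i).mono (Set.inter_subset_right (s := U))
  have hξd : ∀ j, SmoothFun E (fun x => ξ x (d j x)) (U ∩ N) := fun j =>
    hξ _ Set.inter_subset_left hV _ ((hd.smooth j).mono Set.inter_subset_right)
  have hexp : ∀ y ∈ U ∩ N, ∀ u, ξ y u = ∑ j, ξ y (d j y) * cDeriv (x j) y u := by
    intro y hy u
    conv_lhs => rw [hd.expand y hy.2 u, map_sum]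
    exact Finset.sum_congr rfl fun j _ => by rw [map_smul, smul_eq_mul, mul_comm]
  have hder : ∀ {A : ∀ γ : G, CTangent E γ}, SmoothField A (U ∩ N) → ∀ u : CTangent E γ,
      cDeriv (fun y => ξ y (A y)) γ u =
        ∑ j, (ξ γ (d j γ) * cDeriv (fun y => cDeriv (x j) y (A y)) γ u
          + cDeriv (x j) γ (A γ) * cDeriv (fun y => ξ y (d j y)) γ u) := by
    intro A hA u
    rw [cDeriv_congr_on hV (fun y hy => hexp y hy (A y)) hγV,
      cDeriv_sum hV (fun j _ => (hξd j).mul ((hx j).cDeriv hV hA)) hγV]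
    refine Finset.sum_congr rfl fun j _ => ?_
    rw [cDeriv_mul ((hξd j).mdifferentiableAt hV hγV)
      (((hx j).cDeriv hV hA).mdifferentiableAt hV hγV)]
  rw [hder hY, hder hX, hexp γ hγV, ← Finset.sum_sub_distrib, ← Finset.sum_sub_distrib,
    LinearMap.sum_apply, LinearMap.sum_apply]
  refine Finset.sum_congr rfl fun j _ => ?_
  rw [cDeriv_cBracket hV hX hY (hx j) hγV]
  simp only [LinearMap.sub_apply, LinearMap.smulRight_apply, LinearMap.smul_apply, smul_eq_mul]
  ring

/-- The exterior derivative of a complex `1`-form. -/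
def extDeriv (ξ : ∀ γ : G, Module.Dual ℂ (CTangent E γ)) (γ : G) :
    CTangent E γ →ₗ[ℂ] Module.Dual ℂ (CTangent E γ) :=
  (exists_extDeriv (E := E) γ).choose ξ

lemma extDeriv_apply {ξ : ∀ γ : G, Module.Dual ℂ (CTangent E γ)} {U : Set G} (hU : IsOpen U)
    (hξ : SmoothOneForm ξ U) {X Y : ∀ γ : G, CTangent E γ} (hX : SmoothField X U)
    (hY : SmoothField Y U) {γ : G} (hγ : γ ∈ U) :
    extDeriv ξ γ (X γ) (Y γ) = cDeriv (fun x => ξ x (Y x)) γ (X γ)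
      - cDeriv (fun x => ξ x (X x)) γ (Y γ) - ξ γ (cBracket X Y γ) :=
  (exists_extDeriv (E := E) γ).choose_spec ξ U hU hξ X Y hX hY hγ

end Cartan

/-! ### The Bott connection. -/

section BottConnection

variable {E : Type*} [NormedAddCommGroup E] [NormedSpace ℝ E] [FiniteDimensional ℝ E]
  {G : Type*} [TopologicalSpace G] [ChartedSpace E G] [IsManifold 𝓘(ℝ, E) ∞ G]
  {P Q : ∀ γ : G, Submodule ℂ (CTangent E γ)}

lemma exists_field (γ : G) (y : CTangent E γ) :
    ∃ U : Set G, IsOpen U ∧ γ ∈ U ∧ ∃ Y : ∀ γ : G, CTangent E γ, SmoothField Y U ∧ Y γ = y := by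
  obtain ⟨U, hU, hγ, Y, hY, hYy⟩ := isDistribution_top.exists_section (v := y) Submodule.mem_top
  exact ⟨U, hU, hγ, _, hY, hYy⟩

variable {D D' : (∀ γ : G, Conormal P γ) → ∀ γ : G, P γ →ₗ[ℂ] Conormal P γ}

/-- To compute a covariant derivative of Bott type, extend the vectors to local fields. -/
lemma exists_fields (hP : IsDistribution P) (hQ : IsDistribution Q) {U : Set G} (hU : IsOpen U)
    {γ : G} (hγ : γ ∈ U) (v : P γ) {y : CTangent E γ} (hy : y ∈ Q γ) :
    ∃ W ⊆ U, IsOpen W ∧ γ ∈ W ∧ ∃ (X : ∀ γ, P γ) (Y : ∀ γ, Q γ), SmoothIn P X W ∧ X γ = v ∧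
      SmoothIn Q Y W ∧ (Y γ : CTangent E γ) = y := by
  obtain ⟨W₁, hW₁, h₁, X, hX, hXv⟩ := hP.exists_section v.2
  obtain ⟨W₂, hW₂, h₂, Y, hY, hYy⟩ := hQ.exists_section hy
  exact ⟨U ∩ (W₁ ∩ W₂), Set.inter_subset_left, hU.inter (hW₁.inter hW₂), ⟨hγ, h₁, h₂⟩, X, Y,
    hX.mono fun _ h => h.2.1, Subtype.ext hXv, hY.mono fun _ h => h.2.2, hYy⟩

/-- Two operations on `1`-forms agree at a point if they agree on local fields. -/
lemma conormal_map_ext (hP : IsDistribution P) {U : Set G} (hU : IsOpen U) {γ : G} (hγ : γ ∈ U)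
    {A B : P γ →ₗ[ℂ] Conormal P γ}
    (h : ∀ W ⊆ U, IsOpen W → γ ∈ W → ∀ (X : ∀ γ, P γ) (Y : ∀ γ : G, CTangent E γ),
      SmoothIn P X W → SmoothField Y W →
      (A (X γ) : Module.Dual ℂ (CTangent E γ)) (Y γ) =
        (B (X γ) : Module.Dual ℂ (CTangent E γ)) (Y γ)) : A = B := by
  refine LinearMap.ext fun v => Subtype.ext (LinearMap.ext fun y => ?_)
  obtain ⟨W, hWU, hW, hγW, X, Y, hX, rfl, hY, rfl⟩ :=
    exists_fields hP isDistribution_top hU hγ v (y := y) Submodule.mem_top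
  exact h W hWU hW hγW X _ hX hY

lemma IsBott.unique (hP : IsDistribution P) (h : IsBott P D) (h' : IsBott P D') {U : Set G}
    (hU : IsOpen U) {ξ : ∀ γ : G, Conormal P γ} (hξ : SmoothConormal P ξ U) {γ : G} (hγ : γ ∈ U) :
    D' ξ γ = D ξ γ :=
  conormal_map_ext hP hU hγ fun W hWU hW hγW X Y hX hY => by
    have hξW := (isSectionSheaf_conormal P).mono hξ hWU
    rw [h W hW X ξ Y hX hξW hY γ hγW, h' W hW X ξ Y hX hξW hY γ hγW]

lemma IsBott.isPConnection (hP : IsDistribution P) (h : IsBott P D) :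
    IsPConnection P (SmoothConormal P) D := by
  have : CompleteSpace E := FiniteDimensional.complete ℝ E
  have sh := isSectionSheaf_conormal P
  refine ⟨?_, ?_, ?_⟩
  · intro U hU ξ ξ' hξ hξ' γ hγ
    refine conormal_map_ext hP hU hγ fun W hWU hW hγW X Y hX hY => ?_
    replace hξ := sh.mono hξ hWU
    replace hξ' := sh.mono hξ' hWU
    rw [h W hW X _ Y hX (sh.add hξ hξ') hY γ hγW]
    simp only [Submodule.coe_add, LinearMap.add_apply]
    rw [h W hW X _ Y hX hξ hY γ hγW, h W hW X _ Y hX hξ' hY γ hγW, cDeriv_add ((hξ W subset_rfl hW Y hY).mdifferentiableAt hW hγW)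
      ((hξ' W subset_rfl hW Y hY).mdifferentiableAt hW hγW)]
    ring
  · intro U hU f ξ hf hξ γ hγ v
    refine DFunLike.congr_fun (f := D (fun x => f x • ξ x) γ)
      (g := f γ • D ξ γ + ((cDeriv f γ).comp (P γ).subtype).smulRight (ξ γ)) ?_ v
    refine conormal_map_ext hP hU hγ fun W hWU hW hγW X Y hX hY => ?_
    replace hξ := sh.mono hξ hWU
    replace hf := hf.mono hWU
    rw [h W hW X _ Y hX (sh.smul hf hξ) hY γ hγW]
    simp only [LinearMap.add_apply, Submodule.coe_add, LinearMap.smul_apply, Submodule.coe_smul,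
      LinearMap.smulRight_apply, LinearMap.comp_apply, Submodule.subtype_apply, smul_eq_mul]
    rw [h W hW X _ Y hX hξ hY γ hγW, cDeriv_mul (hf.mdifferentiableAt hW hγW)
      ((hξ W subset_rfl hW Y hY).mdifferentiableAt hW hγW)]
    ring
  · intro U hU X ξ hX hξ W hWU hW Y hY
    replace hξ := sh.mono hξ hWU
    replace hX : SmoothIn P X W := SmoothField.mono hX hWU
    exact (((hξ W subset_rfl hW Y hY).cDeriv hW hX).sub
      (hξ W subset_rfl hW _ (SmoothField.cBracket hW hX hY))).congr
      fun γ hγ => h W hW X ξ Y hX hξ hY γ hγ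

/-- Evaluate on a field `B`. The mixed terms `X(ξ([Y,B]))` and `Y(ξ([X,B]))` occur symmetrically and
cancel. The others combine to `[X,Y](ξ(B)) - ξ([[X,Y],B])` by the commutator formula and the Jacobi
identity. -/
lemma IsBott.isFlat (hP : IsDistribution P) (h : IsBott P D) :
    IsFlat P (SmoothConormal P) D := by
  have : CompleteSpace E := FiniteDimensional.complete ℝ E
  have sh := isSectionSheaf_conormal P
  intro U hU X Y Z hX hY hZ ξ hξ γ hγ
  refine Subtype.ext (LinearMap.ext fun w => ?_)
  obtain ⟨W', hW', hγW', B, hB, rfl⟩ := exists_field γ w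
  let W := U ∩ W'
  have hW : IsOpen W := hU.inter hW'
  have hγW : γ ∈ W := ⟨hγ, hγW'⟩
  replace hB : SmoothField B W := hB.mono Set.inter_subset_right
  replace hξ : SmoothConormal P ξ W := sh.mono hξ Set.inter_subset_left
  replace hX : SmoothIn P X W := SmoothField.mono hX Set.inter_subset_left
  replace hY : SmoothIn P Y W := SmoothField.mono hY Set.inter_subset_left
  have hZ' : SmoothIn P Z W := (SmoothField.cBracket hW hX hY).congr fun x hx => hZ x hx.1
  have key : ∀ {A C : ∀ γ, P γ}, SmoothIn P A W → SmoothIn P C W →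
      (D (fun x => D ξ x (C x)) γ (A γ) : Module.Dual ℂ (CTangent E γ)) (B γ) =
        cDeriv (fun x => cDeriv (fun x => (ξ x : Module.Dual ℂ (CTangent E x)) (B x)) x
            (C x : CTangent E x)) γ (A γ : CTangent E γ)
        - cDeriv (fun x => (ξ x : Module.Dual ℂ (CTangent E x))
            (cBracket (fun x => (C x : CTangent E x)) B x)) γ (A γ : CTangent E γ)
        - (cDeriv (fun x => (ξ x : Module.Dual ℂ (CTangent E x))
            (cBracket (fun x => (A x : CTangent E x)) B x)) γ (C γ : CTangent E γ)
          - (ξ γ : Module.Dual ℂ (CTangent E γ)) (cBracket (fun x => (C x : CTangent E x))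
            (cBracket (fun x => (A x : CTangent E x)) B) γ)) := by
    intro A C hA hC
    have hDC := (h.isPConnection hP).smooth W hW C ξ hC hξ
    have hAB := SmoothField.cBracket hW hA hB
    have hCB := SmoothField.cBracket hW hC hB
    rw [h W hW A _ B hA hDC hB γ hγW, h W hW C ξ _ hC hξ hAB γ hγW,
      cDeriv_congr_on hW (fun x hx => h W hW C ξ B hC hξ hB x hx) hγW,
      cDeriv_sub (((hξ W subset_rfl hW B hB).cDeriv hW hC).mdifferentiableAt hW hγW)
        ((hξ W subset_rfl hW _ hCB).mdifferentiableAt hW hγW)]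
  rw [Submodule.coe_sub, LinearMap.sub_apply, key hX hY, key hY hX,
    h W hW Z ξ B hZ' hξ hB γ hγW, hZ γ hγ, cDeriv_cBracket hW hX hY (hξ W subset_rfl hW B hB) hγW,
    cBracket_congr hW (fun x hx => hZ x hx.1) (fun x hx => rfl) hγW,
    cBracket_jacobi hW hX hY hB hγW, map_sub]
  ring

/-- For `X` in `P ⊆ Q` and `Y` in `Q`, both `ξ(Y)` and `ξ([X,Y])` vanish, the latter because `Q` is
involutive. -/
lemma IsBott.preservesAnnihilator (hP : IsDistribution P) (hQ : IsInvolutive Q)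
    (hPQ : ∀ γ, P γ ≤ Q γ) (h : IsBott P D) : PreservesAnnihilator P Q D := by
  intro U hU ξ hξ hann γ hγ v
  rw [Submodule.mem_dualAnnihilator]
  intro y hy
  obtain ⟨W, hWU, hW, hγW, X, Y, hX, rfl, hY, rfl⟩ := exists_fields hP hQ.isDistribution hU hγ v hy
  rw [h W hW X ξ _ hX ((isSectionSheaf_conormal P).mono hξ hWU) hY γ hγW,
    cDeriv_congr_on hW (g := fun _ => 0)
      (fun x hx => (Submodule.mem_dualAnnihilator _).1 (hann x (hWU hx)) _ (Y x).2) hγW,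
    cDeriv_const, LinearMap.zero_apply, zero_sub, neg_eq_zero]
  exact (Submodule.mem_dualAnnihilator _).1 (hann γ hγ) _
    (hQ.bracket_mem W hW _ _ hX hY (fun x _ => hPQ x (X x).2) (fun x _ => (Y x).2) γ hγW)

open Classical in
/-- The Bott connection: the exterior derivative, where it takes values in the conormal bundle. -/
def bottConnection (P : ∀ γ : G, Submodule ℂ (CTangent E γ)) (ξ : ∀ γ : G, Conormal P γ) (γ : G) :
    P γ →ₗ[ℂ] Conormal P γ :=
  if h : ∀ v : P γ, extDeriv (fun x => (ξ x : Module.Dual ℂ (CTangent E x))) γ v ∈ Conormal P γ then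
    ((extDeriv (fun x => (ξ x : Module.Dual ℂ (CTangent E x))) γ).comp (P γ).subtype).codRestrict
      (Conormal P γ) h
  else 0

/-- As `ξ(X) = 0`, the formula for `dξ(X,Y)` loses its middle term and becomes `(L_X ξ)(Y)`.
Involutivity of `P` shows that `dξ(X, ·)` annihilates `P`, so the first branch of the definition
applies at every point where `ξ` is smooth. -/
lemma isBott_bottConnection (hP : IsInvolutive P) : IsBott P (bottConnection P) := by
  have hcd : ∀ (W : Set G), IsOpen W → ∀ (X : ∀ γ, P γ) (ξ : ∀ γ : G, Conormal P γ)
      (Y : ∀ γ : G, CTangent E γ), SmoothIn P X W → SmoothConormal P ξ W → SmoothField Y W →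
      ∀ γ ∈ W, extDeriv (fun x => (ξ x : Module.Dual ℂ (CTangent E x))) γ (X γ) (Y γ) =
        cDeriv (fun x => (ξ x : Module.Dual ℂ (CTangent E x)) (Y x)) γ (X γ : CTangent E γ)
        - (ξ γ : Module.Dual ℂ (CTangent E γ)) (cBracket (fun x => (X x : CTangent E x)) Y γ) := by
    intro W hW X ξ Y hX hξ hY γ hγ
    rw [extDeriv_apply hW (X := fun x => (X x : CTangent E x)) hξ hX hY hγ,
      cDeriv_congr_on hW (f := fun x => (ξ x : Module.Dual ℂ (CTangent E x)) (X x))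
        (g := fun _ => 0)
        (fun x hx => (Submodule.mem_dualAnnihilator _).1 (ξ x).2 _ (X x).2) hγ,
      cDeriv_const, LinearMap.zero_apply, sub_zero]
  intro U hU X ξ Y hX hξ hY γ hγ
  have hmem : ∀ v : P γ,
      extDeriv (fun x => (ξ x : Module.Dual ℂ (CTangent E x))) γ v ∈ Conormal P γ := by
    intro v
    rw [Submodule.mem_dualAnnihilator]
    intro y hy
    obtain ⟨W, hWU, hW, hγW, X, Y, hX, rfl, hY, rfl⟩ :=
      exists_fields hP.isDistribution hP.isDistribution hU hγ v hy
    rw [hcd W hW X ξ _ hX ((isSectionSheaf_conormal P).mono hξ hWU) hY γ hγW,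
      cDeriv_congr_on hW (g := fun _ => 0)
        (fun x hx => (Submodule.mem_dualAnnihilator _).1 (ξ x).2 _ (Y x).2) hγW,
      cDeriv_const, LinearMap.zero_apply, zero_sub, neg_eq_zero]
    exact (Submodule.mem_dualAnnihilator _).1 (ξ γ).2 _
      (hP.bracket_mem W hW _ _ hX hY (fun x _ => (X x).2) (fun x _ => (Y x).2) γ hγW)
  rw [← hcd U hU X ξ Y hX hξ hY γ hγ, bottConnection, dif_pos hmem]
  rfl

theorem isTheFlatConnection_bottConnection (hP : IsInvolutive P) :
    IsTheFlatConnection P (SmoothConormal P) (IsBott P) (bottConnection P) :=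
  have h := isBott_bottConnection hP
  ⟨h.isPConnection hP.isDistribution, h.isFlat hP.isDistribution, h,
    fun _ _ h' _ hU _ hs _ hγ => h.unique hP.isDistribution h' hU hs hγ⟩

end BottConnection

/-! ### Connections induced on quotient bundles. -/

section Pushforward

variable {E : Type*} [NormedAddCommGroup E] [NormedSpace ℝ E]
  {G : Type*} [TopologicalSpace G] [ChartedSpace E G] [IsManifold 𝓘(ℝ, E) ∞ G]
  {P : ∀ γ : G, Submodule ℂ (CTangent E γ)}
  {V : G → Type*} [∀ γ, AddCommGroup (V γ)] [∀ γ, Module ℂ (V γ)]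
  {W : G → Type*} [∀ γ, AddCommGroup (W γ)] [∀ γ, Module ℂ (W γ)]
  {SmV : (∀ γ, V γ) → Set G → Prop} {SmW : (∀ γ, W γ) → Set G → Prop}

open Classical in
/-- The image of a partial connection under a morphism of bundles. -/
def pushforward (SmV : (∀ γ, V γ) → Set G → Prop) (q : ∀ γ, V γ →ₗ[ℂ] W γ)
    (D : (∀ γ, V γ) → ∀ γ, P γ →ₗ[ℂ] V γ) (α : ∀ γ, W γ) (γ : G) : P γ →ₗ[ℂ] W γ :=
  if h : ∃ s : ∀ γ, V γ, ∃ U : Set G, IsOpen U ∧ γ ∈ U ∧ SmV s U ∧ ∀ x ∈ U, q x (s x) = α x then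
    (q γ).comp (D h.choose γ) else 0

variable {q : ∀ γ, V γ →ₗ[ℂ] W γ} {D : (∀ γ, V γ) → ∀ γ, P γ →ₗ[ℂ] V γ}

/-- Independence of the chosen lift: on the common domain two lifts differ by a section of the
kernel of `q`, and by `hker` its derivative lies in the kernel too. -/
lemma pushforward_apply (hV : IsSectionSheaf E SmV) (hD : IsPConnection P SmV D)
    (hker : ∀ U : Set G, IsOpen U → ∀ s, SmV s U → (∀ x ∈ U, q x (s x) = 0) →
      ∀ γ ∈ U, ∀ v, q γ (D s γ v) = 0)
    {U : Set G} (hU : IsOpen U) {s : ∀ γ, V γ} {α : ∀ γ, W γ} (hs : SmV s U)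
    (hα : ∀ x ∈ U, q x (s x) = α x) {γ : G} (hγ : γ ∈ U) :
    pushforward SmV q D α γ = (q γ).comp (D s γ) := by
  have h : ∃ s : ∀ γ, V γ, ∃ U : Set G, IsOpen U ∧ γ ∈ U ∧ SmV s U ∧ ∀ x ∈ U, q x (s x) = α x :=
    ⟨s, U, hU, hγ, hs, hα⟩
  rw [pushforward, dif_pos h]
  obtain ⟨U₀, hU₀, hγ₀, hs₀, hα₀⟩ := h.choose_spec
  set s₀ := h.choose
  have hI := hU.inter hU₀
  have h1 := hV.mono hs (Set.inter_subset_left (t := U₀))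
  have h2 := hV.mono hs₀ (Set.inter_subset_right (s := U))
  have h3 := hV.smul (smoothFun_const (-1) (U ∩ U₀)) h2
  ext v
  have h4 := hker _ hI _ (hV.add h1 h3) (fun x hx => by
    rw [map_add, map_smul, hα x hx.1, hα₀ x hx.2, neg_one_smul, add_neg_cancel]) γ ⟨hγ, hγ₀⟩ v
  rw [hD.add _ hI _ _ h1 h3 γ ⟨hγ, hγ₀⟩, LinearMap.add_apply,
    hD.leibniz _ hI _ _ (smoothFun_const _ _) h2 γ ⟨hγ, hγ₀⟩, cDeriv_const, LinearMap.zero_apply,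
    zero_smul, add_zero, map_add, map_smul, neg_one_smul, ← sub_eq_add_neg, sub_eq_zero] at h4
  exact h4.symm

/-- A flat partial connection that preserves the kernel of a locally split surjection induces a
unique connection on the target, and the latter is flat. -/
theorem isTheFlatConnection_pushforward (hV : IsSectionSheaf E SmV) (hW : IsSectionSheaf E SmW)
    (hD : IsPConnection P SmV D) (hflat : IsFlat P SmV D)
    (hker : ∀ U : Set G, IsOpen U → ∀ s, SmV s U → (∀ x ∈ U, q x (s x) = 0) →
      ∀ γ ∈ U, ∀ v, q γ (D s γ v) = 0)
    (hq : ∀ U s, SmV s U → SmW (fun x => q x (s x)) U)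
    (hlift : ∀ U : Set G, IsOpen U → ∀ α, SmW α U → ∀ γ ∈ U, ∃ U' ⊆ U, IsOpen U' ∧ γ ∈ U' ∧
      ∃ s, SmV s U' ∧ ∀ x ∈ U', q x (s x) = α x) :
    IsTheFlatConnection P SmW
      (fun D' => ∀ U : Set G, IsOpen U → ∀ s, SmV s U → ∀ γ ∈ U, ∀ v : P γ,
        D' (fun x => q x (s x)) γ v = q γ (D s γ v))
      (pushforward SmV q D) := by
  have spec := fun {U : Set G} (hU : IsOpen U) {s : ∀ γ, V γ} {α : ∀ γ, W γ} (hs : SmV s U)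
    (hα : ∀ x ∈ U, q x (s x) = α x) {γ : G} (hγ : γ ∈ U) =>
    pushforward_apply hV hD hker hU hs hα hγ
  refine ⟨⟨?_, ?_, ?_⟩, ?_, ?_, ?_⟩
  · intro U hU α α' hα hα' γ hγ
    obtain ⟨U₁, hU₁U, hU₁, hγ₁, s, hs, hsα⟩ := hlift U hU α hα γ hγ
    obtain ⟨U₂, hU₂U, hU₂, hγ₂, s', hs', hsα'⟩ := hlift U hU α' hα' γ hγ
    have hI := hU₁.inter hU₂
    have h1 := hV.mono hs (Set.inter_subset_left (t := U₂))
    have h2 := hV.mono hs' (Set.inter_subset_right (s := U₁))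
    rw [spec hU₁ hs hsα hγ₁, spec hU₂ hs' hsα' hγ₂,
      spec hI (hV.add h1 h2) (fun x hx => by rw [map_add, hsα x hx.1, hsα' x hx.2]) ⟨hγ₁, hγ₂⟩,
      hD.add _ hI _ _ h1 h2 γ ⟨hγ₁, hγ₂⟩, LinearMap.comp_add]
  · intro U hU f α hf hα γ hγ v
    obtain ⟨U₁, hU₁U, hU₁, hγ₁, s, hs, hsα⟩ := hlift U hU α hα γ hγ
    have hf₁ := hf.mono hU₁U
    rw [spec hU₁ hs hsα hγ₁, spec hU₁ (hV.smul hf₁ hs) (fun x hx => by rw [map_smul, hsα x hx]) hγ₁,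
      LinearMap.comp_apply, hD.leibniz _ hU₁ f s hf₁ hs γ hγ₁, map_add, map_smul, map_smul,
      hsα γ hγ₁]
    rfl
  · intro U hU X α hX hα
    refine hW.of_local hU fun γ hγ => ?_
    obtain ⟨U₁, hU₁U, hU₁, hγ₁, s, hs, hsα⟩ := hlift U hU α hα γ hγ
    refine ⟨U₁, hU₁, hγ₁, hW.mono (U := U₁) ?_ Set.inter_subset_right⟩
    refine hW.congr (hq _ _ (hD.smooth U₁ hU₁ X s (SmoothField.mono hX hU₁U) hs)) fun x hx => ?_
    rw [spec hU₁ hs hsα hx]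
    rfl
  · intro U hU X Y Z hX hY hZ α hα γ hγ
    obtain ⟨U₁, hU₁U, hU₁, hγ₁, s, hs, hsα⟩ := hlift U hU α hα γ hγ
    have hX₁ : SmoothIn P X U₁ := SmoothField.mono hX hU₁U
    have hY₁ : SmoothIn P Y U₁ := SmoothField.mono hY hU₁U
    have key : ∀ {A C : ∀ γ, P γ}, SmoothIn P C U₁ →
        pushforward SmV q D (fun x => pushforward SmV q D α x (C x)) γ (A γ) =
          q γ (D (fun x => D s x (C x)) γ (A γ)) := by
      intro A C hC
      rw [spec hU₁ (hD.smooth U₁ hU₁ C s hC hs)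
        (fun x hx => by rw [spec hU₁ hs hsα hx]; rfl) hγ₁]
      rfl
    rw [key hX₁, key hY₁, spec hU₁ hs hsα hγ₁, ← map_sub, hflat U₁ hU₁ X Y Z hX₁ hY₁
      (fun x hx => hZ x (hU₁U hx)) s hs γ hγ₁]
    rfl
  · intro U hU s hs γ hγ v
    rw [spec hU hs (fun x _ => rfl) hγ]
    rfl
  · intro D' hD' hC U hU α hα γ hγ
    obtain ⟨U₁, hU₁U, hU₁, hγ₁, s, hs, hsα⟩ := hlift U hU α hα γ hγ
    rw [spec hU₁ hs hsα hγ₁,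
      hD'.congr hU₁ (hW.mono hα hU₁U) (hq _ _ hs) (fun x hx => (hsα x hx).symm) hγ₁]
    exact LinearMap.ext fun v => hC U₁ hU₁ s hs γ hγ₁ v

end Pushforward

/-! ### Descent of the Bott connection along restriction of covectors. -/

section Restriction

variable {E : Type*} [NormedAddCommGroup E] [NormedSpace ℝ E] [FiniteDimensional ℝ E]
  {G : Type*} [TopologicalSpace G] [ChartedSpace E G] [IsManifold 𝓘(ℝ, E) ∞ G]
  {T S P : ∀ γ : G, Submodule ℂ (CTangent E γ)}

/-- Restriction of conormal covectors as a linear map. -/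
def conormalRestrictLinear (T P : ∀ γ : G, Submodule ℂ (CTangent E γ)) (γ : G) :
    Conormal P γ →ₗ[ℂ] Module.Dual ℂ (RelQuot T P γ) where
  toFun := conormalRestrict T P γ
  map_add' ξ ξ' := by
    refine LinearMap.ext fun w => ?_
    obtain ⟨v, rfl⟩ := Submodule.Quotient.mk_surjective _ w
    rfl
  map_smul' z ξ := by
    refine LinearMap.ext fun w => ?_
    obtain ⟨v, rfl⟩ := Submodule.Quotient.mk_surjective _ w
    rfl

lemma conormalRestrict_eq_zero_iff {γ : G} {ξ : Conormal P γ} :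
    conormalRestrict T P γ ξ = 0 ↔
      (ξ : Module.Dual ℂ (CTangent E γ)) ∈ (P γ ⊔ T γ).dualAnnihilator := by
  rw [Submodule.dualAnnihilator_sup_eq, Submodule.mem_inf, and_iff_right ξ.2,
    Submodule.mem_dualAnnihilator]
  constructor
  · intro h w hw
    exact DFunLike.congr_fun h (relMk T P γ ⟨w, hw⟩)
  · intro h
    refine LinearMap.ext fun w => ?_
    obtain ⟨v, rfl⟩ := Submodule.Quotient.mk_surjective _ w
    exact h v v.2

variable {r m l : ℕ} {N : Set G} {e : Fin r ⊕ Fin m ⊕ Fin l → ∀ γ : G, CTangent E γ}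
  {c : Fin r ⊕ Fin m ⊕ Fin l → ∀ γ : G, Module.Dual ℂ (CTangent E γ)}

/-- The frame of `T` modulo `P` given by an adapted frame. -/
def IsAdaptedFrame.field (h : IsAdaptedFrame P T N e c) (i : Fin m) (γ : G) : T γ :=
  ⟨e (.inr (.inl i)) γ, h.mem_right i γ⟩

lemma IsAdaptedFrame.smoothIn_field (h : IsAdaptedFrame P T N e c) (i : Fin m) :
    SmoothIn T (h.field i) N := h.isFrame.smooth _

/-- On `T` the third block of coordinates vanishes, and modulo `P` the first block disappears, so
only the middle block survives. -/
lemma IsAdaptedFrame.relMk_eq (h : IsAdaptedFrame P T N e c) {γ : G} (hγ : γ ∈ N) (v : T γ) :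
    relMk T P γ v = ∑ i, c (.inr (.inl i)) γ (v : CTangent E γ) • relMk T P γ (h.field i γ) := by
  have h1 : relMk T P γ (v - ∑ i, c (.inr (.inl i)) γ (v : CTangent E γ) • h.field i γ) = 0 := by
    rw [relMk, Submodule.Quotient.mk_eq_zero]
    refine (h.mem_left_iff γ hγ _).2 ?_
    have h0 := (h.mem_sup_iff γ hγ v).1 (Submodule.mem_sup_right v.2)
    rintro (i | i)
    · simp [IsAdaptedFrame.field, h.isFrame.dual γ hγ]
    · simp [IsAdaptedFrame.field, h.isFrame.dual γ hγ, h0]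
  rw [relMk, Submodule.Quotient.mk_sub, sub_eq_zero] at h1
  rw [relMk, h1]
  exact (map_sum ((P γ).submoduleOf (T γ)).mkQ _ _).trans
    (Finset.sum_congr rfl fun i _ => map_smul ((P γ).submoduleOf (T γ)).mkQ _ _)

/-- Extend `α` by zero along the first and third blocks of an adapted frame: the lift is a
combination of the middle covectors, and these annihilate `P`. -/
lemma exists_conormal_lift (hP : IsDistribution P) (hT : IsDistribution T) {k : ℕ}
    (hk : ∀ γ, Module.finrank ℂ ↥(T γ ⊓ P γ) = k) {U : Set G} (hU : IsOpen U)
    {α : ∀ γ : G, Module.Dual ℂ (RelQuot T P γ)} (hα : SmoothRelDual T P α U) {γ : G} (hγ : γ ∈ U) :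
    ∃ U' ⊆ U, IsOpen U' ∧ γ ∈ U' ∧ ∃ ξ : ∀ γ : G, Conormal P γ, SmoothConormal P ξ U' ∧
      ∀ x ∈ U', conormalRestrict T P x (ξ x) = α x := by
  classical
  obtain ⟨r, m, l, N, e, c, hγN, he⟩ := exists_adaptedFrame hP hT hk γ
  let θ : ∀ x : G, Module.Dual ℂ (CTangent E x) := fun x =>
    ∑ i, α x (relMk T P x (he.field i x)) • c (.inr (.inl i)) x
  have hθ : ∀ x ∈ U ∩ N, θ x ∈ Conormal P x := by
    intro x hx
    rw [Submodule.mem_dualAnnihilator]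
    intro u hu
    have h0 := (he.mem_left_iff x hx.2 u).1 hu
    simp [θ, h0]
  have hI := hU.inter he.isFrame.isOpen
  refine ⟨U ∩ N, Set.inter_subset_left, hI, ⟨hγ, hγN⟩,
    fun x => if h : x ∈ U ∩ N then ⟨θ x, hθ x h⟩ else 0, ?_, ?_⟩
  · intro W hW hWo Y hY
    have h1 : SmoothFun E (fun x => θ x (Y x)) W := by
      simp only [θ, LinearMap.sum_apply, LinearMap.smul_apply, smul_eq_mul]
      exact SmoothFun.sum fun i _ => (hα W (fun x hx => (hW hx).1) hWo _
        (SmoothField.mono (he.smoothIn_field i) fun x hx => (hW hx).2)).mul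
        (he.isFrame.smooth_coframe _ W (fun x hx => (hW hx).2) hWo Y hY)
    exact h1.congr fun x hx => by simp only [dif_pos (hW hx)]
  · intro x hx
    refine LinearMap.ext fun w => ?_
    obtain ⟨v, rfl⟩ := Submodule.Quotient.mk_surjective _ w
    simp only [dif_pos hx]
    change θ x (v : CTangent E x) = α x (relMk T P x v)
    rw [he.relMk_eq hx.2 v]
    simp [θ, mul_comm]

theorem exists_isTheFlatConnection_relDual (hP : IsDistribution P) (hT : IsDistribution T) {k : ℕ}
    (hk : ∀ γ, Module.finrank ℂ ↥(T γ ⊓ P γ) = k)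
    {D : (∀ γ : G, Conormal P γ) → ∀ γ : G, P γ →ₗ[ℂ] Conormal P γ}
    (hD : IsPConnection P (SmoothConormal P) D) (hflat : IsFlat P (SmoothConormal P) D)
    (hpres : PreservesAnnihilator P (fun γ => P γ ⊔ T γ) D) :
    ∃ DT, IsTheFlatConnection P (SmoothRelDual T P) (IsInduced T P D) DT := by
  refine ⟨_, isTheFlatConnection_pushforward (q := conormalRestrictLinear T P)
    (isSectionSheaf_conormal P) (isSectionSheaf_relDual T P) hD hflat ?_ ?_ ?_⟩
  · intro U hU ξ hξ h γ hγ v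
    exact conormalRestrict_eq_zero_iff.2 (hpres U hU ξ hξ
      (fun x hx => conormalRestrict_eq_zero_iff.1 (h x hx)) γ hγ v)
  · intro U ξ hξ W hW hWo Y hY
    exact hξ W hW hWo _ hY
  · intro U hU α hα γ hγ
    exact exists_conormal_lift hP hT hk hU hα hγ

end Restriction

/-! ### Direct sums of partial connections. -/

section DirectSum

variable {E : Type*} [NormedAddCommGroup E] [NormedSpace ℝ E]
  {G : Type*} [TopologicalSpace G] [ChartedSpace E G] [IsManifold 𝓘(ℝ, E) ∞ G]
  {T S P : ∀ γ : G, Submodule ℂ (CTangent E γ)}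
  {DT : (∀ γ : G, Module.Dual ℂ (RelQuot T P γ)) → ∀ γ : G, P γ →ₗ[ℂ] Module.Dual ℂ (RelQuot T P γ)}
  {DS : (∀ γ : G, Module.Dual ℂ (RelQuot S P γ)) → ∀ γ : G, P γ →ₗ[ℂ] Module.Dual ℂ (RelQuot S P γ)}

/-- The direct sum of two connections, as a linear map in the direction. -/
def directSumConnection
    (DT : (∀ γ : G, Module.Dual ℂ (RelQuot T P γ)) →
      ∀ γ : G, P γ →ₗ[ℂ] Module.Dual ℂ (RelQuot T P γ))
    (DS : (∀ γ : G, Module.Dual ℂ (RelQuot S P γ)) →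
      ∀ γ : G, P γ →ₗ[ℂ] Module.Dual ℂ (RelQuot S P γ))
    (β : ∀ γ : G, Module.Dual ℂ (SumQuot T S P γ)) (γ : G) :
    P γ →ₗ[ℂ] Module.Dual ℂ (SumQuot T S P γ) where
  toFun v := sumConnection T S P DT DS β γ v
  map_add' v w := by
    refine LinearMap.ext fun a => ?_
    simp only [sumConnection, map_add, LinearMap.coprod_apply, LinearMap.add_apply]
    ring
  map_smul' z v := by
    refine LinearMap.ext fun a => ?_
    simp only [sumConnection, map_smul, LinearMap.coprod_apply, LinearMap.smul_apply, smul_eq_mul,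
      RingHom.id_apply]
    ring

lemma directSumConnection_inl (β : ∀ γ : G, Module.Dual ℂ (SumQuot T S P γ)) (γ : G) (v : P γ) :
    (directSumConnection DT DS β γ v).comp (LinearMap.inl ℂ _ _) =
      DT (fun x => (β x).comp (LinearMap.inl ℂ _ _)) γ v :=
  LinearMap.coprod_inl _ _

lemma directSumConnection_inr (β : ∀ γ : G, Module.Dual ℂ (SumQuot T S P γ)) (γ : G) (v : P γ) :
    (directSumConnection DT DS β γ v).comp (LinearMap.inr ℂ _ _) =
      DS (fun x => (β x).comp (LinearMap.inr ℂ _ _)) γ v :=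
  LinearMap.coprod_inr _ _

lemma IsPConnection.directSum (hT : IsPConnection P (SmoothRelDual T P) DT)
    (hS : IsPConnection P (SmoothRelDual S P) DS) :
    IsPConnection P (SmoothSumDual T S P) (directSumConnection DT DS) where
  add U hU β β' hβ hβ' γ hγ := by
    refine LinearMap.ext fun v => LinearMap.prod_ext ?_ ?_
    · rw [directSumConnection_inl, LinearMap.add_apply, LinearMap.add_comp, directSumConnection_inl,
        directSumConnection_inl]
      exact DFunLike.congr_fun (hT.add U hU _ _ hβ.1 hβ'.1 γ hγ) v
    · rw [directSumConnection_inr, LinearMap.add_apply, LinearMap.add_comp, directSumConnection_inr,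
        directSumConnection_inr]
      exact DFunLike.congr_fun (hS.add U hU _ _ hβ.2 hβ'.2 γ hγ) v
  leibniz U hU f β hf hβ γ hγ v := by
    refine LinearMap.prod_ext ?_ ?_
    · rw [directSumConnection_inl, LinearMap.add_comp, LinearMap.smul_comp, LinearMap.smul_comp,
        directSumConnection_inl]
      exact hT.leibniz U hU f _ hf hβ.1 γ hγ v
    · rw [directSumConnection_inr, LinearMap.add_comp, LinearMap.smul_comp, LinearMap.smul_comp,
        directSumConnection_inr]
      exact hS.leibniz U hU f _ hf hβ.2 γ hγ v
  smooth U hU X β hX hβ := by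
    constructor
    · simp only [directSumConnection_inl]
      exact hT.smooth U hU X _ hX hβ.1
    · simp only [directSumConnection_inr]
      exact hS.smooth U hU X _ hX hβ.2

lemma IsFlat.directSum (hT : IsFlat P (SmoothRelDual T P) DT)
    (hS : IsFlat P (SmoothRelDual S P) DS) :
    IsFlat P (SmoothSumDual T S P) (directSumConnection DT DS) := by
  intro U hU X Y Z hX hY hZ β hβ γ hγ
  refine LinearMap.prod_ext ?_ ?_
  · simp only [LinearMap.sub_comp, directSumConnection_inl]
    exact hT U hU X Y Z hX hY hZ _ hβ.1 γ hγ
  · simp only [LinearMap.sub_comp, directSumConnection_inr]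
    exact hS U hU X Y Z hX hY hZ _ hβ.2 γ hγ

end DirectSum

/-! ### Connections on line bundles from local frames. -/

section LineFrames

variable {E : Type*} [NormedAddCommGroup E] [NormedSpace ℝ E]
  {G : Type*} [TopologicalSpace G] [ChartedSpace E G]

/-- A smooth frame `a` of a line bundle over `V`, with coordinate `l`. -/
structure IsLineFrame (E : Type*) [NormedAddCommGroup E] [NormedSpace ℝ E]
    {G : Type*} [TopologicalSpace G] [ChartedSpace E G]
    {L : G → Type*} [∀ γ, AddCommGroup (L γ)] [∀ γ, Module ℂ (L γ)]
    (Sm : (∀ γ, L γ) → Set G → Prop) (V : Set G) (a : ∀ γ, L γ) (l : ∀ γ, L γ →ₗ[ℂ] ℂ) : Prop where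
  isOpen : IsOpen V
  smooth : Sm a V
  coord_self : ∀ γ ∈ V, l γ (a γ) = 1
  expand : ∀ γ ∈ V, ∀ x, x = l γ x • a γ
  smooth_coord : ∀ W ⊆ V, IsOpen W → ∀ s, Sm s W → SmoothFun E (fun γ => l γ (s γ)) W

variable {L : G → Type*} [∀ γ, AddCommGroup (L γ)] [∀ γ, Module ℂ (L γ)]
  {Sm : (∀ γ, L γ) → Set G → Prop}

lemma IsLineFrame.mono {V W : Set G} {a : ∀ γ, L γ} {l : ∀ γ, L γ →ₗ[ℂ] ℂ}
    (h : IsLineFrame E Sm V a l) (hSm : IsSectionSheaf E Sm) (hW : W ⊆ V) (hWo : IsOpen W) :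
    IsLineFrame E Sm W a l :=
  ⟨hWo, hSm.mono h.smooth hW, fun γ hγ => h.coord_self γ (hW hγ), fun γ hγ => h.expand γ (hW hγ),
    fun W' hW' => h.smooth_coord W' (hW'.trans hW)⟩

/-- Every nowhere vanishing smooth section of a line bundle is a frame. -/
lemma IsLineFrame.of_ne_zero {V : Set G} {a b : ∀ γ, L γ} {l : ∀ γ, L γ →ₗ[ℂ] ℂ}
    (h : IsLineFrame E Sm V a l) (hb : Sm b V) (h0 : ∀ γ ∈ V, b γ ≠ 0) :
    IsLineFrame E Sm V b (fun γ => (l γ (b γ))⁻¹ • l γ) := by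
  have hl : ∀ γ ∈ V, l γ (b γ) ≠ 0 := fun γ hγ h1 => h0 γ hγ (by
    rw [h.expand γ hγ (b γ), h1, zero_smul])
  refine ⟨h.isOpen, hb, fun γ hγ => ?_, fun γ hγ x => ?_, fun W hW hWo s hs => ?_⟩
  · simp [hl γ hγ]
  · conv_lhs => rw [h.expand γ hγ x]
    conv_rhs => rw [h.expand γ hγ (b γ)]
    rw [smul_smul]
    congr 1
    simp only [LinearMap.smul_apply, smul_eq_mul, map_smul, h.coord_self γ hγ, mul_one]
    rw [mul_right_comm, inv_mul_cancel₀ (hl γ hγ), one_mul]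
  · simp only [LinearMap.smul_apply, smul_eq_mul]
    have hsub : IsOpen V := h.isOpen
    exact (((h.smooth_coord V subset_rfl hsub b hb).inv hl).mono hW).mul (h.smooth_coord W hW hWo s hs)

variable [IsManifold 𝓘(ℝ, E) ∞ G] {P : ∀ γ : G, Submodule ℂ (CTangent E γ)}
  {D D' : (∀ γ, L γ) → ∀ γ, P γ →ₗ[ℂ] L γ}

lemma IsPConnection.apply_of_lineFrame (hD : IsPConnection P Sm D) (hSm : IsSectionSheaf E Sm)
    {V : Set G} {a : ∀ γ, L γ} {l : ∀ γ, L γ →ₗ[ℂ] ℂ} (h : IsLineFrame E Sm V a l) {U : Set G}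
    (hU : IsOpen U) {s : ∀ γ, L γ} (hs : Sm s U) {γ : G} (hγ : γ ∈ U) (hγV : γ ∈ V) (v : P γ) :
    D s γ v = l γ (s γ) • D a γ v + cDeriv (fun x => l x (s x)) γ (v : CTangent E γ) • a γ := by
  have hI := hU.inter h.isOpen
  have hs' := hSm.mono hs (Set.inter_subset_left (t := V))
  have ha' := hSm.mono h.smooth (Set.inter_subset_right (s := U))
  have hf := h.smooth_coord _ Set.inter_subset_right hI s hs'
  rw [hD.congr hI hs' (hSm.smul hf ha') (fun x hx => h.expand x hx.2 (s x)) ⟨hγ, hγV⟩,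
    hD.leibniz _ hI _ a hf ha' γ ⟨hγ, hγV⟩]

/-- Connections on a line bundle that agree on a frame agree. -/
lemma IsPConnection.eq_of_lineFrame (hD : IsPConnection P Sm D) (hD' : IsPConnection P Sm D')
    (hSm : IsSectionSheaf E Sm) {V : Set G} {a : ∀ γ, L γ} {l : ∀ γ, L γ →ₗ[ℂ] ℂ}
    (h : IsLineFrame E Sm V a l) (ha : ∀ γ ∈ V, D' a γ = D a γ) {U : Set G} (hU : IsOpen U)
    {s : ∀ γ, L γ} (hs : Sm s U) {γ : G} (hγ : γ ∈ U) (hγV : γ ∈ V) : D' s γ = D s γ := by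
  ext v
  rw [hD.apply_of_lineFrame hSm h hU hs hγ hγV, hD'.apply_of_lineFrame hSm h hU hs hγ hγV,
    ha γ hγV]

/-- A connection on a line bundle is flat if its curvature vanishes on local frames. -/
lemma isFlat_of_lineFrames [FiniteDimensional ℝ E] (hD : IsPConnection P Sm D)
    (hSm : IsSectionSheaf E Sm)
    (h : ∀ γ : G, ∃ (V : Set G) (a : ∀ γ, L γ) (l : ∀ γ, L γ →ₗ[ℂ] ℂ), γ ∈ V ∧
      IsLineFrame E Sm V a l ∧ ∀ W ⊆ V, IsOpen W → ∀ X Y Z : ∀ γ, P γ, SmoothIn P X W →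
        SmoothIn P Y W → (∀ γ ∈ W, (Z γ : CTangent E γ) = cBracket (fun x => (X x : CTangent E x))
          (fun x => (Y x : CTangent E x)) γ) → ∀ γ ∈ W,
        D (fun x => D a x (Y x)) γ (X γ) - D (fun x => D a x (X x)) γ (Y γ) = D a γ (Z γ)) :
    IsFlat P Sm D := by
  have : CompleteSpace E := FiniteDimensional.complete ℝ E
  intro U hU X Y Z hX hY hZ s hs γ hγ
  obtain ⟨V, a, l, hγV, hV, hR⟩ := h γ
  have hW := hU.inter hV.isOpen
  have hγW : γ ∈ U ∩ V := ⟨hγ, hγV⟩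
  replace hX : SmoothIn P X (U ∩ V) := SmoothField.mono hX Set.inter_subset_left
  replace hY : SmoothIn P Y (U ∩ V) := SmoothField.mono hY Set.inter_subset_left
  replace hs := hSm.mono hs (Set.inter_subset_left (t := V))
  have ha := hSm.mono hV.smooth (Set.inter_subset_right (s := U))
  have hf := hV.smooth_coord _ Set.inter_subset_right hW s hs
  set f : G → ℂ := fun x => l x (s x) with hfdef
  have h1 : ∀ x ∈ U ∩ V, ∀ v : P x, D s x v = f x • D a x v + cDeriv f x (v : CTangent E x) • a x :=
    fun x hx v => hD.apply_of_lineFrame hSm hV hW hs hx hx.2 v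
  -- Second derivative of `s = f a`. The terms with one derivative on `f` and one on `a` are
  -- symmetric in the two directions and cancel in the commutator. The second derivatives of `f` are
  -- absorbed by `[X,Y]f`.
  have h2 : ∀ {A C : ∀ γ, P γ}, SmoothIn P C (U ∩ V) → D (fun x => D s x (C x)) γ (A γ) =
      f γ • D (fun x => D a x (C x)) γ (A γ) + cDeriv f γ (A γ : CTangent E γ) • D a γ (C γ)
      + (cDeriv f γ (C γ : CTangent E γ) • D a γ (A γ)
        + cDeriv (fun x => cDeriv f x (C x : CTangent E x)) γ (A γ : CTangent E γ) • a γ) := by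
    intro A C hC
    have hDa := hD.smooth _ hW C a hC ha
    have hfC := hf.cDeriv hW hC
    rw [hD.congr hW (hD.smooth _ hW C s hC hs) (hSm.add (hSm.smul hf hDa) (hSm.smul hfC ha))
      (fun x hx => h1 x hx (C x)) hγW,
      hD.add _ hW _ _ (hSm.smul hf hDa) (hSm.smul hfC ha) γ hγW, LinearMap.add_apply,
      hD.leibniz _ hW f _ hf hDa γ hγW, hD.leibniz _ hW _ a hfC ha γ hγW]
  rw [h2 hX, h2 hY, h1 γ hγW, ← hR _ Set.inter_subset_right hW X Y Z hX hY
    (fun x hx => hZ x hx.1) γ hγW, hZ γ hγ, cDeriv_cBracket hW hX hY hf hγW]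
  module

/-- The connection on a line bundle that maps the frames `a i` to `Θ i`, where the frame with index
`γ` is used at the point `γ`. -/
def lineConnection (a : G → ∀ γ, L γ) (l : G → ∀ γ, L γ →ₗ[ℂ] ℂ) (Θ : G → ∀ γ, P γ →ₗ[ℂ] L γ)
    (s : ∀ γ, L γ) (γ : G) : P γ →ₗ[ℂ] L γ :=
  l γ γ (s γ) • Θ γ γ + ((cDeriv (fun x => l γ x (s x)) γ).comp (P γ).subtype).smulRight (a γ γ)

variable {V : G → Set G} {a : G → ∀ γ, L γ} {l : G → ∀ γ, L γ →ₗ[ℂ] ℂ} {Θ : G → ∀ γ, P γ →ₗ[ℂ] L γ}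

/-- The definition switches frames from point to point. By the transition rule any frame `i` around
`γ` computes the same value, so on `V i` one frame can be used throughout, which smoothness
requires. -/
lemma lineConnection_apply (hSm : IsSectionSheaf E Sm) (hV : ∀ i, IsLineFrame E Sm (V i) (a i) (l i))
    (hmem : ∀ γ, γ ∈ V γ)
    (hcompat : ∀ i j, ∀ γ ∈ V i ∩ V j, ∀ v : P γ, Θ j γ v = l i γ (a j γ) • Θ i γ v
      + cDeriv (fun x => l i x (a j x)) γ (v : CTangent E γ) • a i γ)
    (i : G) {U : Set G} (hU : IsOpen U) {s : ∀ γ, L γ} (hs : Sm s U) {γ : G} (hγ : γ ∈ U)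
    (hγi : γ ∈ V i) (v : P γ) :
    lineConnection a l Θ s γ v = l i γ (s γ) • Θ i γ v
      + cDeriv (fun x => l i x (s x)) γ (v : CTangent E γ) • a i γ := by
  have hI : IsOpen (V i ∩ V γ) := (hV i).isOpen.inter (hV γ).isOpen
  have hW : IsOpen (U ∩ (V i ∩ V γ)) := hU.inter hI
  have hγW : γ ∈ U ∩ (V i ∩ V γ) := ⟨hγ, hγi, hmem γ⟩
  have hs' := hSm.mono hs (Set.inter_subset_left (t := V i ∩ V γ))
  have hf := (hV γ).smooth_coord _ (fun x hx => hx.2.2) hW s hs'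
  have hg := (hV i).smooth_coord (U ∩ (V i ∩ V γ)) (fun x hx => hx.2.1) hW (a γ)
    (hSm.mono (hV γ).smooth fun x hx => hx.2.2)
  have h1 : ∀ x ∈ U ∩ (V i ∩ V γ), l i x (s x) = l γ x (s x) * l i x (a γ x) := by
    intro x hx
    conv_lhs => rw [(hV γ).expand x hx.2.2 (s x), map_smul, smul_eq_mul]
  rw [cDeriv_congr_on hW h1 hγW, h1 γ hγW, cDeriv_mul (hf.mdifferentiableAt hW hγW)
    (hg.mdifferentiableAt hW hγW)]
  simp only [lineConnection, LinearMap.add_apply, LinearMap.smul_apply, LinearMap.smulRight_apply,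
    LinearMap.comp_apply, Submodule.subtype_apply]
  rw [hcompat i γ γ ⟨hγi, hmem γ⟩ v]
  conv_lhs => rw [(hV i).expand γ hγi (a γ γ)]
  simp only [map_smul, (hV i).coord_self γ hγi, smul_eq_mul, mul_one]
  module

theorem isPConnection_lineConnection (hSm : IsSectionSheaf E Sm)
    (hV : ∀ i, IsLineFrame E Sm (V i) (a i) (l i)) (hmem : ∀ γ, γ ∈ V γ)
    (hcompat : ∀ i j, ∀ γ ∈ V i ∩ V j, ∀ v : P γ, Θ j γ v = l i γ (a j γ) • Θ i γ v
      + cDeriv (fun x => l i x (a j x)) γ (v : CTangent E γ) • a i γ)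
    (hΘ : ∀ i, ∀ W ⊆ V i, IsOpen W → ∀ X : ∀ γ, P γ, SmoothIn P X W →
      Sm (fun γ => Θ i γ (X γ)) W) :
    IsPConnection P Sm (lineConnection a l Θ) := by
  have hap := fun (i : G) {U : Set G} (hU : IsOpen U) {s : ∀ γ, L γ} (hs : Sm s U) {γ : G}
    (hγ : γ ∈ U) (hγi : γ ∈ V i) (v : P γ) =>
    lineConnection_apply hSm hV hmem hcompat i hU hs hγ hγi v
  have hcoord : ∀ {U : Set G}, IsOpen U → ∀ {s}, Sm s U → ∀ i,
      SmoothFun E (fun x => l i x (s x)) (U ∩ V i) := fun hU s hs i =>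
    (hV i).smooth_coord _ Set.inter_subset_right (hU.inter (hV i).isOpen) s
      (hSm.mono hs Set.inter_subset_left)
  refine ⟨?_, ?_, ?_⟩
  · intro U hU s s' hs hs' γ hγ
    ext v
    have hI := hU.inter (hV γ).isOpen
    have hγI : γ ∈ U ∩ V γ := ⟨hγ, hmem γ⟩
    rw [LinearMap.add_apply, hap γ hU hs hγ (hmem γ), hap γ hU hs' hγ (hmem γ),
      hap γ hU (hSm.add hs hs') hγ (hmem γ)]
    simp only [map_add]
    rw [cDeriv_add ((hcoord hU hs γ).mdifferentiableAt hI hγI)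
      ((hcoord hU hs' γ).mdifferentiableAt hI hγI)]
    module
  · intro U hU f s hf hs γ hγ v
    have hI := hU.inter (hV γ).isOpen
    have hγI : γ ∈ U ∩ V γ := ⟨hγ, hmem γ⟩
    rw [hap γ hU hs hγ (hmem γ), hap γ hU (hSm.smul hf hs) hγ (hmem γ)]
    simp only [map_smul, smul_eq_mul]
    rw [cDeriv_mul (hf.mdifferentiableAt hU hγ) ((hcoord hU hs γ).mdifferentiableAt hI hγI)]
    conv_rhs => rw [(hV γ).expand γ (hmem γ) (s γ)]
    simp only [map_smul, (hV γ).coord_self γ (hmem γ), smul_eq_mul, mul_one]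
    module
  · intro U hU X s hX hs
    refine hSm.of_local hU fun γ hγ => ⟨V γ, (hV γ).isOpen, hmem γ, ?_⟩
    have hI := hU.inter (hV γ).isOpen
    have hX' : SmoothIn P X (U ∩ V γ) := SmoothField.mono hX Set.inter_subset_left
    exact hSm.congr (hSm.add (hSm.smul (hcoord hU hs γ) (hΘ γ _ Set.inter_subset_right hI X hX'))
      (hSm.smul ((hcoord hU hs γ).cDeriv hI hX') (hSm.mono (hV γ).smooth Set.inter_subset_right)))
      fun x hx => hap γ hU hs hx.1 hx.2 (X x)

end LineFrames

/-! ### Square roots of line bundles. -/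

section SquareRoots

variable {E : Type*} [NormedAddCommGroup E] [NormedSpace ℝ E]
  {G : Type*} [TopologicalSpace G] [ChartedSpace E G]
  {L : G → Type*} [TopologicalSpace (Bundle.TotalSpace ℂ L)]
  [∀ γ, TopologicalSpace (L γ)] [∀ γ, AddCommGroup (L γ)] [∀ γ, Module ℂ (L γ)]
  [FiberBundle ℂ L] [VectorBundle ℂ ℂ L] [VectorBundle ℝ ℂ L] [ContMDiffVectorBundle ∞ ℂ L 𝓘(ℝ, E)]

/-- The coordinate is taken as a complex linear map, although smoothness is over the reals, so that
it can be multiplied by complex functions. -/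
lemma smoothLine_iff {s : ∀ γ, L γ} (e : Bundle.Trivialization ℂ (Bundle.TotalSpace.proj (E := L)))
    [MemTrivializationAtlas e] {W : Set G} (hWe : W ⊆ e.baseSet) :
    SmoothLine E L s W ↔ SmoothFun E (fun γ => e.linearMapAt ℂ γ (s γ)) W := by
  have h : SmoothLine E L s W ↔ SmoothFun E (fun γ => (e ⟨γ, s γ⟩).2) W :=
    forall₂_congr fun γ hγ => e.contMDiffWithinAt_section (IB := 𝓘(ℝ, E)) W (hWe hγ)
  exact h.trans (contMDiffOn_congr fun γ hγ => by rw [e.coe_linearMapAt_of_mem (hWe hγ)])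

lemma isSectionSheaf_smoothLine : IsSectionSheaf E (SmoothLine E L) := by
  have hmono : ∀ {s : ∀ γ, L γ} {U W}, SmoothLine E L s U → W ⊆ U → SmoothLine E L s W :=
    fun h hW => ContMDiffOn.mono h hW
  have hlocal : ∀ {s : ∀ γ, L γ} {U : Set G}, (∀ γ ∈ U, ∃ W, IsOpen W ∧ γ ∈ W ∧
      SmoothLine E L s (U ∩ W)) → SmoothLine E L s U := fun h =>
    contMDiffOn_of_locally_contMDiffOn h
  refine ⟨hmono, ?_, fun _ h => hlocal h, ?_, ?_, ?_⟩
  · intro s s' U h hs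
    exact ContMDiffOn.congr h fun γ hγ => by rw [hs γ hγ]
  · refine fun {s s' U} h h' => hlocal fun γ hγ => ?_
    let e := trivializationAt ℂ L γ
    refine ⟨e.baseSet, e.open_baseSet, FiberBundle.mem_baseSet_trivializationAt' γ, ?_⟩
    have h1 := (smoothLine_iff e Set.inter_subset_right).1 (hmono h Set.inter_subset_left)
    have h2 := (smoothLine_iff e Set.inter_subset_right).1 (hmono h' Set.inter_subset_left)
    exact (smoothLine_iff e Set.inter_subset_right).2 ((h1.add h2).congr fun x _ => map_add _ _ _)
  · refine fun {f s U} hf h => hlocal fun γ hγ => ?_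
    let e := trivializationAt ℂ L γ
    refine ⟨e.baseSet, e.open_baseSet, FiberBundle.mem_baseSet_trivializationAt' γ, ?_⟩
    have h1 := (smoothLine_iff e Set.inter_subset_right).1 (hmono h Set.inter_subset_left)
    exact (smoothLine_iff e Set.inter_subset_right).2
      (((hf.mono Set.inter_subset_left).mul h1).congr fun x _ => map_smul _ _ _)
  · refine fun U => hlocal fun γ hγ => ?_
    let e := trivializationAt ℂ L γ
    exact ⟨e.baseSet, e.open_baseSet, FiberBundle.mem_baseSet_trivializationAt' γ,
      (smoothLine_iff e Set.inter_subset_right).2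
        ((smoothFun_const 0 _).congr fun x _ => map_zero _)⟩

lemma exists_lineFrame_smoothLine (γ₀ : G) : ∃ (V : Set G) (a : ∀ γ, L γ) (l : ∀ γ, L γ →ₗ[ℂ] ℂ),
    γ₀ ∈ V ∧ IsLineFrame E (SmoothLine E L) V a l := by
  let e := trivializationAt ℂ L γ₀
  have h1 : ∀ γ ∈ e.baseSet, ∀ z : ℂ, e.linearMapAt ℂ γ (e.symmₗ ℂ γ z) = z :=
    fun γ hγ z => e.linearMapAt_symmₗ hγ z
  refine ⟨e.baseSet, fun γ => e.symmₗ ℂ γ 1, fun γ => e.linearMapAt ℂ γ,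
    FiberBundle.mem_baseSet_trivializationAt' γ₀, e.open_baseSet, ?_, fun γ hγ => h1 γ hγ 1, ?_, ?_⟩
  · exact (smoothLine_iff e subset_rfl).2
      ((smoothFun_const 1 _).congr fun γ hγ => h1 γ hγ 1)
  · intro γ hγ x
    rw [← map_smul, smul_eq_mul, mul_one, e.symmₗ_linearMapAt hγ]
  · intro W hW hWo s hs
    exact (smoothLine_iff e hW).1 hs

variable [IsManifold 𝓘(ℝ, E) ∞ G] {P : ∀ γ : G, Submodule ℂ (CTangent E γ)}
  {Λ : G → Type*} [∀ γ, AddCommGroup (Λ γ)] [∀ γ, Module ℂ (Λ γ)]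
  {SmΛ : (∀ γ, Λ γ) → Set G → Prop} {φ : ∀ γ, (L γ ⊗[ℂ] L γ) ≃ₗ[ℂ] Λ γ}
  {DΛ : (∀ γ, Λ γ) → ∀ γ, P γ →ₗ[ℂ] Λ γ} {D D' : (∀ γ, L γ) → ∀ γ, P γ →ₗ[ℂ] L γ}

/-- Local frames of a square root of a line bundle whose squares are frames as well. -/
lemma exists_square_frames (hΛ : IsSectionSheaf E SmΛ)
    (hΛf : ∀ γ : G, ∃ (V : Set G) (a : ∀ γ, Λ γ) (l : ∀ γ, Λ γ →ₗ[ℂ] ℂ), γ ∈ V ∧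
      IsLineFrame E SmΛ V a l)
    (hφ : IsSmoothSquare E L SmΛ φ) (γ : G) :
    ∃ (V : Set G) (a : ∀ γ, L γ) (l : ∀ γ, L γ →ₗ[ℂ] ℂ) (m : ∀ γ, Λ γ →ₗ[ℂ] ℂ), γ ∈ V ∧
      IsLineFrame E (SmoothLine E L) V a l ∧
      IsLineFrame E SmΛ V (fun x => φ x (a x ⊗ₜ[ℂ] a x)) m := by
  obtain ⟨V, a, l, hγV, h⟩ := exists_lineFrame_smoothLine (E := E) (L := L) γ
  obtain ⟨V', b, m, hγV', h'⟩ := hΛf γ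
  have hI : IsOpen (V ∩ V') := h.isOpen.inter h'.isOpen
  have h1 := h.mono isSectionSheaf_smoothLine Set.inter_subset_left hI
  have h2 := h'.mono hΛ Set.inter_subset_right hI
  refine ⟨V ∩ V', a, l, _, ⟨hγV, hγV'⟩, h1,
    h2.of_ne_zero (hφ _ hI a a h1.smooth h1.smooth) fun x hx h0 => ?_⟩
  -- The square of the frame is nonzero because `l ⊗ l` takes the value `1` on `a ⊗ a`.
  have h3 := congrArg (LinearMap.mul' ℂ ℂ ∘ₗ TensorProduct.map (l x) (l x))
    ((LinearEquiv.map_eq_zero_iff _).1 h0)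
  simp [h1.coord_self x hx] at h3

/-- A square root connection of a flat connection is flat. -/
lemma IsSquareRootConnection.isFlat [FiniteDimensional ℝ E]
    (hΛ : IsSectionSheaf E SmΛ)
    (hΛf : ∀ γ : G, ∃ (V : Set G) (a : ∀ γ, Λ γ) (l : ∀ γ, Λ γ →ₗ[ℂ] ℂ), γ ∈ V ∧
      IsLineFrame E SmΛ V a l)
    (hφ : IsSmoothSquare E L SmΛ φ) (hDΛ : IsPConnection P SmΛ DΛ) (hflat : IsFlat P SmΛ DΛ)
    (hD : IsPConnection P (SmoothLine E L) D) (h : IsSquareRootConnection (E := E) P L φ DΛ D) :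
    IsFlat P (SmoothLine E L) D := by
  have sh := isSectionSheaf_smoothLine (E := E) (L := L)
  refine isFlat_of_lineFrames hD sh fun γ => ?_
  obtain ⟨V, a, l, m, hγV, hV, hω⟩ := exists_square_frames hΛ hΛf hφ γ
  refine ⟨V, a, l, hγV, hV, ?_⟩
  intro W hWV hW X Y Z hX hY hZ γ hγ
  have ha := sh.mono hV.smooth hWV
  -- The cross terms `∇a ⊗ ∇a` are symmetric under exchange of the two directions and cancel in the
  -- curvature.
  have key : ∀ {A C : ∀ γ, P γ}, SmoothIn P C W →
      DΛ (fun x => DΛ (fun x => φ x (a x ⊗ₜ[ℂ] a x)) x (C x)) γ (A γ) =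
        φ γ (D (fun x => D a x (C x)) γ (A γ) ⊗ₜ[ℂ] a γ + D a γ (C γ) ⊗ₜ[ℂ] D a γ (A γ)
          + (D a γ (A γ) ⊗ₜ[ℂ] D a γ (C γ) + a γ ⊗ₜ[ℂ] D (fun x => D a x (C x)) γ (A γ))) := by
    intro A C hC
    have hDa := hD.smooth W hW C a hC ha
    have h1 := hφ W hW _ _ hDa ha
    have h2 := hφ W hW _ _ ha hDa
    rw [hDΛ.congr hW (hDΛ.smooth W hW C _ hC (hφ W hW _ _ ha ha)) (hΛ.add h1 h2)
      (fun x hx => by rw [h W hW a a ha ha x hx, map_add]) hγ,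
      hDΛ.add W hW _ _ h1 h2 γ hγ, LinearMap.add_apply, h W hW _ _ hDa ha γ hγ,
      h W hW _ _ ha hDa γ hγ, ← map_add]
  have hR := hflat W hW X Y Z hX hY hZ _ (hφ W hW _ _ ha ha) γ hγ
  rw [key hX, key hY, h W hW a a ha ha γ hγ, ← map_sub] at hR
  -- Evaluation by `l ⊗ l` turns flatness on `a ⊗ a` into `2 R = 0` for the curvature coefficient
  -- `R` of `a`.
  have hR' := congrArg (LinearMap.mul' ℂ ℂ ∘ₗ TensorProduct.map (l γ) (l γ)) ((φ γ).injective hR)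
  simp only [map_add, map_sub, LinearMap.comp_apply, TensorProduct.map_tmul, LinearMap.mul'_apply,
    hV.coord_self γ (hWV hγ)] at hR'
  rw [hV.expand γ (hWV hγ) (D (fun x => D a x (Y x)) γ (X γ)),
    hV.expand γ (hWV hγ) (D (fun x => D a x (X x)) γ (Y γ)), hV.expand γ (hWV hγ) (D a γ (Z γ)),
    ← sub_smul]
  congr 1
  linear_combination hR' / 2

/-- On a frame `a` the derivative of `a ⊗ a` determines twice the connection form, hence the form
itself. -/
lemma IsSquareRootConnection.unique 
    (hΛ : IsSectionSheaf E SmΛ)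
    (hΛf : ∀ γ : G, ∃ (V : Set G) (a : ∀ γ, Λ γ) (l : ∀ γ, Λ γ →ₗ[ℂ] ℂ), γ ∈ V ∧
      IsLineFrame E SmΛ V a l)
    (hφ : IsSmoothSquare E L SmΛ φ)
    (hD : IsPConnection P (SmoothLine E L) D) (h : IsSquareRootConnection (E := E) P L φ DΛ D)
    (hD' : IsPConnection P (SmoothLine E L) D') (h' : IsSquareRootConnection (E := E) P L φ DΛ D')
    {U : Set G} (hU : IsOpen U) {s : ∀ γ, L γ} (hs : SmoothLine E L s U) {γ : G} (hγ : γ ∈ U) :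
    D' s γ = D s γ := by
  obtain ⟨V, a, l, m, hγV, hV, hω⟩ := exists_square_frames hΛ hΛf hφ γ
  refine hD.eq_of_lineFrame hD' isSectionSheaf_smoothLine hV (fun x hx => ?_) hU hs hγ hγV
  ext v
  have h1 := (φ x).injective ((h V hV.isOpen a a hV.smooth hV.smooth x hx v).symm.trans
    (h' V hV.isOpen a a hV.smooth hV.smooth x hx v))
  have h2 := congrArg (LinearMap.mul' ℂ ℂ ∘ₗ TensorProduct.map (l x) (l x)) h1
  simp only [map_add, LinearMap.comp_apply, TensorProduct.map_tmul, LinearMap.mul'_apply,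
    hV.coord_self x hx] at h2
  rw [hV.expand x hx (D a x v), hV.expand x hx (D' a x v)]
  congr 1
  linear_combination - h2 / 2

/-- If `∇(a ⊗ a) = θ · a ⊗ a`, the rule forces `∇a = ½ θ · a`. When `a` is replaced by `g a`, the
square changes by `g²` and `θ` by `2 dg/g`. Half of this is `dg/g`, exactly the change required of a
connection form of `a`, so the local definitions glue. -/
theorem exists_isTheFlatConnection_squareRoot [FiniteDimensional ℝ E]
    (hΛ : IsSectionSheaf E SmΛ)
    (hΛf : ∀ γ : G, ∃ (V : Set G) (a : ∀ γ, Λ γ) (l : ∀ γ, Λ γ →ₗ[ℂ] ℂ), γ ∈ V ∧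
      IsLineFrame E SmΛ V a l)
    (hφ : IsSmoothSquare E L SmΛ φ) (hDΛ : IsPConnection P SmΛ DΛ) (hflat : IsFlat P SmΛ DΛ) :
    ∃ DL, IsTheFlatConnection P (SmoothLine E L) (IsSquareRootConnection (E := E) P L φ DΛ) DL := by
  have sh := isSectionSheaf_smoothLine (E := E) (L := L)
  choose V a l m hmem hV hω using exists_square_frames hΛ hΛf hφ
  let b : G → ∀ γ, Λ γ := fun i x => φ x (a i x ⊗ₜ[ℂ] a i x)
  let Θ : G → ∀ γ, P γ →ₗ[ℂ] L γ := fun i γ =>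
    ((1 / 2 : ℂ) • (m i γ).comp (DΛ (b i) γ)).smulRight (a i γ)
  have hcompat : ∀ i j, ∀ γ ∈ V i ∩ V j, ∀ v : P γ, Θ j γ v = l i γ (a j γ) • Θ i γ v
      + cDeriv (fun x => l i x (a j x)) γ (v : CTangent E γ) • a i γ := by
    intro i j γ hγ v
    have hI : IsOpen (V i ∩ V j) := (hV i).isOpen.inter (hV j).isOpen
    have hg := (hV i).smooth_coord _ Set.inter_subset_left hI (a j)
      (sh.mono (hV j).smooth Set.inter_subset_right)
    set g : G → ℂ := fun x => l i x (a j x) with hgdef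
    have hgj : g γ * l j γ (a i γ) = 1 := by
      have := (hV j).coord_self γ hγ.2
      rw [(hV i).expand γ hγ.1 (a j γ), map_smul, smul_eq_mul] at this
      exact this
    have hωij : ∀ x ∈ V i ∩ V j, b j x = (g x * g x) • b i x := by
      intro x hx
      simp only [b]
      rw [(hV i).expand x hx.1 (a j x), TensorProduct.smul_tmul_smul, map_smul]
    have hωi := hΛ.mono (hω i).smooth (Set.inter_subset_left (t := V j))
    have hωj := hΛ.mono (hω j).smooth (Set.inter_subset_right (s := V i))
    have h1 : DΛ (b j) γ v = (g γ * g γ) • DΛ (b i) γ v + (2 * g γ * cDeriv g γ (v : CTangent E γ)) • b i γ := by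
      rw [hDΛ.congr hI hωj (hΛ.smul (hg.mul hg) hωi) hωij hγ,
        hDΛ.leibniz _ hI _ _ (hg.mul hg) hωi γ hγ,
        cDeriv_mul (hg.mdifferentiableAt hI hγ) (hg.mdifferentiableAt hI hγ)]
      module
    -- Since `b j = g² b i`, the dual coordinates are related by the factor `g²`.
    have h2 : ∀ y, m i γ y = g γ * g γ * m j γ y := by
      intro y
      conv_lhs => rw [(hω j).expand γ hγ.2 y, map_smul]
      change m j γ y • m i γ (b j γ) = _
      rw [hωij γ hγ, map_smul, (hω i).coord_self γ hγ.1]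
      simp [mul_comm]
    have h3 := h2 (DΛ (b j) γ v)
    rw [h1, map_add, map_smul, map_smul, (hω i).coord_self γ hγ.1, ← h1, smul_eq_mul, smul_eq_mul,
      mul_one] at h3
    simp only [Θ, LinearMap.smulRight_apply, LinearMap.smul_apply, LinearMap.comp_apply]
    conv_lhs => rw [(hV i).expand γ hγ.1 (a j γ)]
    change _ • (g γ • a i γ) = _
    rw [smul_smul, smul_smul, ← add_smul]
    congr 1
    have hg0 : g γ ≠ 0 := left_ne_zero_of_mul_eq_one hgj
    -- Multiplying by `g` turns the relation for `dg/g` into half of `h3`, without division by `g`.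
    refine mul_left_cancel₀ hg0 ?_
    simp only [smul_eq_mul]
    linear_combination - h3 / 2
  have hΘ : ∀ i, ∀ W ⊆ V i, IsOpen W → ∀ X : ∀ γ, P γ, SmoothIn P X W →
      SmoothLine E L (fun γ => Θ i γ (X γ)) W := by
    intro i W hW hWo X hX
    have h1 := hDΛ.smooth W hWo X _ hX (hΛ.mono (hω i).smooth hW)
    have h2 := (smoothFun_const (1 / 2) W).mul ((hω i).smooth_coord W hW hWo _ h1)
    exact sh.smul h2 (sh.mono (hV i).smooth hW)
  have hD := isPConnection_lineConnection sh hV hmem hcompat hΘ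
  have hprop : IsSquareRootConnection (E := E) P L φ DΛ (lineConnection a l Θ) := by
    intro U hU s s' hs hs' γ hγ v
    have hI := hU.inter (hV γ).isOpen
    have hγI : γ ∈ U ∩ V γ := ⟨hγ, hmem γ⟩
    replace hs := sh.mono hs (Set.inter_subset_left (t := V γ))
    replace hs' := sh.mono hs' (Set.inter_subset_left (t := V γ))
    have hf := (hV γ).smooth_coord _ Set.inter_subset_right hI s hs
    have hf' := (hV γ).smooth_coord _ Set.inter_subset_right hI s' hs'
    have hωI := hΛ.mono (hω γ).smooth (Set.inter_subset_right (s := U))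
    have hexp : ∀ x ∈ U ∩ V γ,
        φ x (s x ⊗ₜ[ℂ] s' x) = (l γ x (s x) * l γ x (s' x)) • b γ x := by
      intro x hx
      conv_lhs => rw [(hV γ).expand x hx.2 (s x), (hV γ).expand x hx.2 (s' x),
        TensorProduct.smul_tmul_smul, map_smul]
    rw [hDΛ.congr hI (hφ _ hI _ _ hs hs') (hΛ.smul (hf.mul hf') hωI) hexp hγI,
      hDΛ.leibniz _ hI _ _ (hf.mul hf') hωI γ hγI,
      cDeriv_mul (hf.mdifferentiableAt hI hγI) (hf'.mdifferentiableAt hI hγI),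
      (hω γ).expand γ (hmem γ) (DΛ (b γ) γ v)]
    have hDs : ∀ t : ∀ γ, L γ, lineConnection a l Θ t γ v =
        (l γ γ (t γ) * (1 / 2 * m γ γ (DΛ (b γ) γ v))
          + cDeriv (fun x => l γ x (t x)) γ (v : CTangent E γ)) • a γ γ := by
      intro t
      simp only [lineConnection, LinearMap.add_apply, LinearMap.smul_apply,
        LinearMap.smulRight_apply, LinearMap.comp_apply, Submodule.subtype_apply, Θ, smul_smul,
        ← add_smul, smul_eq_mul]
    rw [hDs, hDs]
    conv_rhs => rw [(hV γ).expand γ (hmem γ) (s γ), (hV γ).expand γ (hmem γ) (s' γ),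
      TensorProduct.smul_tmul_smul, TensorProduct.smul_tmul_smul, ← add_smul, map_smul]
    simp only [map_smul, (hV γ).coord_self γ (hmem γ), smul_eq_mul, mul_one]
    change _ = _ • b γ γ
    rw [smul_smul, ← add_smul]
    congr 1
    ring
  exact ⟨_, hD, hprop.isFlat hΛ hΛf hφ hDΛ hflat hD, hprop, fun D' hD' h' U hU s hs γ hγ =>
    hprop.unique hΛ hΛf hφ hD hD' h' hU hs hγ⟩

end SquareRoots

/-! ### Determinants, wedge products and Jacobi's formula. -/

section Determinants

/-- Each summand is a diagonal entry of the product, by Cramer's rule. The sum is the derivative of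
the determinant at `A` in direction `U`. -/
lemma sum_det_updateCol {n : ℕ} (A U : Matrix (Fin n) (Fin n) ℂ) :
    ∑ i, (A.updateCol i (fun k => U k i)).det = (A.adjugate * U).trace := by
  refine Finset.sum_congr rfl fun i _ => ?_
  rw [← Matrix.cramer_apply, Matrix.cramer_eq_adjugate_mulVec]
  rfl

lemma trace_adjugate_mul_mul {n : ℕ} (A B : Matrix (Fin n) (Fin n) ℂ) :
    (A.adjugate * (B * A)).trace = A.det * B.trace := by
  rw [Matrix.trace_mul_comm, Matrix.mul_assoc, Matrix.mul_adjugate, Matrix.mul_smul, Matrix.mul_one,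
    Matrix.trace_smul, smul_eq_mul]

variable {W : Type*} [AddCommGroup W] [Module ℂ W] {n : ℕ}

lemma dual_eq_sum {θ : Fin n → Module.Dual ℂ W} {w : Fin n → W} (hexp : ∀ q, q = ∑ i, θ i q • w i)
    (η : Module.Dual ℂ W) : η = ∑ j, η (w j) • θ j := by
  refine LinearMap.ext fun q => ?_
  conv_lhs => rw [hexp q, map_sum]
  rw [LinearMap.sum_apply]
  exact Finset.sum_congr rfl fun i _ => by
    rw [map_smul, LinearMap.smul_apply, smul_eq_mul, smul_eq_mul, mul_comm]

lemma sum_dual_apply (η : Fin n → Module.Dual ℂ W) {θ : Fin n → Module.Dual ℂ W} (a b : Fin n → ℂ)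
    {w : Fin n → W} (hdual : ∀ i j, θ i (w j) = if i = j then 1 else 0) (k : Fin n) :
    (∑ j, (a j • η j + b j • θ j)) (w k) = (∑ j, η j (w k) * a j) + b k := by
  rw [LinearMap.sum_apply]
  simp only [LinearMap.add_apply, LinearMap.smul_apply, smul_eq_mul, hdual, mul_ite, mul_one,
    mul_zero, Finset.sum_add_distrib, Finset.sum_ite_eq', Finset.mem_univ, if_true, mul_comm]

lemma wedge_apply (β : Fin n → Module.Dual ℂ W) (w : Fin n → W) :
    wedge β w = Matrix.det (Matrix.of fun k i => β i (w k)) := rfl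

lemma wedge_update_apply (β : Fin n → Module.Dual ℂ W) (i : Fin n) (η : Module.Dual ℂ W)
    (w : Fin n → W) : wedge (Function.update β i η) w =
      ((Matrix.of fun k i => β i (w k)).updateCol i fun k => η (w k)).det := by
  rw [wedge_apply]
  congr 1
  ext k j
  by_cases h : j = i
  · subst h; simp
  · simp [h]

lemma wedge_update_add (β : Fin n → Module.Dual ℂ W) (i : Fin n) (η η' : Module.Dual ℂ W) :
    wedge (Function.update β i (η + η')) =
      wedge (Function.update β i η) + wedge (Function.update β i η') := by
  ext w
  simp only [AlternatingMap.add_apply, wedge_update_apply]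
  exact Matrix.det_updateCol_add _ _ _ _

lemma wedge_update_smul (β : Fin n → Module.Dual ℂ W) (i : Fin n) (z : ℂ) (η : Module.Dual ℂ W) :
    wedge (Function.update β i (z • η)) = z • wedge (Function.update β i η) := by
  ext w
  simp only [AlternatingMap.smul_apply, wedge_update_apply]
  exact Matrix.det_updateCol_smul _ _ _ _

lemma wedge_eq_one {w : Fin n → W} {β : Fin n → Module.Dual ℂ W}
    (hdual : ∀ i j, β i (w j) = if i = j then 1 else 0) : wedge β w = 1 := by
  rw [wedge_apply]
  convert Matrix.det_one (n := Fin n) (R := ℂ) using 2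
  ext k i
  simp [hdual, Matrix.one_apply, eq_comm]

/-- Top-degree forms are multiples of the determinant of the basis `w`, and the wedge of the dual
basis is that determinant. -/
lemma alternatingMap_eq_smul_wedge {w : Fin n → W} {β : Fin n → Module.Dual ℂ W}
    (hdual : ∀ i j, β i (w j) = if i = j then 1 else 0) (hexp : ∀ q, q = ∑ i, β i q • w i)
    (σ : W [⋀^Fin n]→ₗ[ℂ] ℂ) : σ = σ w • wedge β := by
  let b : Module.Basis (Fin n) ℂ W := Module.Basis.ofEquivFun
    { toFun := fun q i => β i q
      map_add' := fun q q' => by ext i; simp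
      map_smul' := fun z q => by ext i; simp
      invFun := fun z => ∑ i, z i • w i
      left_inv := fun q => (hexp q).symm
      right_inv := fun z => by ext i; simp [hdual] }
  have hb : ⇑b = w := by
    funext i
    rw [Module.Basis.coe_ofEquivFun]
    simp [Pi.single_apply, Finset.sum_ite_eq']
  have h2 := (wedge β).eq_smul_basis_det b
  rw [hb, wedge_eq_one hdual, one_smul] at h2
  have h3 := σ.eq_smul_basis_det b
  rw [hb, ← h2] at h3
  exact h3

variable {E : Type*} [NormedAddCommGroup E] [NormedSpace ℝ E]
  {G : Type*} [TopologicalSpace G] [ChartedSpace E G]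

lemma cDeriv_prod {ι : Type*} [DecidableEq ι] {s : Finset ι} {f : ι → G → ℂ} {U : Set G}
    (hU : IsOpen U) (hf : ∀ i ∈ s, SmoothFun E (f i) U) {γ : G} (hγ : γ ∈ U) (u : CTangent E γ) :
    cDeriv (fun x => ∏ i ∈ s, f i x) γ u =
      ∑ i ∈ s, ∏ j ∈ s, Function.update (fun j => f j γ) i (cDeriv (f i) γ u) j := by
  induction s using Finset.induction_on with
  | empty => simp
  | insert a s ha ih =>
    have hs := fun i hi => hf i (Finset.mem_insert_of_mem hi)
    have ha' := hf a (Finset.mem_insert_self a s)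
    simp only [Finset.prod_insert ha]
    rw [cDeriv_mul (ha'.mdifferentiableAt hU hγ) ((SmoothFun.prod hs).mdifferentiableAt hU hγ),
      ih hs, Finset.sum_insert ha, Function.update_self, add_comm]
    congr 1
    · rw [mul_comm]
      congr 1
      refine Finset.prod_congr rfl fun j hj => ?_
      rw [Function.update_of_ne (ne_of_mem_of_not_mem hj ha)]
    · rw [Finset.mul_sum]
      refine Finset.sum_congr rfl fun i hi => ?_
      rw [Function.update_of_ne (ne_of_mem_of_not_mem hi ha).symm]

/-- Jacobi's formula. -/
lemma cDeriv_det {A : G → Matrix (Fin n) (Fin n) ℂ} {U : Set G} (hU : IsOpen U)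
    (hA : ∀ i j, SmoothFun E (fun x => A x i j) U) {γ : G} (hγ : γ ∈ U) (u : CTangent E γ) :
    cDeriv (fun x => (A x).det) γ u =
      ((A γ).adjugate * Matrix.of fun k i => cDeriv (fun x => A x k i) γ u).trace := by
  rw [← sum_det_updateCol]
  simp only [Matrix.det_apply']
  rw [cDeriv_sum hU (fun σ _ => (smoothFun_const _ U).mul (SmoothFun.prod fun i _ => hA _ _)) hγ,
    Finset.sum_comm]
  refine Finset.sum_congr rfl fun σ _ => ?_
  rw [cDeriv_const_mul _ ((SmoothFun.prod fun i _ => hA _ _).mdifferentiableAt hU hγ),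
    cDeriv_prod hU (fun i _ => hA _ _) hγ, Finset.mul_sum]
  refine Finset.sum_congr rfl fun i _ => ?_
  congr 1
  refine Finset.prod_congr rfl fun j _ => ?_
  by_cases h : j = i
  · subst h; simp
  · simp [h]

end Determinants

/-! ### The connection on the top exterior power. -/

section WedgeConnection

variable {E : Type*} [NormedAddCommGroup E] [NormedSpace ℝ E]
  {G : Type*} [TopologicalSpace G] [ChartedSpace E G] [IsManifold 𝓘(ℝ, E) ∞ G]
  {T S P : ∀ γ : G, Submodule ℂ (CTangent E γ)} {n : ℕ}

/-- The element of `T / (T ∩ P) ⊕ S / (S ∩ P)` represented by elements of `T` and `S`. -/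
def sumMk (P : ∀ γ : G, Submodule ℂ (CTangent E γ)) {γ : G} (A : T γ) (B : S γ) :
    SumQuot T S P γ := (relMk T P γ A, relMk S P γ B)

/-- A local frame of `T / (T ∩ P) ⊕ S / (S ∩ P)`, represented by sections of `T` and `S`, and its
dual frame. -/
structure IsSumFrame (T S P : ∀ γ : G, Submodule ℂ (CTangent E γ)) {n : ℕ} (V : Set G)
    (A : Fin n → ∀ γ : G, T γ) (B : Fin n → ∀ γ : G, S γ)
    (β : Fin n → ∀ γ : G, Module.Dual ℂ (SumQuot T S P γ)) : Prop where
  isOpen : IsOpen V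
  smooth_left : ∀ i, SmoothIn T (A i) V
  smooth_right : ∀ i, SmoothIn S (B i) V
  smooth_dual : ∀ i, SmoothSumDual T S P (β i) V
  dual : ∀ γ ∈ V, ∀ i j, β i γ (sumMk P (A j γ) (B j γ)) = if i = j then 1 else 0
  expand : ∀ γ ∈ V, ∀ q, q = ∑ i, β i γ q • sumMk P (A i γ) (B i γ)

lemma SmoothSumDual.eval {β : ∀ γ : G, Module.Dual ℂ (SumQuot T S P γ)} {U W : Set G}
    (h : SmoothSumDual T S P β U) (hW : W ⊆ U) (hWo : IsOpen W) {A : ∀ γ : G, T γ}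
    {B : ∀ γ : G, S γ} (hA : SmoothIn T A W) (hB : SmoothIn S B W) :
    SmoothFun E (fun γ => β γ (sumMk P (A γ) (B γ))) W := by
  refine ((h.1 W hW hWo A hA).add (h.2 W hW hWo B hB)).congr fun γ hγ => ?_
  rw [LinearMap.comp_apply, LinearMap.comp_apply, ← map_add]
  simp [sumMk]

lemma smoothForm_wedge {β : Fin n → ∀ γ : G, Module.Dual ℂ (SumQuot T S P γ)} {U : Set G}
    (h : ∀ i, SmoothSumDual T S P (β i) U) :
    SmoothForm n T S P (fun γ => wedge fun i => β i γ) U :=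
  fun _ hW hWo _ _ hA hB => SmoothFun.det fun k i => (h i).eval hW hWo (hA k) (hB k)

variable {V : Set G} {A : Fin n → ∀ γ : G, T γ} {B : Fin n → ∀ γ : G, S γ}
  {β : Fin n → ∀ γ : G, Module.Dual ℂ (SumQuot T S P γ)}

lemma IsSumFrame.isLineFrame (h : IsSumFrame T S P V A B β) :
    IsLineFrame E (SmoothForm n T S P) V (fun γ => wedge fun i => β i γ)
      (fun γ => altEval fun j => sumMk P (A j γ) (B j γ)) := by
  refine ⟨h.isOpen, smoothForm_wedge h.smooth_dual, fun γ hγ => wedge_eq_one (h.dual γ hγ),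
    fun γ hγ σ =>
    alternatingMap_eq_smul_wedge (h.dual γ hγ) (h.expand γ hγ) σ, fun W hW hWo σ hσ =>
    hσ W subset_rfl hWo A B (fun i => (h.smooth_left i).mono hW) fun i => (h.smooth_right i).mono hW⟩

/-- The derivation `∑ᵢ β₁ ∧ ⋯ ∧ ∇βᵢ ∧ ⋯ ∧ βₙ`. -/
def wedgeDerivation (D : (∀ γ : G, Module.Dual ℂ (SumQuot T S P γ)) →
      ∀ γ : G, P γ →ₗ[ℂ] Module.Dual ℂ (SumQuot T S P γ))
    (β : Fin n → ∀ γ : G, Module.Dual ℂ (SumQuot T S P γ)) (γ : G) :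
    P γ →ₗ[ℂ] FormBundle n T S P γ where
  toFun v := ∑ i, wedge (Function.update (fun j => β j γ) i (D (β i) γ v))
  map_add' v v' := by simp only [map_add, wedge_update_add, Finset.sum_add_distrib]
  map_smul' z v := by simp only [map_smul, wedge_update_smul, Finset.smul_sum, RingHom.id_apply]

variable {D : (∀ γ : G, Module.Dual ℂ (SumQuot T S P γ)) →
  ∀ γ : G, P γ →ₗ[ℂ] Module.Dual ℂ (SumQuot T S P γ)}

lemma wedgeDerivation_apply (β : Fin n → ∀ γ : G, Module.Dual ℂ (SumQuot T S P γ)) (γ : G)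
    (v : P γ) : wedgeDerivation D β γ v =
      ∑ i, wedge (Function.update (fun j => β j γ) i (D (β i) γ v)) := rfl

lemma wedgeDerivation_eval (β : Fin n → ∀ γ : G, Module.Dual ℂ (SumQuot T S P γ)) (γ : G)
    (v : P γ) (w : Fin n → SumQuot T S P γ) : wedgeDerivation D β γ v w =
      ((Matrix.of fun k i => β i γ (w k)).adjugate *
        Matrix.of fun k i => D (β i) γ v (w k)).trace := by
  rw [wedgeDerivation_apply, ← sum_det_updateCol]
  exact (map_sum (altEval w) _ _).trans
    (Finset.sum_congr rfl fun i _ => wedge_update_apply _ _ _ _)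

/-- The derivation of a product of covectors in terms of a frame. -/
lemma IsSumFrame.wedgeDerivation_eq (h : IsSumFrame T S P V A B β)
    (hD : IsPConnection P (SmoothSumDual T S P) D) {U : Set G} (hU : IsOpen U)
    {β' : Fin n → ∀ γ : G, Module.Dual ℂ (SumQuot T S P γ)}
    (hβ' : ∀ i, SmoothSumDual T S P (β' i) U) {γ : G} (hγ : γ ∈ U) (hγV : γ ∈ V) (v : P γ) :
    wedgeDerivation D β' γ v =
      (wedge (fun i => β' i γ) fun j => sumMk P (A j γ) (B j γ)) • wedgeDerivation D β γ v
      + cDeriv (fun x => wedge (fun i => β' i x) fun j => sumMk P (A j x) (B j x)) γ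
          (v : CTangent E γ) • wedge (fun i => β i γ) := by
  have sh := isSectionSheaf_sumDual (E := E) T S P
  have hI := hU.inter h.isOpen
  have hγI : γ ∈ U ∩ V := ⟨hγ, hγV⟩
  let g : G → Matrix (Fin n) (Fin n) ℂ := fun x =>
    Matrix.of fun k i => β' i x (sumMk P (A k x) (B k x))
  have hg : ∀ k i, SmoothFun E (fun x => g x k i) (U ∩ V) := fun k i =>
    (hβ' i).eval Set.inter_subset_left hI ((h.smooth_left k).mono Set.inter_subset_right)
      ((h.smooth_right k).mono Set.inter_subset_right)
  let C : Matrix (Fin n) (Fin n) ℂ := Matrix.of fun k j => D (β j) γ v (sumMk P (A k γ) (B k γ))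
  have hexp : ∀ i, ∀ x ∈ V, β' i x = ∑ j, g x j i • β j x := by
    intro i x hx
    exact dual_eq_sum (h.expand x hx) (β' i x)
  have hβI := fun j => sh.mono (h.smooth_dual j) (Set.inter_subset_right (s := U))
  have hDβ' : ∀ i, D (β' i) γ v =
      ∑ j, (g γ j i • D (β j) γ v + cDeriv (E := E) (fun x => g x j i) γ (v : CTangent E γ) • β j γ) := by
    intro i
    rw [hD.congr hI (sh.mono (hβ' i) Set.inter_subset_left)
      (sh.sum fun j _ => sh.smul (hg j i) (hβI j)) (fun x hx => hexp i x hx.2) hγI,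
      hD.map_sum sh hI (fun j _ => sh.smul (hg j i) (hβI j)) hγI, LinearMap.sum_apply]
    exact Finset.sum_congr rfl fun j _ => hD.leibniz _ hI _ _ (hg j i) (hβI j) γ hγI v
  -- With `β' = β g`, the derivatives of `β'` have the matrix `C g + dg` in the frame, where `C` is
  -- the connection matrix of `β`.
  have h1 : (Matrix.of fun k i => D (β' i) γ v (sumMk P (A k γ) (B k γ))) =
      C * g γ + Matrix.of fun k i => cDeriv (E := E) (fun x => g x k i) γ (v : CTangent E γ) := by
    ext k i
    change D (β' i) γ v (sumMk P (A k γ) (B k γ)) = (C * g γ) k i +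
      cDeriv (E := E) (fun x => g x k i) γ (v : CTangent E γ)
    have h4 := sum_dual_apply (W := SumQuot T S P γ) (fun j => D (β j) γ v) (fun j => g γ j i)
      (θ := fun j => β j γ) (fun j => cDeriv (E := E) (fun x => g x j i) γ (v : CTangent E γ))
      (w := fun k => sumMk P (A k γ) (B k γ)) (h.dual γ hγV) k
    rw [hDβ' i, Matrix.mul_apply]
    exact h4
  have h2 : wedgeDerivation D β γ v (fun j => sumMk P (A j γ) (B j γ)) = C.trace := by
    rw [wedgeDerivation_eval]
    have : (Matrix.of fun k i => β i γ (sumMk P (A k γ) (B k γ))) = 1 := by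
      ext k i
      simp [h.dual γ hγV, Matrix.one_apply, eq_comm]
    rw [this, Matrix.adjugate_one, Matrix.one_mul]
  -- `tr(adj(g) (C g + dg)) = det g · tr C + d(det g)`, by cyclicity of the trace and Jacobi's
  -- formula.
  have h3 : wedgeDerivation D β' γ v (fun j => sumMk P (A j γ) (B j γ)) =
      (g γ).det * C.trace + cDeriv (fun x => (g x).det) γ (v : CTangent E γ) := by
    rw [wedgeDerivation_eval, h1, Matrix.mul_add, Matrix.trace_add]
    change ((g γ).adjugate * (C * g γ)).trace + _ = _
    rw [trace_adjugate_mul_mul, cDeriv_det hI hg hγI]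
  rw [alternatingMap_eq_smul_wedge (h.dual γ hγV) (h.expand γ hγV) (wedgeDerivation D β' γ v), h3,
    alternatingMap_eq_smul_wedge (h.dual γ hγV) (h.expand γ hγV) (wedgeDerivation D β γ v), h2,
    smul_smul, ← add_smul]
  rfl

lemma update_section (β : Fin n → ∀ γ : G, Module.Dual ℂ (SumQuot T S P γ)) (i : Fin n)
    (η : ∀ γ : G, Module.Dual ℂ (SumQuot T S P γ)) (x : G) :
    (fun j => Function.update β i η j x) = Function.update (fun j => β j x) i (η x) := by
  funext j
  by_cases h : j = i
  · subst h; simp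
  · simp [h]

lemma IsPConnection.smoothForm_wedgeDerivation (hD : IsPConnection P (SmoothSumDual T S P) D)
    {U : Set G} (hU : IsOpen U) (hβ : ∀ i, SmoothSumDual T S P (β i) U) {X : ∀ γ, P γ}
    (hX : SmoothIn P X U) (i : Fin n) :
    SmoothForm n T S P (fun x => wedge (Function.update (fun j => β j x) i (D (β i) x (X x)))) U := by
  have h1 : ∀ j, SmoothSumDual T S P
      (Function.update β i (fun x => D (β i) x (X x)) j) U := by
    intro j
    by_cases h : j = i
    · subst h
      rw [Function.update_self]
      exact hD.smooth U hU X _ hX (hβ j)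
    · rw [Function.update_of_ne h]
      exact hβ j
  have h2 := smoothForm_wedge h1
  simp only [update_section] at h2
  exact h2

variable [FiniteDimensional ℝ E]

/-- A second derivative of `β₁ ∧ ⋯ ∧ βₙ` hits one factor twice or two different factors once each.
The terms of the second kind are symmetric in the directions and cancel; those of the first kind
give the curvature of `D`, which is zero. -/
lemma isFlat_of_wedge
    (hframe : ∀ γ : G, ∃ (V : Set G) (A : Fin n → ∀ γ : G, T γ) (B : Fin n → ∀ γ : G, S γ)
      (β : Fin n → ∀ γ : G, Module.Dual ℂ (SumQuot T S P γ)), γ ∈ V ∧ IsSumFrame T S P V A B β)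
    (hD : IsPConnection P (SmoothSumDual T S P) D) (hflat : IsFlat P (SmoothSumDual T S P) D)
    {DΩ : (∀ γ : G, FormBundle n T S P γ) → ∀ γ : G, P γ →ₗ[ℂ] FormBundle n T S P γ}
    (hDΩ : IsPConnection P (SmoothForm n T S P) DΩ)
    (hprop : ∀ U : Set G, IsOpen U → ∀ β : Fin n → ∀ γ : G, Module.Dual ℂ (SumQuot T S P γ),
        (∀ i, SmoothSumDual T S P (β i) U) → ∀ γ ∈ U, ∀ v : P γ,
          DΩ (fun x => wedge (fun i => β i x)) γ v = wedgeDerivation D β γ v) :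
    IsFlat P (SmoothForm n T S P) DΩ := by
  have sh := isSectionSheaf_form (E := E) T S P n
  refine isFlat_of_lineFrames hDΩ sh fun γ₀ => ?_
  obtain ⟨V, A, B, β, hγ₀, hV⟩ := hframe γ₀
  refine ⟨_, _, _, hγ₀, hV.isLineFrame, ?_⟩
  intro W hW hWo X Y Z hX hY hZ γ hγ
  have shD := isSectionSheaf_sumDual (E := E) T S P
  have hβ := fun k => shD.mono (hV.smooth_dual k) hW
  have key : ∀ {M N : ∀ γ, P γ}, SmoothIn P N W →
      DΩ (fun x => DΩ (fun x => wedge fun i => β i x) x (N x)) γ (M γ) =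
        ∑ i, (wedge (Function.update (fun j => β j γ) i
            (D (fun x => D (β i) x (N x)) γ (M γ)))
          + ∑ j ∈ Finset.univ.erase i, wedge (Function.update
            (Function.update (fun k => β k γ) i (D (β i) γ (N γ))) j (D (β j) γ (M γ)))) := by
    intro M N hN
    have h1 := fun i => hD.smoothForm_wedgeDerivation hWo hβ hN i
    have h0 : ∀ x ∈ W, DΩ (fun x => wedge fun i => β i x) x (N x) =
        ∑ i, wedge (Function.update (fun j => β j x) i (D (β i) x (N x))) := fun x hx =>
      (hprop W hWo β hβ x hx (N x)).trans (wedgeDerivation_apply β x (N x))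
    rw [hDΩ.congr hWo (hDΩ.smooth W hWo N _ hN (smoothForm_wedge hβ)) (sh.sum fun i _ => h1 i)
      h0 hγ, hDΩ.map_sum sh hWo (fun i _ => h1 i) hγ,
      LinearMap.sum_apply]
    refine Finset.sum_congr rfl fun i _ => ?_
    let η : Fin n → ∀ γ : G, Module.Dual ℂ (SumQuot T S P γ) :=
      Function.update β i (fun x => D (β i) x (N x))
    have hη : ∀ j, SmoothSumDual T S P (η j) W := by
      intro j
      by_cases h : j = i
      · subst h
        simp only [η, Function.update_self]
        exact hD.smooth W hWo N _ hN (hβ j)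
      · simp only [η, Function.update_of_ne h]
        exact hβ j
    have h2 := hprop W hWo η hη γ hγ (M γ)
    rw [wedgeDerivation_apply, ← Finset.add_sum_erase _ _ (Finset.mem_univ i)] at h2
    simp only [η, update_section, Function.update_self, Function.update_idem] at h2
    rw [h2]
    congr 1
    refine Finset.sum_congr rfl fun j hj => ?_
    rw [Function.update_of_ne (Finset.ne_of_mem_erase hj)]
  rw [key hX, key hY, hprop W hWo β hβ γ hγ, wedgeDerivation_apply, Finset.sum_add_distrib,
    Finset.sum_add_distrib]
  -- Interchange the two summation indices; updates at distinct positions commute.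
  have hsymm : (∑ i, ∑ j ∈ Finset.univ.erase i, wedge (Function.update
        (Function.update (fun k => β k γ) i (D (β i) γ (Y γ))) j (D (β j) γ (X γ)))) =
      ∑ i, ∑ j ∈ Finset.univ.erase i, wedge (Function.update
        (Function.update (fun k => β k γ) i (D (β i) γ (X γ))) j (D (β j) γ (Y γ))) := by
    rw [Finset.sum_comm' (t' := Finset.univ) (s' := fun i => Finset.univ.erase i)
      (by simp [eq_comm])]
    refine Finset.sum_congr rfl fun i _ => Finset.sum_congr rfl fun j hj => ?_
    rw [Function.update_comm (Finset.ne_of_mem_erase hj)]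
  rw [hsymm, add_sub_add_right_eq_sub, ← Finset.sum_sub_distrib]
  refine Finset.sum_congr rfl fun i _ => ?_
  rw [← hflat W hWo X Y Z hX hY hZ (β i) (hβ i) γ hγ, sub_eq_add_neg, sub_eq_add_neg,
    wedge_update_add, ← neg_one_smul ℂ (D (fun x => D (β i) x (X x)) γ (Y γ)), wedge_update_smul,
    neg_one_smul]

/-- `IsSumFrame.wedgeDerivation_eq` serves twice: for another frame it is the gluing condition, and
for arbitrary covectors it is the required product rule. -/
theorem exists_isTheFlatConnection_wedge
    (hframe : ∀ γ : G, ∃ (V : Set G) (A : Fin n → ∀ γ : G, T γ) (B : Fin n → ∀ γ : G, S γ)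
      (β : Fin n → ∀ γ : G, Module.Dual ℂ (SumQuot T S P γ)), γ ∈ V ∧ IsSumFrame T S P V A B β)
    (hD : IsPConnection P (SmoothSumDual T S P) D) (hflat : IsFlat P (SmoothSumDual T S P) D) :
    ∃ DΩ, IsTheFlatConnection P (SmoothForm n T S P)
      (fun DΩ => ∀ U : Set G, IsOpen U → ∀ β : Fin n → ∀ γ : G, Module.Dual ℂ (SumQuot T S P γ),
        (∀ i, SmoothSumDual T S P (β i) U) → ∀ γ ∈ U, ∀ v : P γ,
          DΩ (fun x => wedge (fun i => β i x)) γ v = wedgeDerivation D β γ v) DΩ := by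
  have sh := isSectionSheaf_form (E := E) T S P n
  have hframe' := hframe
  choose V A B β hmem hV using hframe
  have hL := fun i => (hV i).isLineFrame
  have hcompat := fun (i j : G) (γ : G) (hγ : γ ∈ V i ∩ V j) (v : P γ) =>
    (hV i).wedgeDerivation_eq hD (hV j).isOpen (hV j).smooth_dual hγ.2 hγ.1 v
  have hΘ : ∀ i, ∀ W ⊆ V i, IsOpen W → ∀ X : ∀ γ, P γ, SmoothIn P X W →
      SmoothForm n T S P (fun γ => wedgeDerivation D (β i) γ (X γ)) W := fun i W hW hWo X hX =>
    sh.sum fun j _ => hD.smoothForm_wedgeDerivation hWo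
      (fun k => (isSectionSheaf_sumDual T S P).mono ((hV i).smooth_dual k) hW) hX j
  have hDΩ := isPConnection_lineConnection sh hL hmem hcompat hΘ
  have hprop := fun (U : Set G) (hU : IsOpen U)
      (β' : Fin n → ∀ γ : G, Module.Dual ℂ (SumQuot T S P γ))
      (hβ' : ∀ i, SmoothSumDual T S P (β' i) U) (γ : G) (hγ : γ ∈ U) (v : P γ) =>
    (lineConnection_apply sh hL hmem hcompat γ hU (smoothForm_wedge hβ') hγ (hmem γ) v).trans
      ((hV γ).wedgeDerivation_eq hD hU hβ' hγ (hmem γ) v).symm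
  refine ⟨_, hDΩ, isFlat_of_wedge hframe' hD hflat hDΩ hprop, hprop, ?_⟩
  intro D' hD' h' U hU σ hσ γ hγ
  refine hDΩ.eq_of_lineFrame hD' sh (hL γ) (fun x hx => LinearMap.ext fun v => ?_) hU hσ hγ
    (hmem γ)
  rw [h' _ (hV γ).isOpen _ (hV γ).smooth_dual x hx v,
    hprop _ (hV γ).isOpen _ (hV γ).smooth_dual x hx v]

end WedgeConnection

/-! ### Local frames of the direct sum of the two quotients. -/

section SumFrames

section Products

variable {W₁ W₂ : Type*} [AddCommGroup W₁] [Module ℂ W₁] [AddCommGroup W₂] [Module ℂ W₂]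
  {m₁ m₂ : ℕ}

/-- The vectors of a frame of a direct sum. -/
def prodFrame (w₁ : Fin m₁ → W₁) (w₂ : Fin m₂ → W₂) : Fin m₁ ⊕ Fin m₂ → W₁ × W₂ :=
  Sum.elim (fun i => (w₁ i, 0)) (fun i => (0, w₂ i))

/-- The covectors of the dual frame of a direct sum. -/
def prodDualFrame (θ₁ : Fin m₁ → Module.Dual ℂ W₁) (θ₂ : Fin m₂ → Module.Dual ℂ W₂) :
    Fin m₁ ⊕ Fin m₂ → Module.Dual ℂ (W₁ × W₂) :=
  Sum.elim (fun i => (θ₁ i).comp (LinearMap.fst ℂ W₁ W₂))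
    (fun i => (θ₂ i).comp (LinearMap.snd ℂ W₁ W₂))

variable {w₁ : Fin m₁ → W₁} {w₂ : Fin m₂ → W₂} {θ₁ : Fin m₁ → Module.Dual ℂ W₁}
  {θ₂ : Fin m₂ → Module.Dual ℂ W₂}

lemma prodFrame_dual (h₁ : ∀ i j, θ₁ i (w₁ j) = if i = j then 1 else 0)
    (h₂ : ∀ i j, θ₂ i (w₂ j) = if i = j then 1 else 0) (s s' : Fin m₁ ⊕ Fin m₂) :
    prodDualFrame θ₁ θ₂ s (prodFrame w₁ w₂ s') = if s = s' then 1 else 0 := by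
  rcases s with i | i <;> rcases s' with j | j <;> simp [prodDualFrame, prodFrame, h₁, h₂]

lemma prodFrame_expand (h₁ : ∀ q, q = ∑ i, θ₁ i q • w₁ i) (h₂ : ∀ q, q = ∑ i, θ₂ i q • w₂ i)
    (q : W₁ × W₂) : q = ∑ s, prodDualFrame θ₁ θ₂ s q • prodFrame w₁ w₂ s := by
  rw [Fintype.sum_sum_type]
  refine Prod.ext ?_ ?_
  · conv_lhs => rw [h₁ q.1]
    simp [prodDualFrame, prodFrame, Prod.fst_sum]
  · conv_lhs => rw [h₂ q.2]
    simp [prodDualFrame, prodFrame, Prod.snd_sum]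

variable (θ₁ θ₂) in
lemma prodDualFrame_inl_comp_inr (i : Fin m₁) :
    (prodDualFrame θ₁ θ₂ (.inl i)).comp (LinearMap.inr ℂ W₁ W₂) = 0 :=
  LinearMap.ext fun _ => map_zero (θ₁ i)

variable (θ₁ θ₂) in
lemma prodDualFrame_inr_comp_inl (i : Fin m₂) :
    (prodDualFrame θ₁ θ₂ (.inr i)).comp (LinearMap.inl ℂ W₁ W₂) = 0 :=
  LinearMap.ext fun _ => map_zero (θ₂ i)

end Products

variable {E : Type*} [NormedAddCommGroup E] [NormedSpace ℝ E] [FiniteDimensional ℝ E]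
  {G : Type*} [TopologicalSpace G] [ChartedSpace E G] [IsManifold 𝓘(ℝ, E) ∞ G]
  {T S P : ∀ γ : G, Submodule ℂ (CTangent E γ)}

open Classical in
lemma exists_relFrame (hP : IsDistribution P) (hT : IsDistribution T) {k t : ℕ}
    (hk : ∀ γ, Module.finrank ℂ ↥(T γ ⊓ P γ) = k) (ht : ∀ γ, Module.finrank ℂ (T γ) = t) (γ₀ : G) :
    ∃ (N : Set G) (A : Fin (t - k) → ∀ γ : G, T γ)
      (θ : Fin (t - k) → ∀ γ : G, Module.Dual ℂ (RelQuot T P γ)), γ₀ ∈ N ∧ IsOpen N ∧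
      (∀ i, SmoothIn T (A i) N) ∧ (∀ i, SmoothRelDual T P (θ i) N) ∧
      (∀ γ ∈ N, ∀ i j, θ i γ (relMk T P γ (A j γ)) = if i = j then 1 else 0) ∧
      ∀ γ ∈ N, ∀ q, q = ∑ i, θ i γ q • relMk T P γ (A i γ) := by
  obtain ⟨r, m, l, N, e, c, hγN, he⟩ := exists_adaptedFrame hP hT hk γ₀
  have hm : m = t - k := by
    have := he.finrank_eq γ₀ hγN
    rw [hk, ht] at this
    omega
  -- The length of the middle block depends a priori on `γ₀`; the rank identity makes it the same
  -- number at all points, so that one degree `n` serves everywhere.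
  subst hm
  have hc : ∀ i, ∀ γ ∈ N, c (.inr (.inl i)) γ ∈ Conormal P γ := fun i γ hγ =>
    (Submodule.mem_dualAnnihilator _).2 fun u hu => (he.mem_left_iff γ hγ u).1 hu (.inl i)
  let θ : Fin (t - k) → ∀ γ : G, Module.Dual ℂ (RelQuot T P γ) := fun i γ =>
    conormalRestrict T P γ (if h : γ ∈ N then ⟨_, hc i γ h⟩ else 0)
  have hθ : ∀ i, ∀ γ ∈ N, ∀ v : T γ, θ i γ (relMk T P γ v) = c (.inr (.inl i)) γ v := by
    intro i γ hγ v
    simp only [θ, dif_pos hγ]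
    rfl
  refine ⟨N, he.field, θ, hγN, he.isFrame.isOpen, he.smoothIn_field, ?_, ?_, ?_⟩
  · intro i W hW hWo Y hY
    exact (he.isFrame.smooth_coframe (.inr (.inl i)) W hW hWo _ hY).congr fun γ hγ =>
      hθ i γ (hW hγ) _
  · intro γ hγ i j
    rw [hθ i γ hγ]
    refine (he.isFrame.dual γ hγ _ _).trans ?_
    simp
  · intro γ hγ q
    obtain ⟨v, rfl⟩ := Submodule.Quotient.mk_surjective _ q
    refine (he.relMk_eq hγ v).trans (Finset.sum_congr rfl fun i _ => ?_)
    rw [← hθ i γ hγ v]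

/-- Frames of the two quotients are padded by zero sections and indexed together through `Fin n ≃
Fin (t - k) ⊕ Fin (t - k)`. -/
lemma exists_sumFrame (hP : IsDistribution P) (hT : IsDistribution T) (hS : IsDistribution S)
    {k t n : ℕ} (hkT : ∀ γ, Module.finrank ℂ ↥(T γ ⊓ P γ) = k)
    (hkS : ∀ γ, Module.finrank ℂ ↥(S γ ⊓ P γ) = k) (htT : ∀ γ, Module.finrank ℂ (T γ) = t)
    (htS : ∀ γ, Module.finrank ℂ (S γ) = t) (hn : n = 2 * (t - k)) (γ₀ : G) :
    ∃ (V : Set G) (A : Fin n → ∀ γ : G, T γ) (B : Fin n → ∀ γ : G, S γ)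
      (β : Fin n → ∀ γ : G, Module.Dual ℂ (SumQuot T S P γ)),
      γ₀ ∈ V ∧ IsSumFrame T S P V A B β := by
  obtain ⟨N₁, A₁, θ₁, h₁, ho₁, hA₁, hθ₁, hd₁, hx₁⟩ := exists_relFrame hP hT hkT htT γ₀
  obtain ⟨N₂, A₂, θ₂, h₂, ho₂, hA₂, hθ₂, hd₂, hx₂⟩ := exists_relFrame hP hS hkS htS γ₀
  let σ : Fin n ≃ Fin (t - k) ⊕ Fin (t - k) :=
    (finCongr (by omega : n = (t - k) + (t - k))).trans finSumFinEquiv.symm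
  let A : Fin (t - k) ⊕ Fin (t - k) → ∀ γ : G, T γ := Sum.elim A₁ fun _ _ => 0
  let B : Fin (t - k) ⊕ Fin (t - k) → ∀ γ : G, S γ := Sum.elim (fun _ _ => 0) A₂
  have hAB : ∀ s γ, sumMk P (A s γ) (B s γ) =
      prodFrame (fun i => relMk T P γ (A₁ i γ)) (fun i => relMk S P γ (A₂ i γ)) s := by
    rintro (i | i) γ <;> rfl
  let β : Fin (t - k) ⊕ Fin (t - k) → ∀ γ : G, Module.Dual ℂ (SumQuot T S P γ) := fun s γ =>
    prodDualFrame (fun i => θ₁ i γ) (fun i => θ₂ i γ) s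
  refine ⟨N₁ ∩ N₂, fun i => A (σ i), fun i => B (σ i), fun i => β (σ i), ⟨h₁, h₂⟩,
    ho₁.inter ho₂, ?_, ?_, ?_, ?_, ?_⟩
  · intro i
    rcases σ i with j | j
    · exact SmoothField.mono (hA₁ j) Set.inter_subset_left
    · exact SmoothField.zero _
  · intro i
    rcases σ i with j | j
    · exact SmoothField.zero _
    · exact SmoothField.mono (hA₂ j) Set.inter_subset_right
  · intro i
    have sT := isSectionSheaf_relDual (E := E) T P
    have sS := isSectionSheaf_relDual (E := E) S P
    rcases σ i with j | j
    · refine ⟨sT.mono (hθ₁ j) Set.inter_subset_left, sS.congr (sS.zero _) fun γ _ => ?_⟩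
      exact prodDualFrame_inl_comp_inr _ _ j
    · refine ⟨sT.congr (sT.zero _) fun γ _ => ?_, sS.mono (hθ₂ j) Set.inter_subset_right⟩
      exact prodDualFrame_inr_comp_inl _ _ j
  · intro γ hγ i j
    rw [hAB]
    refine (prodFrame_dual (hd₁ γ hγ.1) (hd₂ γ hγ.2) (σ i) (σ j)).trans ?_
    simp only [σ.injective.eq_iff]
  · intro γ hγ q
    refine (prodFrame_expand (hx₁ γ hγ.1) (hx₂ γ hγ.2) q).trans ?_
    refine (σ.sum_comp _).symm.trans (Finset.sum_congr rfl fun i _ => ?_)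
    rw [hAB]

end SumFrames

end HalfForms

end

/-! ### Assembly of the theorem. -/

theorem mainTheorem10
    {E : Type*} [NormedAddCommGroup E] [NormedSpace ℝ E] [FiniteDimensional ℝ E]
    {F : Type*} [NormedAddCommGroup F] [NormedSpace ℝ F] [FiniteDimensional ℝ F]
    {G : Type*} [TopologicalSpace G] [ChartedSpace E G] [IsManifold 𝓘(ℝ, E) ∞ G]
    {M : Type*} [TopologicalSpace M] [ChartedSpace F M] [IsManifold 𝓘(ℝ, F) ∞ M]
    (𝒢 : HalfForms.LieGroupoid E F G M)
    (P : ∀ γ : G, Submodule ℂ (HalfForms.CTangent E γ)) (hP : 𝒢.IsPolarization P)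
    (k : ℕ) (hk : ∀ γ : G, Module.finrank ℂ ↥(𝒢.tgtTangent γ ⊓ P γ) = k)
    (n : ℕ) (hn : n = 2 * (Module.finrank ℝ E - Module.finrank ℝ F - k)) :
    HalfForms.IsInvolutive (fun γ => P γ ⊔ 𝒢.tgtTangent γ) ∧
    HalfForms.IsInvolutive (fun γ => P γ ⊔ 𝒢.srcTangent γ) ∧
    (∀ γ : G, Module.finrank ℂ (HalfForms.SumQuot 𝒢.tgtTangent 𝒢.srcTangent P γ) = n) ∧
    ∃ (DB : (∀ γ : G, HalfForms.Conormal P γ) → ∀ γ : G, P γ →ₗ[ℂ] HalfForms.Conormal P γ)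
      (DT : (∀ γ : G, Module.Dual ℂ (HalfForms.RelQuot 𝒢.tgtTangent P γ)) →
        ∀ γ : G, P γ →ₗ[ℂ] Module.Dual ℂ (HalfForms.RelQuot 𝒢.tgtTangent P γ))
      (DS : (∀ γ : G, Module.Dual ℂ (HalfForms.RelQuot 𝒢.srcTangent P γ)) →
        ∀ γ : G, P γ →ₗ[ℂ] Module.Dual ℂ (HalfForms.RelQuot 𝒢.srcTangent P γ))
      (DΩ : (∀ γ : G, HalfForms.FormBundle n 𝒢.tgtTangent 𝒢.srcTangent P γ) →
        ∀ γ : G, P γ →ₗ[ℂ] HalfForms.FormBundle n 𝒢.tgtTangent 𝒢.srcTangent P γ),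
      HalfForms.IsTheFlatConnection P (HalfForms.SmoothConormal P) (HalfForms.IsBott P) DB ∧
      HalfForms.PreservesAnnihilator P (fun γ => P γ ⊔ 𝒢.tgtTangent γ) DB ∧
      HalfForms.PreservesAnnihilator P (fun γ => P γ ⊔ 𝒢.srcTangent γ) DB ∧
      HalfForms.IsTheFlatConnection P (HalfForms.SmoothRelDual 𝒢.tgtTangent P)
        (HalfForms.IsInduced 𝒢.tgtTangent P DB) DT ∧
      HalfForms.IsTheFlatConnection P (HalfForms.SmoothRelDual 𝒢.srcTangent P)
        (HalfForms.IsInduced 𝒢.srcTangent P DB) DS ∧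
      HalfForms.IsTheFlatConnection P
        (HalfForms.SmoothForm n 𝒢.tgtTangent 𝒢.srcTangent P)
        (HalfForms.IsWedgeInduced n 𝒢.tgtTangent 𝒢.srcTangent P DT DS) DΩ ∧
      ∀ (L : G → Type uL) [TopologicalSpace (Bundle.TotalSpace ℂ L)]
        [∀ γ, TopologicalSpace (L γ)] [∀ γ, AddCommGroup (L γ)] [∀ γ, Module ℂ (L γ)]
        [FiberBundle ℂ L] [VectorBundle ℂ ℂ L] [VectorBundle ℝ ℂ L]
        [ContMDiffVectorBundle ∞ ℂ L 𝓘(ℝ, E)]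
        (φ : ∀ γ, TensorProduct ℂ (L γ) (L γ) ≃ₗ[ℂ]
          HalfForms.FormBundle n 𝒢.tgtTangent 𝒢.srcTangent P γ),
        HalfForms.IsSmoothSquare E L
          (HalfForms.SmoothForm n 𝒢.tgtTangent 𝒢.srcTangent P) φ →
        ∃ DL : (∀ γ, L γ) → ∀ γ, P γ →ₗ[ℂ] L γ,
          HalfForms.IsTheFlatConnection P (HalfForms.SmoothLine E L)
            (HalfForms.IsSquareRootConnection P L φ DΩ) DL := by
  have hPd := hP.involutive.isDistribution
  have hTd : HalfForms.IsDistribution 𝒢.tgtTangent := HalfForms.isDistribution_ker 𝒢.submersion_tgt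
  have hSd : HalfForms.IsDistribution 𝒢.srcTangent := HalfForms.isDistribution_ker 𝒢.submersion_src
  -- This is the only use of the Hermitian condition: the rank hypothesis on the target side carries
  -- over to the source side.
  have hkS := hP.hermitian.finrank_srcTangent hk
  have htT : ∀ γ, Module.finrank ℂ (𝒢.tgtTangent γ) = Module.finrank ℝ E - Module.finrank ℝ F :=
    HalfForms.finrank_ker 𝒢.submersion_tgt
  have htS : ∀ γ, Module.finrank ℂ (𝒢.srcTangent γ) = Module.finrank ℝ E - Module.finrank ℝ F :=
    HalfForms.finrank_ker 𝒢.submersion_src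
  have hPT : HalfForms.IsInvolutive (fun γ => P γ ⊔ 𝒢.tgtTangent γ) :=
    HalfForms.isInvolutive_sup_ker 𝒢.submersion_tgt hP.involutive hk hP.multiplicative.tgt_image
  have hPS : HalfForms.IsInvolutive (fun γ => P γ ⊔ 𝒢.srcTangent γ) :=
    HalfForms.isInvolutive_sup_ker 𝒢.submersion_src hP.involutive hkS hP.multiplicative.src_image
  have hB := HalfForms.isTheFlatConnection_bottConnection hP.involutive
  have hBT := hB.property.preservesAnnihilator hPd hPT fun γ => le_sup_left
  have hBS := hB.property.preservesAnnihilator hPd hPS fun γ => le_sup_left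
  obtain ⟨DT, hDT⟩ := HalfForms.exists_isTheFlatConnection_relDual hPd hTd hk hB.isPConnection
    hB.isFlat hBT
  obtain ⟨DS, hDS⟩ := HalfForms.exists_isTheFlatConnection_relDual hPd hSd hkS hB.isPConnection
    hB.isFlat hBS
  have hframe := HalfForms.exists_sumFrame hPd hTd hSd hk hkS htT htS hn
  -- The values of `directSumConnection` are those of `sumConnection` by definition, so the product
  -- rule obtained here is `IsWedgeInduced`.
  obtain ⟨DΩ, hDΩ⟩ := HalfForms.exists_isTheFlatConnection_wedge hframe
    (hDT.isPConnection.directSum hDS.isPConnection) (hDT.isFlat.directSum hDS.isFlat)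
  refine ⟨hPT, hPS, fun γ => ?_, _, DT, DS, DΩ, hB, hBT, hBS, hDT, hDS, hDΩ, ?_⟩
  · rw [Module.finrank_prod, HalfForms.finrank_relQuot, HalfForms.finrank_relQuot, hk, hkS, htT,
      htS, hn, two_mul]
  · intro L _ _ _ _ _ _ _ _ φ hφ
    refine HalfForms.exists_isTheFlatConnection_squareRoot
      (HalfForms.isSectionSheaf_form _ _ _ _) (fun γ => ?_) hφ hDΩ.isPConnection hDΩ.isFlat
    obtain ⟨V, A, B, β, hγ, hV⟩ := hframe γ
    exact ⟨V, _, _, hγ, hV.isLineFrame⟩
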